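/- Let $\tau,\eta\in\mathbb{C}$ with $\mathrm{Im}\,\tau>0$, $\mathrm{Im}\,\eta>0$, and let $1,2\eta,\tau$ be incommensurate (linearly independent over $\mathbb{Q}$). Put $p=e^{2\pi i\tau}$, $q=e^{4\pi i\eta}$, $(t;p)_\infty=\prod_{k\ge0}(1-tp^k)$, $$\theta_1(z|\tau)=-\sum_{n\in\mathbb{Z}}e^{\pi i(n+\frac12)^2\tau}e^{2\pi i(n+\frac12)(z+\frac12)},\qquad \theta_2(z|\tau)=\theta_1(z+\tfrac12|\tau),$$ $$\theta_3(z|\tau)=e^{\frac{\pi i\tau}{4}+\pi iz}\theta_2(z+\tfrac{\tau}{2}|\tau),\qquad \theta_4(z|\tau)=\theta_3(z+\tfrac12|\tau),$$ $$\Gamma(z)=\prod_{a,b\ge0}\frac{1-e^{-2\pi iz}p^{a+1}q^{b+1}}{1-e^{2\pi iz}p^aq^b},\qquad \mathrm{R}(\tau)=\frac{e^{-\pi i\tau/4}}{i\,(p;p)_\infty},\qquad c_A=\frac{e^{\pi i\eta}}{\mathrm{R}(\tau)},\qquad c_B=\frac{e^{\pi i\tau/2}}{\mathrm{R}(2\eta)}.$$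 For an entire function $\Phi$ with $\Phi(x+1)=\Phi(x)=\Phi(-x)$, let $[\mathrm{M}(g)\Phi](z)$ be the meromorphic continuation in $g$ of $$\frac{(q;q)_\infty(p;p)_\infty}{2}\int_0^1\frac{\Gamma(z+x-g)\Gamma(z-x-g)\Gamma(-z+x-g)\Gamma(-z-x-g)}{\Gamma(-2g)\Gamma(2x)\Gamma(-2x)}\,\Phi(x)\,dx,\qquad \mathrm{Im}(-g\pm z)>0 .$$ For $k\in\{3,4\}$, define difference operators $$\mathrm{A}_k(g)=e^{\pi i\frac{z^2}{\eta}}\frac{c_A}{\theta_1(2z|\tau)}\Bigl[\theta_k(z+g+\eta|\tfrac\tau2)e^{\eta\partial_z}-\theta_k(z-g-\eta|\tfrac\tau2)e^{-\eta\partial_z}\Bigr]e^{-\pi i\frac{z^2}{\eta}},$$ $$\mathrm{B}_k(g)=e^{2\pi i\frac{z^2}{\tau}}\frac{c_B}{\theta_1(2z|2\eta)}\Bigl[\theta_k(z+g+\tfrac\tau2|\eta)e^{\frac\tau2\partial_z}-\theta_k(z-g-\tfrac\tau2|\eta)e^{-\frac\tau2\partial_z}\Bigr]e^{-2\pi i\frac{z^2}{\tau}},$$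 and, for integers $n,m\ge0$, $$\mathrm{M}^{(k)}(n\eta+m\tfrac\tau2)=\mathrm{A}_k((n-1)\eta+m\tfrac\tau2)\cdots\mathrm{A}_k(m\tfrac\tau2)\,\mathrm{B}_k((m-1)\tfrac\tau2)\cdots\mathrm{B}_k(0)\,\theta_k^{-m}(z|\eta)\,\theta_k^{-n}(z|\tfrac\tau2).$$ Set $$\alpha^{(n)}_k(z)=c_A^n\,\frac{\prod_{j=1}^n\theta_1(2\eta j|\tau)}{\prod_{j=1}^k\theta_1(2\eta j|\tau)\prod_{j=1}^{n-k}\theta_1(2\eta j|\tau)}\cdot\frac{\theta_1(2z+2\eta(n-2k)|\tau)}{\prod_{j=0}^n\theta_1(2z-2\eta(k-j)|\tau)},$$ $$\beta^{(m)}_\ell(z)=c_B^m\,\frac{\prod_{j=1}^m\theta_1(\tau j|2\eta)}{\prod_{j=1}^\ell\theta_1(\tau j|2\eta)\prod_{j=1}^{m-\ell}\theta_1(\tau j|2\eta)}\cdot\frac{\theta_1(2z+\tau(m-2\ell)|2\eta)}{\prod_{j=0}^m\theta_1(2z-\tau(\ell-j)|2\eta)},$$ and let $\mathrm{S}_{n,m}$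 be the finite-difference operator $$\mathrm{S}_{n,m}=(-1)^{nm}e^{-\frac{\pi i\tau}{2}m^2n-\pi i\eta n^2m}\sum_{k=0}^n\sum_{\ell=0}^m(-1)^{k+\ell}\alpha^{(n)}_k(z)\,\beta^{(m)}_\ell(z)\;e^{(n-1)(m-2\ell)\left[\frac{\pi i\tau}{2}(m-2\ell)+2\pi i(z+(n-2k)\eta)\right]}$$ $$\qquad\cdot\;e^{(m-1)(n-2k)\left[\pi i\eta(n-2k)+2\pi i(z+(m-2\ell)\frac\tau2)\right]}\;e^{\left[(n-2k)\eta+(m-2\ell)\frac\tau2\right]\partial_z},$$ where $e^{s\partial_z}f(z)=f(z+s)$. Then, for all integers $n,m\ge0$: (1) for every entire $\Phi$ with $\Phi(x+1)=\Phi(x)=\Phi(-x)$ and every $z$ with $2z\notin\mathbb{Z}+\mathbb{Z}\tau+\mathbb{Z}2\eta$, the function $g\mapsto[\mathrm{M}(g)\Phi](z)$ is continued to a function that is meromorphic in a half-plane $\mathrm{Im}\,g<c$ containing $n\eta+m\frac\tau2$ and analytic at that point, and its value there is $[\mathrm{M}(n\eta+m\tfrac\tau2)\Phi](z)=[\mathrm{S}_{n,m}\Phi](z)$;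 (2) for $k=3,4$, $\mathrm{M}^{(k)}(n\eta+m\frac\tau2)=\mathrm{S}_{n,m}$ as finite-difference operators: $[\mathrm{M}^{(k)}(n\eta+m\tfrac\tau2)f](z)=[\mathrm{S}_{n,m}f](z)$ for every function $f:\mathbb{C}\to\mathbb{C}$ and every $z$ such that none of the numbers $\theta_1(2w|\tau)$, $\theta_1(2w|2\eta)$, $\theta_k(w|\frac\tau2)$, $\theta_k(w|\eta)$ vanishes for $w=z+r\eta+s\frac\tau2$ with integers $|r|\le n$, $|s|\le m$. In particular $\mathrm{M}^{(k)}$ does not depend on $k$. -/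

import Mathlib

noncomputable section

namespace EllipticDouble

open Complex
open scoped Real

/-! ### Theta functions and the elliptic gamma function -/

/-- The Jacobi theta function `θ₁(z|τ)`. -/
def theta1 (z τ : ℂ) : ℂ :=
  -∑' n : ℤ, exp (π * I * ((n : ℂ) + 1 / 2) ^ 2 * τ) *
    exp (2 * π * I * ((n : ℂ) + 1 / 2) * (z + 1 / 2))

/-- The Jacobi theta function `θ₂(z|τ)`. -/
def theta2 (z τ : ℂ) : ℂ := theta1 (z + 1 / 2) τ

/-- The Jacobi theta function `θ₃(z|τ)`. -/
def theta3 (z τ : ℂ) : ℂ := exp (π * I * τ / 4 + π * I * z) * theta2 (z + τ / 2) τ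

/-- The Jacobi theta function `θ₄(z|τ)`. -/
def theta4 (z τ : ℂ) : ℂ := theta3 (z + 1 / 2) τ

/-- `θ_k(z|τ)` for `k = 3, 4`, the two values for which it is used. -/
def thetaK (k : ℕ) (z τ : ℂ) : ℂ := if k = 3 then theta3 z τ else theta4 z τ

/-- The infinite product `(p;p)_∞` with `p = e^{2πiτ}`. -/
def qPoch (τ : ℂ) : ℂ := ∏' k : ℕ, (1 - exp (2 * π * I * τ) ^ (k + 1))

/-- The constant `R(τ) = p^{-1/8} / (i (p;p)_∞)` with `p = e^{2πiτ}`. -/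
def constR (τ : ℂ) : ℂ := exp (-(π * I * τ / 4)) / (I * qPoch τ)

/-- The elliptic gamma function `Γ(z|τ,2η)`, with `p = e^{2πiτ}` and `q = e^{4πiη}`. -/
def ellGamma (τ η z : ℂ) : ℂ :=
  ∏' nm : ℕ × ℕ,
    (1 - exp (-(2 * π * I * z)) * exp (2 * π * I * τ) ^ (nm.1 + 1) *
        exp (4 * π * I * η) ^ (nm.2 + 1)) /
      (1 - exp (2 * π * I * z) * exp (2 * π * I * τ) ^ nm.1 * exp (4 * π * I * η) ^ nm.2)

/-! ### The integral operator `M(g)` -/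

/-- The integral
`(q;q)_∞ (p;p)_∞ / 2 · ∫₀¹ Γ(±z±x-g) / Γ(-2g,±2x) Φ(x) dx`,
which represents `[M(g)Φ](z)` when `Im(-g±z) > 0`. -/
def intertwinerIntegral (τ η g : ℂ) (Φ : ℂ → ℂ) (z : ℂ) : ℂ :=
  qPoch (2 * η) * qPoch τ / 2 *
    ∫ x in (0 : ℝ)..1,
      (ellGamma τ η (z + x - g) * ellGamma τ η (z - x - g) *
          ellGamma τ η (-z + x - g) * ellGamma τ η (-z - x - g)) /
        (ellGamma τ η (-2 * g) * ellGamma τ η (2 * x) * ellGamma τ η (-2 * x)) * Φ x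

/-- `IntertwinerValue τ η g Φ z v` says that `[M(g)Φ](z) = v`, where `[M(g)Φ](z)` is the analytic
continuation in `g` of the integral above: there is a meromorphic function `F` on a half-plane
`Im s < c` containing `g`, equal to the integral wherever `Im(-s±z) > 0` (except at the isolated
zeros of the denominator `Γ(-2s)`), analytic at `g`, with `F g = v`.
As the half-plane is connected, the identity theorem makes `v` unique. -/
def IntertwinerValue (τ η g : ℂ) (Φ : ℂ → ℂ) (z v : ℂ) : Prop :=
  ∃ (c : ℝ) (F : ℂ → ℂ), g.im < c ∧ MeromorphicOn F {s : ℂ | s.im < c} ∧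
    (∀ s : ℂ, s.im < c → 0 < (-s + z).im → 0 < (-s - z).im → ellGamma τ η (-2 * s) ≠ 0 →
      F s = intertwinerIntegral τ η s Φ z) ∧
    AnalyticAt ℂ F g ∧ F g = v

/-! ### The factorized operator -/

/-- The constant `c_A`. -/
def constA (τ η : ℂ) : ℂ := exp (π * I * η) / constR τ

/-- The constant `c_B`. -/
def constB (τ η : ℂ) : ℂ := exp (π * I * (τ / 2)) / constR (2 * η)

/-- The difference operator
`A_k(g) = e^{πiz²/η} (c_A/θ₁(2z|τ)) [θ_k(z+g+η|τ/2) e^{η∂} - θ_k(z-g-η|τ/2) e^{-η∂}] e^{-πiz²/η}`. -/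
def opA (τ η : ℂ) (k : ℕ) (g : ℂ) (f : ℂ → ℂ) (z : ℂ) : ℂ :=
  exp (π * I * z ^ 2 / η) * (constA τ η / theta1 (2 * z) τ) *
    (thetaK k (z + g + η) (τ / 2) * (exp (-(π * I * (z + η) ^ 2 / η)) * f (z + η)) -
      thetaK k (z - g - η) (τ / 2) * (exp (-(π * I * (z - η) ^ 2 / η)) * f (z - η)))

/-- The difference operator
`B_k(g) = e^{2πiz²/τ} (c_B/θ₁(2z|2η)) [θ_k(z+g+τ/2|η) e^{τ∂/2} - θ_k(z-g-τ/2|η) e^{-τ∂/2}]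
e^{-2πiz²/τ}`. -/
def opB (τ η : ℂ) (k : ℕ) (g : ℂ) (f : ℂ → ℂ) (z : ℂ) : ℂ :=
  exp (2 * π * I * z ^ 2 / τ) * (constB τ η / theta1 (2 * z) (2 * η)) *
    (thetaK k (z + g + τ / 2) η * (exp (-(2 * π * I * (z + τ / 2) ^ 2 / τ)) * f (z + τ / 2)) -
      thetaK k (z - g - τ / 2) η * (exp (-(2 * π * I * (z - τ / 2) ^ 2 / τ)) * f (z - τ / 2)))

/-- The product `A_k(g+(n-1)η) ⋯ A_k(g+η) A_k(g)`. -/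
def prodA (τ η : ℂ) (k : ℕ) (g : ℂ) : ℕ → (ℂ → ℂ) → (ℂ → ℂ)
  | 0, f => f
  | n + 1, f => opA τ η k (g + n * η) (prodA τ η k g n f)

/-- The product `B_k(g+(m-1)τ/2) ⋯ B_k(g+τ/2) B_k(g)`. -/
def prodB (τ η : ℂ) (k : ℕ) (g : ℂ) : ℕ → (ℂ → ℂ) → (ℂ → ℂ)
  | 0, f => f
  | m + 1, f => opB τ η k (g + m * (τ / 2)) (prodB τ η k g m f)

/-- The factorized operator `M^{(k)}(nη+mτ/2)`:
`A_k((n-1)η+mτ/2) ⋯ A_k(mτ/2) B_k((m-1)τ/2) ⋯ B_k(0) θ_k(z|η)^{-m} θ_k(z|τ/2)^{-n}`. -/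
def factorizedM (τ η : ℂ) (k n m : ℕ) (f : ℂ → ℂ) : ℂ → ℂ :=
  prodA τ η k (m * (τ / 2)) n
    (prodB τ η k 0 m fun w => f w / (thetaK k w η ^ m * thetaK k w (τ / 2) ^ n))

/-- None of the theta functions by which `factorizedM τ η k n m f z` divides vanishes. The set of
such `z` is the complement of a closed discrete set. -/
def RegularPoint (τ η : ℂ) (k n m : ℕ) (z : ℂ) : Prop :=
  ∀ i j : ℤ, |i| ≤ n → |j| ≤ m →
    theta1 (2 * (z + i * η + j * (τ / 2))) τ ≠ 0 ∧
    theta1 (2 * (z + i * η + j * (τ / 2))) (2 * η) ≠ 0 ∧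
    thetaK k (z + i * η + j * (τ / 2)) (τ / 2) ≠ 0 ∧
    thetaK k (z + i * η + j * (τ / 2)) η ≠ 0

/-! ### The normal ordered form -/

/-- The elliptic binomial coefficient with modulus `τ` and step `h`. -/
def ellBinom (τ h : ℂ) (n l : ℕ) : ℂ :=
  (∏ j ∈ Finset.Icc 1 n, theta1 (h * j) τ) /
    ((∏ j ∈ Finset.Icc 1 l, theta1 (h * j) τ) * ∏ j ∈ Finset.Icc 1 (n - l), theta1 (h * j) τ)

/-- The coefficient `α_l^{(n)}(z)`, for `l ≤ n`. -/
def alphaCoeff (τ η : ℂ) (n l : ℕ) (z : ℂ) : ℂ :=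
  constA τ η ^ n * ellBinom τ (2 * η) n l *
    (theta1 (2 * z + 2 * η * ((n : ℂ) - 2 * l)) τ /
      ∏ j ∈ Finset.range (n + 1), theta1 (2 * z - 2 * η * ((l : ℂ) - j)) τ)

/-- The coefficient `β_l^{(m)}(z)`, for `l ≤ m`. -/
def betaCoeff (τ η : ℂ) (m l : ℕ) (z : ℂ) : ℂ :=
  constB τ η ^ m * ellBinom (2 * η) τ m l *
    (theta1 (2 * z + τ * ((m : ℂ) - 2 * l)) (2 * η) /
      ∏ j ∈ Finset.range (m + 1), theta1 (2 * z - τ * ((l : ℂ) - j)) (2 * η))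

/-- The normal ordered finite-difference operator, all shift operators standing on the right. -/
def normalOrderedM (τ η : ℂ) (n m : ℕ) (f : ℂ → ℂ) (z : ℂ) : ℂ :=
  (-1) ^ (n * m) * exp (-(π * I * τ / 2 * m ^ 2 * n) - π * I * η * n ^ 2 * m) *
    ∑ k ∈ Finset.range (n + 1), (-1) ^ k * alphaCoeff τ η n k z *
      ∑ l ∈ Finset.range (m + 1), (-1) ^ l * betaCoeff τ η m l z *
        exp (((n : ℂ) - 1) * ((m : ℂ) - 2 * l) *
          (π * I * τ / 2 * ((m : ℂ) - 2 * l) + 2 * π * I * (z + ((n : ℂ) - 2 * k) * η))) *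
        exp (((m : ℂ) - 1) * ((n : ℂ) - 2 * k) *
          (π * I * η * ((n : ℂ) - 2 * k) + 2 * π * I * (z + ((m : ℂ) - 2 * l) * (τ / 2)))) *
        f (z + (((n : ℂ) - 2 * k) * η + ((m : ℂ) - 2 * l) * (τ / 2)))

end EllipticDouble

end

/-!
The product `A_k((n-1)η) ⋯ A_k(0)` is normal ordered by induction on `n`: its coefficients satisfy
a Pascal type recursion, which is the three-term relation between `θ₁(· | τ)` and `θ_k(· | τ/2)`.
Exchanging `(τ, 2η)` and `(2η, τ)` turns `B_k` into `A_k`, and quasi-periodicity moves the `A`s past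
the theta functions in the `B`s; in the composition all `θ_k` cancel.

For the integral, the Fourier variable `e(x)` makes the integrand an even 1-periodic function
divided by finitely many factors `(1 - t e(x)) (1 - t / e(x))`. Partial fractions in
`e(x) + 1 / e(x)` leave one integral for each pole; shifting its contour upwards continues that
integral in `g`. At `g = nη + mτ/2` the prefactor `1 / Γ(-2g)` vanishes, so only the poles that
pinch the contour in pairs contribute, through their residues. These pairs are labelled by the
`(n + 1)(m + 1)` lattice points `aτ + b(2η)` with `a ≤ m`, `b ≤ n`. By the functional equations of
`Γ` and the Jacobi triple product each residue is a quotient of theta functions, namely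
`α_k^{(n)} β_l^{(m)}` up to a phase.
-/

noncomputable section

namespace EllipticDouble

open Complex Filter Topology MeasureTheory
open scoped Real

/-- The coordinate `e^{2πiz}` on `ℂ/ℤ`, in which theta functions and `Γ` are infinite products. -/
local notation "e(" z ")" => Complex.exp (2 * π * I * z)

/-! ### Infinite products `∏ (1 - w rᵢ)` -/

/-- The infinite product `∏ᵢ (1 - w rᵢ)`, as a function of `w`. -/
def prodOneSub {ι : Type*} (r : ι → ℂ) (w : ℂ) : ℂ := ∏' i, (1 - w * r i)

section prodOneSub

variable {ι : Type*} {r : ι → ℂ}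

theorem hasProd_prodOneSub (hr : Summable fun i => ‖r i‖) (w : ℂ) :
    HasProd (fun i => 1 - w * r i) (prodOneSub r w) := by
  have h : Summable fun i => ‖-(w * r i)‖ := by
    simpa only [norm_neg, norm_mul] using hr.mul_left ‖w‖
  have hprod := (multipliable_one_add_of_summable h).hasProd
  simp only [← sub_eq_add_neg] at hprod
  exact hprod

theorem prodOneSub_eq_zero_iff (hr : Summable fun i => ‖r i‖) (w : ℂ) :
    prodOneSub r w = 0 ↔ ∃ i, w * r i = 1 := by
  constructor
  · intro h
    by_contra! hne
    refine tprod_one_add_ne_zero_of_summable (f := fun i => -(w * r i)) (fun i => ?_) ?_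
      (by simpa only [prodOneSub, sub_eq_add_neg] using h)
    · rw [← sub_eq_add_neg]
      exact sub_ne_zero.mpr (hne i).symm
    · simpa only [norm_neg, norm_mul] using hr.mul_left ‖w‖
  · rintro ⟨i, hi⟩
    exact (hasProd_prodOneSub hr w).unique (hasProd_zero_of_exists_eq_zero ⟨i, by simp [hi]⟩)

theorem prodOneSub_ne_zero (hr : Summable fun i => ‖r i‖) {w : ℂ} (hw : ∀ i, ‖w * r i‖ < 1) :
    prodOneSub r w ≠ 0 := fun h => by
  obtain ⟨i, hi⟩ := (prodOneSub_eq_zero_iff hr w).1 h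
  exact (hw i).ne (by rw [hi, norm_one])

theorem differentiable_prodOneSub (hr : Summable fun i => ‖r i‖) :
    Differentiable ℂ (prodOneSub r) := by
  intro w
  have hopen : IsOpen (Metric.ball (0 : ℂ) (‖w‖ + 1)) := Metric.isOpen_ball
  have hbound : ∀ i, ∀ v ∈ Metric.ball (0 : ℂ) (‖w‖ + 1),
      ‖-(v * r i)‖ ≤ (‖w‖ + 1) * ‖r i‖ := fun i v hv => by
    rw [norm_neg, norm_mul]
    exact mul_le_mul_of_nonneg_right (mem_ball_zero_iff.1 hv).le (norm_nonneg _)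
  have hunif := Summable.hasProdLocallyUniformlyOn_one_add
    (f := fun i (v : ℂ) => -(v * r i)) hopen (hr.mul_left (‖w‖ + 1))
    (Eventually.of_forall hbound) (fun i => by fun_prop)
  have hdiff := hunif.differentiableOn
    (Eventually.of_forall fun s => .fun_finsetProd fun i _ => by fun_prop) hopen
  simp only [← sub_eq_add_neg] at hdiff
  exact hdiff.differentiableAt (hopen.mem_nhds (by simp))

theorem prodOneSub_of_isCompl {α β : Type*} {f : α → ι} {g : β → ι}
    (hr : Summable fun i => ‖r i‖) (hf : f.Injective) (hg : g.Injective)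
    (h : IsCompl (Set.range f) (Set.range g)) (w : ℂ) :
    prodOneSub r w = prodOneSub (r ∘ f) w * prodOneSub (r ∘ g) w := by
  have hf' : HasProd ((fun i => 1 - w * r i) ∘ f) (prodOneSub (r ∘ f) w) :=
    hasProd_prodOneSub (hr.comp_injective hf) w
  have hg' : HasProd ((fun i => 1 - w * r i) ∘ g) (prodOneSub (r ∘ g) w) :=
    hasProd_prodOneSub (hr.comp_injective hg) w
  exact (hasProd_prodOneSub hr w).unique
    ((hf.hasProd_range_iff.2 hf').mul_isCompl h (hg.hasProd_range_iff.2 hg'))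

theorem summable_norm_ite_zero (hr : Summable fun i => ‖r i‖) (P : ι → Prop) [DecidablePred P] :
    Summable fun i => ‖if P i then 0 else r i‖ :=
  hr.of_nonneg_of_le (fun _ => norm_nonneg _) fun i => by split_ifs <;> simp

theorem prodOneSub_ite_eq_prod_mul [DecidableEq ι] (hr : Summable fun i => ‖r i‖)
    {s t : Finset ι} (hst : s ⊆ t) (w : ℂ) :
    prodOneSub (fun i => if i ∈ s then 0 else r i) w =
      (∏ i ∈ t \ s, (1 - w * r i)) * prodOneSub (fun i => if i ∈ t then 0 else r i) w := by
  have hfin : HasProd (fun i => if i ∈ t \ s then 1 - w * r i else 1)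
      (∏ i ∈ t \ s, if i ∈ t \ s then 1 - w * r i else 1) :=
    hasProd_prod_of_ne_finset_one fun i hi => if_neg hi
  rw [Finset.prod_congr rfl fun i hi => if_pos hi] at hfin
  refine (hasProd_prodOneSub (summable_norm_ite_zero hr _) w).unique
    ((hfin.mul (hasProd_prodOneSub (summable_norm_ite_zero hr _) w)).congr_fun fun i => ?_)
  by_cases hi : i ∈ t <;> by_cases hi' : i ∈ s
  · simp [hi, hi']
  · simp [hi, hi']
  · exact absurd (hst hi') hi
  · simp [hi, hi']

theorem prodOneSub_const_mul (c w : ℂ) :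
    prodOneSub (fun i => c * r i) w = prodOneSub r (c * w) := by
  simp only [prodOneSub, mul_left_comm w, mul_assoc]

end prodOneSub

/-- The product `(w;p)_∞ = ∏_k (1 - w p^k)`. -/
def qProd (p w : ℂ) : ℂ := prodOneSub (fun k : ℕ => p ^ k) w

/-- The double product `(w;p,q)_∞ = ∏_{a,b} (1 - w p^a q^b)`. -/
def pqProd (p q w : ℂ) : ℂ := prodOneSub (fun j : ℕ × ℕ => p ^ j.1 * q ^ j.2) w

/-- The modified theta function `(w;p)_∞ (p/w;p)_∞`. -/
def modTheta (p w : ℂ) : ℂ := qProd p w * qProd p (p / w)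

section qProd

variable {p q : ℂ}

theorem summable_norm_pow (hp : ‖p‖ < 1) : Summable fun k : ℕ => ‖p ^ k‖ := by
  simpa only [norm_pow] using summable_geometric_of_lt_one (norm_nonneg p) hp

theorem summable_norm_pow_mul_pow (hp : ‖p‖ < 1) (hq : ‖q‖ < 1) :
    Summable fun j : ℕ × ℕ => ‖p ^ j.1 * q ^ j.2‖ := by
  simpa only [norm_mul] using (summable_norm_pow hp).mul_of_nonneg (summable_norm_pow hq)
    (fun _ => norm_nonneg _) (fun _ => norm_nonneg _)

theorem qProd_eq_one_sub_mul (hp : ‖p‖ < 1) (w : ℂ) :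
    qProd p w = (1 - w) * qProd p (p * w) := by
  have hcompl : IsCompl (Set.range fun _ : Unit => 0) (Set.range Nat.succ) := by
    rw [Set.range_const, Nat.range_succ]
    refine IsCompl.of_eq (Set.eq_empty_of_forall_notMem ?_) (Set.eq_univ_of_forall ?_)
    · rintro x ⟨rfl, hx⟩
      exact lt_irrefl 0 (Set.mem_ofPred.1 hx)
    · exact fun k => k.eq_zero_or_pos
  rw [qProd, prodOneSub_of_isCompl (summable_norm_pow hp) (fun _ _ _ => rfl) Nat.succ_injective
    hcompl, qProd, ← prodOneSub_const_mul]
  simp [prodOneSub, pow_succ']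

theorem pqProd_comm (p q w : ℂ) : pqProd p q w = pqProd q p w := by
  rw [pqProd, prodOneSub, ← (Equiv.prodComm ℕ ℕ).tprod_eq]
  simp only [Equiv.prodComm_apply, Prod.fst_swap, Prod.snd_swap, mul_comm (p ^ _), pqProd,
    prodOneSub]

theorem pqProd_eq_qProd_mul_right (hp : ‖p‖ < 1) (hq : ‖q‖ < 1) (w : ℂ) :
    pqProd p q w = qProd p w * pqProd p q (q * w) := by
  have hcompl : IsCompl (Set.range fun k : ℕ => (k, 0))
      (Set.range fun j : ℕ × ℕ => (j.1, j.2 + 1)) := by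
    refine IsCompl.of_eq (Set.eq_empty_of_forall_notMem ?_) (Set.eq_univ_of_forall ?_)
    · rintro x ⟨⟨k, rfl⟩, ⟨j, hj⟩⟩
      exact Nat.succ_ne_zero _ (congrArg Prod.snd hj)
    · rintro ⟨a, _ | b⟩
      exacts [Or.inl ⟨a, rfl⟩, Or.inr ⟨(a, b), rfl⟩]
  rw [pqProd, prodOneSub_of_isCompl (summable_norm_pow_mul_pow hp hq)
    (fun _ _ h => congrArg Prod.fst h) (fun a b h => by simpa [Prod.ext_iff] using h) hcompl,
    pqProd, ← prodOneSub_const_mul]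
  congr 2
  · ext k
    simp
  · ext j
    simp only [Function.comp_apply, pow_succ']
    ring

theorem pqProd_eq_qProd_mul_left (hp : ‖p‖ < 1) (hq : ‖q‖ < 1) (w : ℂ) :
    pqProd p q w = qProd q w * pqProd p q (p * w) := by
  rw [pqProd_comm, pqProd_eq_qProd_mul_right hq hp, pqProd_comm]

theorem qProd_eq_zero_iff (hp : ‖p‖ < 1) (w : ℂ) : qProd p w = 0 ↔ ∃ k : ℕ, w * p ^ k = 1 :=
  prodOneSub_eq_zero_iff (summable_norm_pow hp) w

theorem qProd_ne_zero (hp : ‖p‖ < 1) {w : ℂ} (hw : ‖w‖ < 1) : qProd p w ≠ 0 :=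
  prodOneSub_ne_zero (summable_norm_pow hp) fun k => by
    rw [norm_mul, norm_pow]
    exact mul_lt_one_of_nonneg_of_lt_one_left (norm_nonneg w) hw
      (pow_le_one₀ (norm_nonneg p) hp.le)

theorem differentiable_qProd (hp : ‖p‖ < 1) : Differentiable ℂ (qProd p) :=
  differentiable_prodOneSub (summable_norm_pow hp)

theorem tendsto_prod_one_sub_mul_pow (hp : ‖p‖ < 1) (w : ℂ) :
    Tendsto (fun n => ∏ k ∈ Finset.range n, (1 - w * p ^ k)) atTop (𝓝 (qProd p w)) :=
  (hasProd_prodOneSub (summable_norm_pow hp) w).tendsto_prod_nat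

end qProd

/-! ### The Jacobi triple product -/

section GaussBinom

variable {K : Type*} [Field K] {p : K}

/-- The finite product `(p;p)_n = (1 - p)(1 - p²)⋯(1 - pⁿ)`. -/
def qFact (p : K) (n : ℕ) : K := ∏ i ∈ Finset.range n, (1 - p ^ (i + 1))

/-- The Gaussian binomial coefficient `(p;p)_n / ((p;p)_k (p;p)_{n-k})`, meaningful for `k ≤ n`. -/
def gaussBinom (p : K) (n k : ℕ) : K := qFact p n / (qFact p k * qFact p (n - k))

theorem qFact_succ (n : ℕ) : qFact p (n + 1) = qFact p n * (1 - p ^ (n + 1)) :=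
  Finset.prod_range_succ _ _

theorem qFact_ne_zero (hp : ∀ k : ℕ, 1 - p ^ (k + 1) ≠ 0) (n : ℕ) : qFact p n ≠ 0 :=
  Finset.prod_ne_zero_iff.mpr fun i _ => hp i

theorem gaussBinom_zero_right (hp : ∀ k : ℕ, 1 - p ^ (k + 1) ≠ 0) (n : ℕ) :
    gaussBinom p n 0 = 1 := by
  have hzero : qFact p 0 = 1 := Finset.prod_range_zero _
  rw [gaussBinom, Nat.sub_zero, hzero, one_mul, div_self (qFact_ne_zero hp n)]

theorem gaussBinom_self (hp : ∀ k : ℕ, 1 - p ^ (k + 1) ≠ 0) (n : ℕ) : gaussBinom p n n = 1 := by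
  have hzero : qFact p 0 = 1 := Finset.prod_range_zero _
  rw [gaussBinom, Nat.sub_self, hzero, mul_one, div_self (qFact_ne_zero hp n)]

theorem gaussBinom_succ_succ (hp : ∀ k : ℕ, 1 - p ^ (k + 1) ≠ 0) {n k : ℕ} (h : k + 1 ≤ n) :
    gaussBinom p (n + 1) (k + 1) = gaussBinom p n (k + 1) + p ^ (n - k) * gaussBinom p n k := by
  obtain ⟨d, rfl⟩ := Nat.exists_eq_add_of_le h
  have hsub₁ : k + 1 + d + 1 - (k + 1) = d + 1 := by omega
  have hsub₂ : k + 1 + d - (k + 1) = d := by omega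
  have hsub₃ : k + 1 + d - k = d + 1 := by omega
  simp only [gaussBinom, hsub₁, hsub₂, hsub₃, qFact_succ]
  have := qFact_ne_zero hp k
  have := qFact_ne_zero hp d
  have := hp k
  have := hp d
  field_simp
  ring

theorem prod_one_add_mul_pow_eq_sum_gaussBinom (hp : ∀ k : ℕ, 1 - p ^ (k + 1) ≠ 0) (x : K)
    (n : ℕ) : ∏ k ∈ Finset.range n, (1 + x * p ^ k) =
      ∑ k ∈ Finset.range (n + 1), p ^ k.choose 2 * gaussBinom p n k * x ^ k := by
  induction n with
  | zero => simp [gaussBinom, qFact]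
  | succ n ih =>
    have hpascal : ∀ k ∈ Finset.range n,
        p ^ (k + 1).choose 2 * gaussBinom p (n + 1) (k + 1) * x ^ (k + 1) =
          p ^ (k + 1).choose 2 * gaussBinom p n (k + 1) * x ^ (k + 1) +
          p ^ k.choose 2 * gaussBinom p n k * x ^ k * (x * p ^ n) := by
      intro k hk
      have hk' : k + 1 ≤ n := Finset.mem_range.mp hk
      rw [gaussBinom_succ_succ hp hk', Nat.choose_succ_succ' k 1, Nat.choose_one_right, pow_add,
        ← pow_sub_mul_pow p (Nat.le_of_succ_le hk')]
      ring
    rw [Finset.prod_range_succ, ih, mul_add, mul_one, Finset.sum_range_succ' _ (n + 1),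
      Finset.sum_range_succ (fun k => p ^ (k + 1).choose 2 * _ * _) n,
      Finset.sum_congr rfl hpascal, Finset.sum_add_distrib,
      ← Finset.sum_mul]
    nth_rewrite 1 [Finset.sum_range_succ' _ n]
    rw [Finset.sum_range_succ (fun k => p ^ k.choose 2 * gaussBinom p n k * x ^ k) n]
    simp only [gaussBinom_zero_right hp, gaussBinom_self hp, Nat.choose_succ_succ' n 1,
      Nat.choose_one_right, pow_add]
    ring

theorem mul_prod_one_sub_div_pow (hp₀ : p ≠ 0) {w : K} (hw : w ≠ 0) {T : ℤ → K} (hT₀ : T 0 = 1)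
    (hT : ∀ j, T (j + 1) = -w * p ^ j * T j) (N : ℕ) :
    T (-N) * ∏ k ∈ Finset.range N, (1 - w / p ^ (k + 1)) =
      ∏ k ∈ Finset.range N, (1 - p / w * p ^ k) := by
  induction N with
  | zero => simp [hT₀]
  | succ N ih =>
    have hstep := hT (-(N + 1 : ℕ))
    rw [Nat.cast_succ, neg_add, neg_add_cancel_right, ← neg_add, zpow_neg, ← Nat.cast_succ,
      zpow_natCast] at hstep
    rw [Finset.prod_range_succ, Finset.prod_range_succ, ← ih, hstep]
    field_simp
    ring

theorem prod_mul_prod_eq_sum_gaussBinom (hp : ∀ k : ℕ, 1 - p ^ (k + 1) ≠ 0) (hp₀ : p ≠ 0)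
    {w : K} (hw : w ≠ 0) {T : ℤ → K} (hT₀ : T 0 = 1) (hT : ∀ j, T (j + 1) = -w * p ^ j * T j)
    (N : ℕ) :
    (∏ k ∈ Finset.range N, (1 - w * p ^ k)) * ∏ k ∈ Finset.range N, (1 - p / w * p ^ k) =
      ∑ k ∈ Finset.range (2 * N + 1), T (k - N) * gaussBinom p (2 * N) k := by
  set x : K := -w * p ^ (-N : ℤ) with hx
  have hterm : ∀ k : ℕ, T (k - N) = T (-N) * (p ^ k.choose 2 * x ^ k) := fun k => by
    induction k with
    | zero => simp
    | succ k ih =>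
      rw [Nat.cast_succ, add_sub_right_comm, hT, ih, Nat.choose_succ_succ' k 1,
        Nat.choose_one_right, pow_add, hx, zpow_sub₀ hp₀, zpow_neg]
      simp only [zpow_natCast]
      ring
  have hlow : ∏ k ∈ Finset.range N, (1 + x * p ^ k) =
      ∏ k ∈ Finset.range N, (1 - w / p ^ (k + 1)) := by
    rw [← Finset.prod_range_reflect]
    refine Finset.prod_congr rfl fun k hk => ?_
    rw [hx, zpow_neg, zpow_natCast, ← pow_sub_mul_pow p (Finset.mem_range.mp hk), Nat.sub_sub,
      add_comm 1 k]
    field_simp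
    ring
  have hhigh : ∏ k ∈ Finset.range N, (1 + x * p ^ (N + k)) =
      ∏ k ∈ Finset.range N, (1 - w * p ^ k) := by
    refine Finset.prod_congr rfl fun k _ => ?_
    rw [hx, zpow_neg, zpow_natCast, pow_add]
    field_simp
    ring
  simp only [hterm, ← mul_prod_one_sub_div_pow hp₀ hw hT₀ hT, mul_assoc, ← Finset.mul_sum]
  rw [mul_left_comm, ← hhigh, ← hlow, mul_comm (∏ k ∈ _, (1 + x * p ^ (N + k))),
    ← Finset.prod_range_add, ← two_mul, prod_one_add_mul_pow_eq_sum_gaussBinom hp]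
  simp only [mul_assoc, mul_comm (x ^ _)]

end GaussBinom

section Tendsto

variable {p : ℂ}

theorem one_sub_pow_succ_ne_zero (hp : ‖p‖ < 1) (k : ℕ) : 1 - p ^ (k + 1) ≠ 0 := by
  intro h
  refine (pow_lt_one₀ (norm_nonneg p) hp k.succ_ne_zero).ne ?_
  rw [← norm_pow, ← sub_eq_zero.mp h, norm_one]

theorem tendsto_qFact (hp : ‖p‖ < 1) : Tendsto (qFact p) atTop (𝓝 (qProd p p)) := by
  have h := tendsto_prod_one_sub_mul_pow hp p
  simp only [← pow_succ'] at h
  exact h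

theorem tendsto_gaussBinom (hp : ‖p‖ < 1) {α : Type*} {l : Filter α} {n k : α → ℕ}
    (hn : Tendsto n l atTop) (hk : Tendsto k l atTop)
    (hnk : Tendsto (fun i => n i - k i) l atTop) :
    Tendsto (fun i => gaussBinom p (n i) (k i)) l (𝓝 (qProd p p)⁻¹) := by
  have hne := qProd_ne_zero hp hp
  have hfact := tendsto_qFact hp
  rw [← div_mul_cancel_left₀ hne (qProd p p)]
  exact (hfact.comp hn).div ((hfact.comp hk).mul (hfact.comp hnk)) (mul_ne_zero hne hne)

theorem exists_norm_gaussBinom_le (hp : ‖p‖ < 1) : ∃ C, ∀ n k, ‖gaussBinom p n k‖ ≤ C := by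
  obtain ⟨M, hM⟩ := (tendsto_qFact hp).norm.bddAbove_range
  obtain ⟨D, hD⟩ := ((tendsto_qFact hp).inv₀ (qProd_ne_zero hp hp)).norm.bddAbove_range
  have hM' : ∀ n, ‖qFact p n‖ ≤ M := fun n => hM ⟨n, rfl⟩
  have hD' : ∀ n, ‖(qFact p n)⁻¹‖ ≤ D := fun n => hD ⟨n, rfl⟩
  have hM₀ := (norm_nonneg _).trans (hM' 0)
  have hD₀ := (norm_nonneg _).trans (hD' 0)
  refine ⟨M * (D * D), fun n k => ?_⟩
  rw [gaussBinom, div_eq_mul_inv, mul_inv, norm_mul, norm_mul]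
  exact mul_le_mul (hM' n) (mul_le_mul (hD' k) (hD' (n - k)) (norm_nonneg _) hD₀) (by positivity)
    hM₀

theorem tendsto_sum_mul_gaussBinom (hp : ‖p‖ < 1) {T : ℤ → ℂ} (hT : Summable fun j => ‖T j‖) :
    Tendsto (fun N : ℕ => ∑ k ∈ Finset.range (2 * N + 1), T (k - N) * gaussBinom p (2 * N) k) atTop
      (𝓝 ((∑' j, T j) * (qProd p p)⁻¹)) := by
  obtain ⟨C, hC⟩ := exists_norm_gaussBinom_le hp
  let f : ℕ → ℤ → ℂ := fun N j =>
    if j ∈ Finset.Icc (-N : ℤ) N then T j * gaussBinom p (2 * N) (j + N).toNat else 0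
  have hf : ∀ N : ℕ, ∑' j, f N j =
      ∑ k ∈ Finset.range (2 * N + 1), T (k - N) * gaussBinom p (2 * N) k := fun N => by
    rw [tsum_eq_sum (s := Finset.Icc (-N : ℤ) N) fun j hj => if_neg hj]
    refine Finset.sum_bij' (fun j _ => (j + N).toNat) (fun k _ => (k : ℤ) - N)
      (by grind) (by grind) (by grind) (by grind) fun j hj => ?_
    rw [if_pos hj, Int.toNat_of_nonneg (by grind), add_sub_cancel_right]
  simp only [← hf, ← tsum_mul_right]
  refine tendsto_tsum_of_dominated_convergence (bound := fun j => ‖T j‖ * C) (hT.mul_right C)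
    (fun j => ?_) (Eventually.of_forall fun N j => ?_)
  · have hlim : Tendsto (fun N : ℕ => gaussBinom p (2 * N) (j + N).toNat) atTop
        (𝓝 (qProd p p)⁻¹) := by
      refine tendsto_gaussBinom hp ?_ ?_ ?_ <;> refine tendsto_atTop.2 fun b => ?_ <;>
      filter_upwards [eventually_ge_atTop (b + j.natAbs)] with N hN <;> omega
    refine (hlim.const_mul (T j)).congr' ?_
    filter_upwards [eventually_ge_atTop j.natAbs] with N hN
    exact (if_pos (Finset.mem_Icc.mpr (by omega))).symm
  · dsimp only [f]
    split_ifs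
    · rw [norm_mul]
      exact mul_le_mul_of_nonneg_left (hC _ _) (norm_nonneg _)
    · rw [norm_zero]
      exact mul_nonneg (norm_nonneg _) ((norm_nonneg _).trans (hC 0 0))

end Tendsto

theorem norm_exp_two_pi_I_mul (τ : ℂ) : ‖e(τ)‖ = Real.exp (-(2 * π * τ.im)) := by
  rw [norm_exp]
  congr 1
  simp

theorem norm_exp_two_pi_I_mul_lt_one {τ : ℂ} (hτ : 0 < τ.im) : ‖e(τ)‖ < 1 := by
  rw [norm_exp_two_pi_I_mul, Real.exp_lt_one_iff, neg_lt_zero]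
  positivity

theorem qPoch_eq_qProd (τ : ℂ) : qPoch τ = qProd e(τ) e(τ) := by
  simp only [qPoch, qProd, prodOneSub, pow_succ']

theorem qPoch_ne_zero {τ : ℂ} (hτ : 0 < τ.im) : qPoch τ ≠ 0 := by
  rw [qPoch_eq_qProd]
  exact qProd_ne_zero (norm_exp_two_pi_I_mul_lt_one hτ) (norm_exp_two_pi_I_mul_lt_one hτ)

theorem jacobiTheta₂_term_eq (j : ℤ) (x τ : ℂ) :
    jacobiTheta₂_term j x τ = exp (2 * π * I * j * x + π * I * j ^ 2 * τ) := rfl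

theorem neg_exp (x : ℂ) : -exp x = exp (x + π * I) := (exp_antiperiodic x).symm

theorem jacobiTheta₂_triple_product {τ : ℂ} (hτ : 0 < τ.im) (x : ℂ) :
    jacobiTheta₂ (x + 1 / 2 - τ / 2) τ = qPoch τ * modTheta e(τ) e(x) := by
  have hp := norm_exp_two_pi_I_mul_lt_one hτ
  have hT : ∀ j : ℤ, jacobiTheta₂_term (j + 1) (x + 1 / 2 - τ / 2) τ =
      -e(x) * e(τ) ^ j * jacobiTheta₂_term j (x + 1 / 2 - τ / 2) τ := fun j => by
    simp only [jacobiTheta₂_term_eq, ← exp_int_mul, neg_exp, ← exp_add]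
    congr 1
    push_cast
    ring
  have hsum := tendsto_sum_mul_gaussBinom hp
    ((summable_jacobiTheta₂_term_iff (x + 1 / 2 - τ / 2) τ).2 hτ).norm
  have hfin := prod_mul_prod_eq_sum_gaussBinom
    (T := fun j => jacobiTheta₂_term j (x + 1 / 2 - τ / 2) τ) (one_sub_pow_succ_ne_zero hp)
    (exp_ne_zero _) (exp_ne_zero _) (by simp [jacobiTheta₂_term]) hT
  have hprod := tendsto_nhds_unique (hsum.congr fun N => (hfin N).symm)
    ((tendsto_prod_one_sub_mul_pow hp e(x)).mul (tendsto_prod_one_sub_mul_pow hp (e(τ) / e(x))))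
  rw [qPoch_eq_qProd, modTheta, ← hprod, mul_left_comm, mul_inv_cancel₀ (qProd_ne_zero hp hp),
    mul_one, jacobiTheta₂]

/-! ### Theta functions -/

theorem theta1_eq_jacobiTheta₂ (x τ : ℂ) :
    theta1 x τ = I * exp (π * I * τ / 4 - π * I * x) * jacobiTheta₂ (x + 1 / 2 - τ / 2) τ := by
  have hI : I = exp (π * I / 2) := by rw [mul_div_right_comm, exp_pi_div_two_mul_I]
  rw [theta1, jacobiTheta₂, ← (Equiv.addRight (1 : ℤ)).tsum_eq fun j => jacobiTheta₂_term j _ τ,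
    ← tsum_neg, ← tsum_mul_left]
  congr 1
  ext n
  rw [jacobiTheta₂_term_eq, Equiv.coe_addRight, ← exp_add, neg_exp]
  nth_rewrite 4 [hI]
  rw [← exp_add, ← exp_add]
  congr 1
  push_cast
  ring

theorem constR_ne_zero {τ : ℂ} (hτ : 0 < τ.im) : constR τ ≠ 0 :=
  div_ne_zero (exp_ne_zero _) (mul_ne_zero I_ne_zero (qPoch_ne_zero hτ))

theorem constR_mul_theta1 {τ : ℂ} (hτ : 0 < τ.im) (x : ℂ) :
    constR τ * theta1 x τ = exp (-(π * I * x)) * modTheta e(τ) e(x) := by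
  have := qPoch_ne_zero hτ
  have := exp_ne_zero (π * I * τ / 4)
  rw [theta1_eq_jacobiTheta₂, jacobiTheta₂_triple_product hτ, constR, sub_eq_add_neg, exp_add,
    exp_neg (π * I * τ / 4)]
  field_simp

theorem exists_int_eq_of_exp_eq_one {x : ℂ} (h : e(x) = 1) : ∃ n : ℤ, x = n := by
  obtain ⟨n, hn⟩ := exp_eq_one_iff.1 h
  exact ⟨n, mul_left_cancel₀ two_pi_I_ne_zero (hn.trans (mul_comm _ _))⟩

theorem exists_eq_add_mul_of_theta1_eq_zero {τ : ℂ} (hτ : 0 < τ.im) {x : ℂ} (h : theta1 x τ = 0) :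
    ∃ a b : ℤ, x = a + b * τ := by
  have hp := norm_exp_two_pi_I_mul_lt_one hτ
  have hmod := constR_mul_theta1 hτ x
  rw [h, mul_zero, eq_comm, mul_eq_zero, or_iff_right (exp_ne_zero _), modTheta, mul_eq_zero,
    qProd_eq_zero_iff hp, qProd_eq_zero_iff hp] at hmod
  rcases hmod with ⟨k, hk⟩ | ⟨k, hk⟩
  · rw [← exp_nat_mul, ← exp_add] at hk
    obtain ⟨n, hn⟩ := exists_int_eq_of_exp_eq_one (x := x + k * τ) (by rw [← hk]; ring_nf)
    exact ⟨n, -k, by push_cast; linear_combination hn⟩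
  · rw [← exp_nat_mul, ← exp_sub, ← exp_add] at hk
    obtain ⟨n, hn⟩ := exists_int_eq_of_exp_eq_one (x := τ - x + k * τ) (by rw [← hk]; ring_nf)
    exact ⟨-n, k + 1, by push_cast; linear_combination -hn⟩

theorem theta1_neg (x τ : ℂ) : theta1 (-x) τ = -theta1 x τ := by
  have hθ : jacobiTheta₂ (-x + 1 / 2 - τ / 2) τ = exp (-(2 * π * I * x + π * I)) *
      jacobiTheta₂ (x + 1 / 2 - τ / 2) τ := by
    rw [← jacobiTheta₂_neg_left, ← jacobiTheta₂_add_left,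
      show -(-x + 1 / 2 - τ / 2) + 1 = (x + 1 / 2 - τ / 2) + τ by ring, jacobiTheta₂_add_left']
    congr 2
    ring
  have hexp : exp (π * I * τ / 4 - π * I * -x) * exp (-(2 * π * I * x + π * I)) =
      -exp (π * I * τ / 4 - π * I * x) := by
    rw [← exp_add, neg_exp, exp_eq_exp_iff_exists_int]
    exact ⟨-1, by push_cast; ring⟩
  rw [theta1_eq_jacobiTheta₂, theta1_eq_jacobiTheta₂, hθ]
  linear_combination I * jacobiTheta₂ (x + 1 / 2 - τ / 2) τ * hexp

theorem theta1_zero (τ : ℂ) : theta1 0 τ = 0 :=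
  self_eq_neg.1 (by simpa only [neg_zero] using theta1_neg 0 τ)

theorem theta1_add (x τ : ℂ) :
    theta1 (x + τ) τ = exp (π * I - π * I * τ - 2 * π * I * x) * theta1 x τ := by
  have hexp : exp (π * I * τ / 4 - π * I * (x + τ)) *
      exp (-π * I * (τ + 2 * (x + 1 / 2 - τ / 2))) =
      exp (π * I - π * I * τ - 2 * π * I * x) * exp (π * I * τ / 4 - π * I * x) := by
    rw [← exp_add, ← exp_add, exp_eq_exp_iff_exists_int]
    exact ⟨-1, by push_cast; ring⟩
  rw [theta1_eq_jacobiTheta₂, theta1_eq_jacobiTheta₂,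
    show x + τ + 1 / 2 - τ / 2 = (x + 1 / 2 - τ / 2) + τ by ring, jacobiTheta₂_add_left']
  linear_combination I * jacobiTheta₂ (x + 1 / 2 - τ / 2) τ * hexp

theorem add_int_mul_of_add {F : ℂ → ℂ} {τ c : ℂ}
    (h : ∀ x, F (x + τ) = exp (π * I * c - π * I * τ - 2 * π * I * x) * F x) (a : ℤ) (x : ℂ) :
    F (x + a * τ) = exp (π * I * (c * a - a ^ 2 * τ - 2 * a * x)) * F x := by
  induction a using Int.induction_on with
  | zero => simp
  | succ i ih =>
    rw [show x + ((i + 1 : ℤ) : ℂ) * τ = x + (i : ℤ) * τ + τ by push_cast; ring, h, ih,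
      ← mul_assoc, ← exp_add]
    congr 2
    push_cast
    ring
  | pred i ih =>
    rw [show x + ((-i : ℤ) : ℂ) * τ = x + ((-i - 1 : ℤ) : ℂ) * τ + τ by push_cast; ring, h] at ih
    refine mul_left_cancel₀ (exp_ne_zero _) (ih.trans ?_)
    rw [← mul_assoc, ← exp_add]
    congr 2
    push_cast
    ring

theorem theta1_add_int_mul (a : ℤ) (x τ : ℂ) :
    theta1 (x + a * τ) τ = exp (π * I * (a - a ^ 2 * τ - 2 * a * x)) * theta1 x τ := by
  simpa only [one_mul] using add_int_mul_of_add (F := fun x => theta1 x τ) (c := 1)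
    (fun x => by simpa only [mul_one] using theta1_add x τ) a x

theorem theta3_eq_jacobiTheta₂ (z τ : ℂ) : theta3 z τ = jacobiTheta₂ z τ := by
  rw [theta3, theta2, theta1_eq_jacobiTheta₂,
    show z + τ / 2 + 1 / 2 + 1 / 2 - τ / 2 = z + 1 by ring, jacobiTheta₂_add_left]
  have hexp : exp (π * I * τ / 4 + π * I * z) *
      exp (π * I * τ / 4 - π * I * (z + τ / 2 + 1 / 2)) = -I := by
    rw [← exp_add, ← exp_neg_pi_div_two_mul_I]
    congr 1
    ring
  linear_combination (I * jacobiTheta₂ z τ) * hexp - jacobiTheta₂ z τ * I_mul_I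

theorem theta4_eq_jacobiTheta₂ (z τ : ℂ) : theta4 z τ = jacobiTheta₂ (z + 1 / 2) τ :=
  theta3_eq_jacobiTheta₂ _ _

/-- The exponent `c` of the sign in `θ_k(z+τ|τ) = (-1)^c e^{-πiτ-2πiz} θ_k(z|τ)`, for
`k = 3, 4`. -/
def thetaSign (k : ℕ) : ℤ := if k = 3 then 0 else 1

theorem thetaK_add (k : ℕ) (z τ : ℂ) : thetaK k (z + τ) τ =
    exp (π * I * thetaSign k - π * I * τ - 2 * π * I * z) * thetaK k z τ := by
  rw [thetaK, thetaK, thetaSign]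
  split_ifs
  · rw [theta3_eq_jacobiTheta₂, theta3_eq_jacobiTheta₂, jacobiTheta₂_add_left']
    congr 2
    push_cast
    ring
  · rw [theta4_eq_jacobiTheta₂, theta4_eq_jacobiTheta₂, add_right_comm, jacobiTheta₂_add_left']
    congr 1
    rw [exp_eq_exp_iff_exists_int]
    exact ⟨-1, by push_cast; ring⟩

theorem thetaK_add_int_mul (k : ℕ) (a : ℤ) (z τ : ℂ) : thetaK k (z + a * τ) τ =
    exp (π * I * (thetaSign k * a - a ^ 2 * τ - 2 * a * z)) * thetaK k z τ :=
  add_int_mul_of_add (F := fun x => thetaK k x τ) (fun x => thetaK_add k x τ) a z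

theorem jacobiTheta₂_mul_eq_tsum {τ : ℂ} (hτ : 0 < τ.im) (x y : ℂ) :
    jacobiTheta₂ x τ * jacobiTheta₂ y τ =
      ∑' j : ℤ × ℤ, jacobiTheta₂_term j.1 x τ * jacobiTheta₂_term j.2 y τ :=
  tsum_mul_tsum_of_summable_norm (f := fun n => jacobiTheta₂_term n x τ)
    (g := fun n => jacobiTheta₂_term n y τ)
    ((summable_jacobiTheta₂_term_iff x τ).2 hτ).norm
    ((summable_jacobiTheta₂_term_iff y τ).2 hτ).norm

theorem summable_jacobiTheta₂_term_mul {τ : ℂ} (hτ : 0 < τ.im) (x y : ℂ) :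
    Summable fun j : ℤ × ℤ => jacobiTheta₂_term j.1 x τ * jacobiTheta₂_term j.2 y τ :=
  summable_mul_of_summable_norm (f := fun n => jacobiTheta₂_term n x τ)
    (g := fun n => jacobiTheta₂_term n y τ)
    ((summable_jacobiTheta₂_term_iff x τ).2 hτ).norm
    ((summable_jacobiTheta₂_term_iff y τ).2 hτ).norm

theorem exp_pi_mul_I_mul_int (n : ℤ) : exp (π * I * n) = (-1) ^ n := by
  rw [mul_comm, exp_int_mul, exp_pi_mul_I]

theorem jacobiTheta₂_term_add_half (n : ℤ) (x τ : ℂ) :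
    jacobiTheta₂_term n (x + 1 / 2) τ = (-1) ^ n * jacobiTheta₂_term n x τ := by
  rw [jacobiTheta₂_term_eq, jacobiTheta₂_term_eq, ← exp_pi_mul_I_mul_int, ← exp_add]
  ring_nf

theorem theta4_mul_theta3_sub_eq_tsum {τ : ℂ} (hτ : 0 < τ.im) (x y : ℂ) :
    theta4 x τ * theta3 y τ - theta3 x τ * theta4 y τ =
      ∑' j : ℤ × ℤ, ((-1) ^ j.1 - (-1) ^ j.2) *
        (jacobiTheta₂_term j.1 x τ * jacobiTheta₂_term j.2 y τ) := by
  rw [theta3_eq_jacobiTheta₂, theta3_eq_jacobiTheta₂, theta4_eq_jacobiTheta₂,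
    theta4_eq_jacobiTheta₂, jacobiTheta₂_mul_eq_tsum hτ, jacobiTheta₂_mul_eq_tsum hτ,
    ← (summable_jacobiTheta₂_term_mul hτ _ _).tsum_sub (summable_jacobiTheta₂_term_mul hτ _ _)]
  congr 1
  ext j
  rw [jacobiTheta₂_term_add_half, jacobiTheta₂_term_add_half]
  ring

theorem theta1_add_mul_theta1_sub_eq_tsum {τ : ℂ} (hτ : 0 < τ.im) (x y : ℂ) :
    theta1 (x + y) τ * theta1 (x - y) τ =
      ∑' j : ℤ × ℤ, (-1) ^ (j.1 + j.2 - 1) * (jacobiTheta₂_term (j.1 + j.2 - 1) x (τ / 2) *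
        jacobiTheta₂_term (j.1 - j.2) y (τ / 2)) := by
  have hfactor : theta1 (x + y) τ * theta1 (x - y) τ =
      exp (π * I + π * I * τ / 2 - 2 * π * I * x) *
        (jacobiTheta₂ (x + y + 1 / 2 - τ / 2) τ * jacobiTheta₂ (x - y + 1 / 2 - τ / 2) τ) := by
    have hexp : I * exp (π * I * τ / 4 - π * I * (x + y)) *
        (I * exp (π * I * τ / 4 - π * I * (x - y))) =
        exp (π * I + π * I * τ / 2 - 2 * π * I * x) := by
      rw [mul_mul_mul_comm, I_mul_I, ← exp_pi_mul_I, ← exp_add, ← exp_add]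
      ring_nf
    rw [theta1_eq_jacobiTheta₂, theta1_eq_jacobiTheta₂, mul_mul_mul_comm, hexp]
  rw [hfactor, jacobiTheta₂_mul_eq_tsum hτ, ← tsum_mul_left]
  congr 1
  ext j
  simp only [jacobiTheta₂_term_eq, ← exp_pi_mul_I_mul_int, ← exp_add]
  rw [exp_eq_exp_iff_exists_int]
  exact ⟨1, by push_cast; ring⟩

theorem two_mul_theta1_add_mul_theta1_sub {τ : ℂ} (hτ : 0 < τ.im) (x y : ℂ) :
    2 * (theta1 (x + y) τ * theta1 (x - y) τ) =
      theta4 x (τ / 2) * theta3 y (τ / 2) - theta3 x (τ / 2) * theta4 y (τ / 2) := by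
  have hinj : Function.Injective fun j : ℤ × ℤ => (j.1 + j.2 - 1, j.1 - j.2) := by
    rintro ⟨a, b⟩ ⟨c, d⟩ h
    grind
  have hsupport : (Function.support fun j : ℤ × ℤ => ((-1) ^ j.1 - (-1) ^ j.2 : ℂ) *
      (jacobiTheta₂_term j.1 x (τ / 2) * jacobiTheta₂_term j.2 y (τ / 2))) ⊆
      Set.range fun j : ℤ × ℤ => (j.1 + j.2 - 1, j.1 - j.2) := by
    rintro ⟨a, b⟩ hab
    obtain heven | ⟨c, hc⟩ := Int.even_or_odd (a - b)
    · have hparity : ((-1 : ℂ) ^ a) = (-1) ^ b := by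
        rw [← sub_add_cancel a b, zpow_add₀ (by norm_num), heven.neg_one_zpow, one_mul]
      exact absurd (by simp only [hparity, sub_self, zero_mul]) hab
    · exact ⟨(c + 1 + b, c + 1), by grind⟩
  rw [theta4_mul_theta3_sub_eq_tsum (by simpa using hτ), ← hinj.tsum_eq hsupport,
    theta1_add_mul_theta1_sub_eq_tsum hτ, ← tsum_mul_left]
  congr 1
  ext ⟨a, b⟩
  have hparity : (-1 : ℂ) ^ (a - b) = -(-1) ^ (a + b - 1) := by
    rw [show a - b = a + b - 1 + (2 * (-b) + 1) by ring, zpow_add₀ (by norm_num),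
      (odd_two_mul_add_one (-b)).neg_one_zpow, mul_neg_one]
  simp only [hparity]
  ring

theorem theta1_thetaK_three_term {τ : ℂ} (hτ : 0 < τ.im) (k : ℕ) (a b c : ℂ) :
    theta1 (a + b) τ * theta1 (a - b) τ * thetaK k c (τ / 2) =
      theta1 (b + c) τ * theta1 (c - b) τ * thetaK k a (τ / 2) +
      theta1 (c + a) τ * theta1 (a - c) τ * thetaK k b (τ / 2) := by
  have hab := two_mul_theta1_add_mul_theta1_sub hτ a b
  have hcb := two_mul_theta1_add_mul_theta1_sub hτ c b
  have hac := two_mul_theta1_add_mul_theta1_sub hτ a c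
  rw [add_comm b c, add_comm c a, thetaK, thetaK, thetaK]
  split_ifs
  · linear_combination theta3 c (τ / 2) / 2 * hab - theta3 a (τ / 2) / 2 * hcb -
      theta3 b (τ / 2) / 2 * hac
  · linear_combination theta4 c (τ / 2) / 2 * hab - theta4 a (τ / 2) / 2 * hcb -
      theta4 b (τ / 2) / 2 * hac

/-! ### Normal ordering -/

/-- Incommensurability of `1, τ, 2η`, written out over `ℤ`. -/
def Incommensurable (τ η : ℂ) : Prop :=
  ∀ a b c : ℤ, (a : ℂ) + b * τ + c * (2 * η) = 0 → a = 0 ∧ b = 0 ∧ c = 0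

theorem Incommensurable.of_linearIndependent {τ η : ℂ}
    (h : LinearIndependent ℚ ![(1 : ℂ), 2 * η, τ]) : Incommensurable τ η := by
  intro a b c habc
  have hzero := Fintype.linearIndependent_iff.1 h ![(a : ℚ), (c : ℚ), (b : ℚ)] (by
    simp only [Fin.sum_univ_three, Matrix.cons_val, Rat.smul_def]
    push_cast
    linear_combination habc)
  have ha := hzero 0
  have hc := hzero 1
  have hb := hzero 2
  simp only [Matrix.cons_val] at ha hb hc
  exact ⟨mod_cast ha, mod_cast hb, mod_cast hc⟩

theorem Incommensurable.swap {τ η : ℂ} (h : Incommensurable τ η) :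
    Incommensurable (2 * η) (τ / 2) := by
  intro a b c habc
  obtain ⟨ha, hc, hb⟩ := h a c b (by linear_combination habc)
  exact ⟨ha, hb, hc⟩

theorem Incommensurable.theta1_ne_zero {τ η : ℂ} (hinc : Incommensurable τ η) (hτ : 0 < τ.im)
    {j : ℕ} (hj : j ≠ 0) : theta1 (2 * η * j) τ ≠ 0 := by
  intro h
  obtain ⟨a, b, hab⟩ := exists_eq_add_mul_of_theta1_eq_zero hτ h
  obtain ⟨-, -, hj'⟩ := hinc (-a) (-b) j (by push_cast; linear_combination hab)
  exact hj (mod_cast hj')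

theorem ellBinom_succ {τ h : ℂ} (hstep : ∀ j : ℕ, j ≠ 0 → theta1 (h * j) τ ≠ 0) {n l : ℕ}
    (hl : l ≤ n) : ellBinom τ h (n + 1) l * theta1 (h * ((n : ℂ) + 1 - l)) τ =
      ellBinom τ h n l * theta1 (h * ((n : ℂ) + 1)) τ := by
  have hprod : ∀ N : ℕ, ∏ j ∈ Finset.Icc 1 N, theta1 (h * j) τ ≠ 0 := fun N =>
    Finset.prod_ne_zero_iff.2 fun j hj => hstep j (Nat.one_le_iff_ne_zero.1 (Finset.mem_Icc.1 hj).1)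
  have hcast : ((n - l + 1 : ℕ) : ℂ) = (n : ℂ) + 1 - l := by
    push_cast [hl]
    ring
  have hne := hstep (n - l + 1) (Nat.succ_ne_zero _)
  have := hprod l
  have := hprod (n - l)
  rw [ellBinom, ellBinom, Nat.sub_add_comm hl, Finset.prod_Icc_succ_top (by omega),
    Finset.prod_Icc_succ_top (by omega), hcast]
  rw [hcast] at hne
  push_cast
  field_simp

theorem ellBinom_succ_succ {τ h : ℂ} (hstep : ∀ j : ℕ, j ≠ 0 → theta1 (h * j) τ ≠ 0) (n l : ℕ) :
    ellBinom τ h (n + 1) (l + 1) * theta1 (h * ((l : ℂ) + 1)) τ =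
      ellBinom τ h n l * theta1 (h * ((n : ℂ) + 1)) τ := by
  have hprod : ∀ N : ℕ, ∏ j ∈ Finset.Icc 1 N, theta1 (h * j) τ ≠ 0 := fun N =>
    Finset.prod_ne_zero_iff.2 fun j hj => hstep j (Nat.one_le_iff_ne_zero.1 (Finset.mem_Icc.1 hj).1)
  have hne := hstep (l + 1) (Nat.succ_ne_zero _)
  have := hprod l
  have := hprod (n - l)
  rw [ellBinom, ellBinom, Nat.add_sub_add_right, Finset.prod_Icc_succ_top (by omega),
    Finset.prod_Icc_succ_top (by omega)]
  push_cast at hne ⊢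
  field_simp

theorem alphaCoeff_succ {τ η : ℂ} (hstep : ∀ j : ℕ, j ≠ 0 → theta1 (2 * η * j) τ ≠ 0) {n l : ℕ}
    (hl : l ≤ n) {z : ℂ} (hz : theta1 (2 * z - 2 * η * l) τ ≠ 0) :
    alphaCoeff τ η (n + 1) l z *
        (theta1 (2 * z - 2 * η * l) τ * theta1 (2 * η * ((n : ℂ) + 1 - l)) τ) =
      constA τ η * alphaCoeff τ η n l (z + η) * theta1 (2 * η * ((n : ℂ) + 1)) τ := by
  have hden : ∏ j ∈ Finset.range (n + 2), theta1 (2 * z - 2 * η * ((l : ℂ) - j)) τ =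
      (∏ j ∈ Finset.range (n + 1), theta1 (2 * (z + η) - 2 * η * ((l : ℂ) - j)) τ) *
        theta1 (2 * z - 2 * η * l) τ := by
    rw [Finset.prod_range_succ']
    congr 1
    · refine Finset.prod_congr rfl fun j _ => ?_
      push_cast
      ring_nf
    · rw [Nat.cast_zero, sub_zero]
  have hnum : 2 * z + 2 * η * (((n + 1 : ℕ) : ℂ) - 2 * l) =
      2 * (z + η) + 2 * η * ((n : ℂ) - 2 * l) := by
    push_cast
    ring
  rw [alphaCoeff, alphaCoeff, hden, hnum]
  have hbinom := ellBinom_succ hstep hl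
  generalize theta1 (2 * (z + η) + 2 * η * ((n : ℂ) - 2 * l)) τ = a
  generalize (∏ j ∈ Finset.range (n + 1), theta1 (2 * (z + η) - 2 * η * ((l : ℂ) - j)) τ) = d
  have hcancel := div_mul_cancel₀ (a / d) hz
  rw [div_div] at hcancel
  linear_combination constA τ η ^ (n + 1) * (a / d) * hbinom +
    constA τ η ^ (n + 1) * ellBinom τ (2 * η) (n + 1) l *
      theta1 (2 * η * ((n : ℂ) + 1 - l)) τ * hcancel

theorem alphaCoeff_succ_succ {τ η : ℂ} (hstep : ∀ j : ℕ, j ≠ 0 → theta1 (2 * η * j) τ ≠ 0)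
    (n l : ℕ) {z : ℂ} (hz : theta1 (2 * z + 2 * η * ((n : ℂ) - l)) τ ≠ 0) :
    alphaCoeff τ η (n + 1) (l + 1) z *
        (theta1 (2 * z + 2 * η * ((n : ℂ) - l)) τ * theta1 (2 * η * ((l : ℂ) + 1)) τ) =
      constA τ η * alphaCoeff τ η n l (z - η) * theta1 (2 * η * ((n : ℂ) + 1)) τ := by
  have hden : ∏ j ∈ Finset.range (n + 2), theta1 (2 * z - 2 * η * (((l + 1 : ℕ) : ℂ) - j)) τ =
      (∏ j ∈ Finset.range (n + 1), theta1 (2 * (z - η) - 2 * η * ((l : ℂ) - j)) τ) *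
        theta1 (2 * z + 2 * η * ((n : ℂ) - l)) τ := by
    rw [Finset.prod_range_succ]
    congr 1
    · refine Finset.prod_congr rfl fun j _ => ?_
      push_cast
      ring_nf
    · push_cast
      ring_nf
  have hnum : 2 * z + 2 * η * (((n + 1 : ℕ) : ℂ) - 2 * (l + 1 : ℕ)) =
      2 * (z - η) + 2 * η * ((n : ℂ) - 2 * l) := by
    push_cast
    ring
  rw [alphaCoeff, alphaCoeff, hden, hnum]
  have hbinom := ellBinom_succ_succ hstep n l
  generalize theta1 (2 * (z - η) + 2 * η * ((n : ℂ) - 2 * l)) τ = a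
  generalize (∏ j ∈ Finset.range (n + 1), theta1 (2 * (z - η) - 2 * η * ((l : ℂ) - j)) τ) = d
  have hcancel := div_mul_cancel₀ (a / d) hz
  rw [div_div] at hcancel
  linear_combination constA τ η ^ (n + 1) * (a / d) * hbinom +
    constA τ η ^ (n + 1) * ellBinom τ (2 * η) (n + 1) (l + 1) *
      theta1 (2 * η * ((l : ℂ) + 1)) τ * hcancel

/-- The operator `A_k((N-1)η)` stripped of the conjugation by `e^{πiz²/η}`. -/
def reducedA (τ η : ℂ) (k N : ℕ) (f : ℂ → ℂ) (z : ℂ) : ℂ :=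
  constA τ η / theta1 (2 * z) τ *
    (thetaK k (z + N * η) (τ / 2) * f (z + η) - thetaK k (z - N * η) (τ / 2) * f (z - η))

/-- The product `A_k((n-1)η) ⋯ A_k(0)` stripped of the conjugation by `e^{πiz²/η}`. -/
def reducedProdA (τ η : ℂ) (k : ℕ) : ℕ → (ℂ → ℂ) → (ℂ → ℂ)
  | 0, f => f
  | n + 1, f => reducedA τ η k (n + 1) (reducedProdA τ η k n f)

theorem theta1_mul_theta1_mul_thetaK {τ η : ℂ} (hτ : 0 < τ.im) (k n l : ℕ) (z : ℂ) :
    theta1 (2 * z) τ * theta1 (2 * η * ((n : ℂ) + 1)) τ *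
        thetaK k (z + ((n : ℂ) + 1 - 2 * l) * η) (τ / 2) =
      theta1 (2 * z - 2 * η * l) τ * theta1 (2 * η * ((n : ℂ) + 1 - l)) τ *
          thetaK k (z + (n + 1) * η) (τ / 2) +
        theta1 (2 * z + 2 * η * ((n : ℂ) + 1 - l)) τ * theta1 (2 * η * l) τ *
          thetaK k (z - (n + 1) * η) (τ / 2) := by
  convert theta1_thetaK_three_term hτ k (z + (n + 1) * η) (z - (n + 1) * η)
    (z + ((n : ℂ) + 1 - 2 * l) * η) using 4 <;> ring_nf

theorem alphaCoeff_mul_thetaK {τ η : ℂ} (hτ : 0 < τ.im) (k n l : ℕ) (z : ℂ) :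
    theta1 (2 * z) τ * theta1 (2 * η * ((n : ℂ) + 1)) τ * (alphaCoeff τ η (n + 1) l z *
        thetaK k (z + ((n : ℂ) + 1 - 2 * l) * η) (τ / 2)) =
      alphaCoeff τ η (n + 1) l z *
          (theta1 (2 * z - 2 * η * l) τ * theta1 (2 * η * ((n : ℂ) + 1 - l)) τ) *
          thetaK k (z + (n + 1) * η) (τ / 2) +
        alphaCoeff τ η (n + 1) l z *
          (theta1 (2 * z + 2 * η * ((n : ℂ) + 1 - l)) τ * theta1 (2 * η * l) τ) *
          thetaK k (z - (n + 1) * η) (τ / 2) := by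
  linear_combination alphaCoeff τ η (n + 1) l z * theta1_mul_theta1_mul_thetaK hτ k n l z

theorem sum_alphaCoeff_succ_shift_add {τ η : ℂ}
    (hstep : ∀ j : ℕ, j ≠ 0 → theta1 (2 * η * j) τ ≠ 0) (n : ℕ) (g : ℂ → ℂ) {z : ℂ}
    (hz : ∀ i : ℤ, |i| ≤ n → theta1 (2 * (z + i * η)) τ ≠ 0) :
    ∑ l ∈ Finset.range (n + 2), (-1) ^ l * (alphaCoeff τ η (n + 1) l z *
        (theta1 (2 * z - 2 * η * l) τ * theta1 (2 * η * ((n : ℂ) + 1 - l)) τ)) *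
          g (z + ((n : ℂ) + 1 - 2 * l) * η) =
      constA τ η * theta1 (2 * η * ((n : ℂ) + 1)) τ * ∑ l ∈ Finset.range (n + 1),
        (-1) ^ l * alphaCoeff τ η n l (z + η) * g (z + η + ((n : ℂ) - 2 * l) * η) := by
  rw [Finset.sum_range_succ, Finset.mul_sum, Nat.cast_succ, sub_self, mul_zero, theta1_zero,
    mul_zero, mul_zero, mul_zero, zero_mul, add_zero]
  refine Finset.sum_congr rfl fun l hl => ?_
  have hln : l ≤ n := Nat.lt_succ_iff.1 (Finset.mem_range.1 hl)
  have hzl := hz (-l) (by simpa using hln)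
  rw [alphaCoeff_succ hstep hln (by convert hzl using 2; push_cast; ring)]
  ring_nf

theorem sum_alphaCoeff_succ_shift_sub {τ η : ℂ}
    (hstep : ∀ j : ℕ, j ≠ 0 → theta1 (2 * η * j) τ ≠ 0) (n : ℕ) (g : ℂ → ℂ) {z : ℂ}
    (hz : ∀ i : ℤ, |i| ≤ n → theta1 (2 * (z + i * η)) τ ≠ 0) :
    ∑ l ∈ Finset.range (n + 2), (-1) ^ l * (alphaCoeff τ η (n + 1) l z *
        (theta1 (2 * z + 2 * η * ((n : ℂ) + 1 - l)) τ * theta1 (2 * η * l) τ)) *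
          g (z + ((n : ℂ) + 1 - 2 * l) * η) =
      -(constA τ η * theta1 (2 * η * ((n : ℂ) + 1)) τ * ∑ l ∈ Finset.range (n + 1),
        (-1) ^ l * alphaCoeff τ η n l (z - η) * g (z - η + ((n : ℂ) - 2 * l) * η)) := by
  rw [Finset.sum_range_succ', Finset.mul_sum, ← Finset.sum_neg_distrib, Nat.cast_zero, mul_zero,
    theta1_zero, mul_zero, mul_zero, mul_zero, zero_mul, add_zero]
  refine Finset.sum_congr rfl fun l hl => ?_
  have hln : l ≤ n := Nat.lt_succ_iff.1 (Finset.mem_range.1 hl)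
  have hzl := hz (n - l) (abs_le.2 ⟨by omega, by omega⟩)
  have hcoeff := alphaCoeff_succ_succ hstep n l (z := z)
    (by convert hzl using 2; push_cast; ring)
  rw [Nat.cast_succ, show (n : ℂ) + 1 - (l + 1) = n - l by ring, hcoeff]
  ring_nf

theorem reducedA_sum_alphaCoeff {τ η : ℂ} (hτ : 0 < τ.im)
    (hstep : ∀ j : ℕ, j ≠ 0 → theta1 (2 * η * j) τ ≠ 0) (k n : ℕ) (g : ℂ → ℂ) {z : ℂ}
    (hz : ∀ i : ℤ, |i| ≤ n → theta1 (2 * (z + i * η)) τ ≠ 0) :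
    reducedA τ η k (n + 1)
        (fun w => ∑ l ∈ Finset.range (n + 1),
          (-1) ^ l * alphaCoeff τ η n l w * g (w + ((n : ℂ) - 2 * l) * η)) z =
      ∑ l ∈ Finset.range (n + 2), (-1) ^ l * alphaCoeff τ η (n + 1) l z *
        (thetaK k (z + ((n : ℂ) + 1 - 2 * l) * η) (τ / 2) *
          g (z + ((n : ℂ) + 1 - 2 * l) * η)) := by
  have hstep' : theta1 (2 * η * ((n : ℂ) + 1)) τ ≠ 0 := mod_cast hstep (n + 1) n.succ_ne_zero
  have hz0 : theta1 (2 * z) τ ≠ 0 := by simpa using hz 0 (by simp)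
  refine mul_left_cancel₀ (mul_ne_zero hz0 hstep') ?_
  trans thetaK k (z + (n + 1) * η) (τ / 2) * (constA τ η * theta1 (2 * η * ((n : ℂ) + 1)) τ *
      ∑ l ∈ Finset.range (n + 1),
        (-1) ^ l * alphaCoeff τ η n l (z + η) * g (z + η + ((n : ℂ) - 2 * l) * η)) +
    thetaK k (z - (n + 1) * η) (τ / 2) * -(constA τ η * theta1 (2 * η * ((n : ℂ) + 1)) τ *
      ∑ l ∈ Finset.range (n + 1),
        (-1) ^ l * alphaCoeff τ η n l (z - η) * g (z - η + ((n : ℂ) - 2 * l) * η))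
  · rw [reducedA, Nat.cast_succ, mul_assoc, mul_assoc, mul_left_comm (theta1 (2 * z) τ),
      ← mul_assoc (theta1 (2 * z) τ), mul_div_cancel₀ _ hz0]
    ring
  · rw [← sum_alphaCoeff_succ_shift_add hstep n g hz,
      ← sum_alphaCoeff_succ_shift_sub hstep n g hz, Finset.mul_sum, Finset.mul_sum,
      ← Finset.sum_add_distrib, Finset.mul_sum]
    refine Finset.sum_congr rfl fun l _ => ?_
    linear_combination -(-1) ^ l * g (z + ((n : ℂ) + 1 - 2 * l) * η) *
      alphaCoeff_mul_thetaK hτ k n l z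

theorem reducedProdA_eq_sum {τ η : ℂ} (hτ : 0 < τ.im)
    (hstep : ∀ j : ℕ, j ≠ 0 → theta1 (2 * η * j) τ ≠ 0) (k n : ℕ) (f : ℂ → ℂ) {z : ℂ}
    (hz : ∀ i : ℤ, |i| ≤ n → theta1 (2 * (z + i * η)) τ ≠ 0) :
    reducedProdA τ η k n f z = ∑ l ∈ Finset.range (n + 1), (-1) ^ l * alphaCoeff τ η n l z *
      (thetaK k (z + ((n : ℂ) - 2 * l) * η) (τ / 2) ^ n * f (z + ((n : ℂ) - 2 * l) * η)) := by
  induction n generalizing z with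
  | zero =>
    have : theta1 (2 * z) τ ≠ 0 := by simpa using hz 0 (by simp)
    simp [reducedProdA, alphaCoeff, ellBinom, this]
  | succ n ih =>
    have hshift : ∀ ε : ℤ, |ε| = 1 → reducedProdA τ η k n f (z + ε * η) =
        ∑ l ∈ Finset.range (n + 1), (-1) ^ l * alphaCoeff τ η n l (z + ε * η) *
          (thetaK k (z + ε * η + ((n : ℂ) - 2 * l) * η) (τ / 2) ^ n *
            f (z + ε * η + ((n : ℂ) - 2 * l) * η)) := fun ε hε => ih fun i hi => by
      have hiε := hz (ε + i) ((abs_add_le ε i).trans (by push_cast; omega))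
      convert hiε using 2
      push_cast
      ring
    have hplus := hshift 1 (by simp)
    have hminus := hshift (-1) (by simp)
    rw [Int.cast_one, one_mul] at hplus
    rw [Int.cast_neg, Int.cast_one, neg_one_mul, ← sub_eq_add_neg] at hminus
    have hA := reducedA_sum_alphaCoeff hτ hstep k n
      (fun w => thetaK k w (τ / 2) ^ n * f w) (z := z)
      (fun i hi => hz i (hi.trans (by push_cast; omega)))
    rw [reducedProdA, reducedA, hplus, hminus]
    rw [reducedA] at hA
    rw [hA]
    refine Finset.sum_congr rfl fun l _ => ?_
    rw [Nat.cast_succ]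
    ring

theorem reducedA_const_mul (τ η : ℂ) (k N : ℕ) (c : ℂ) (f : ℂ → ℂ) (z : ℂ) :
    reducedA τ η k N (fun w => c * f w) z = c * reducedA τ η k N f z := by
  rw [reducedA, reducedA]
  ring

theorem thetaK_sub_int_mul (k : ℕ) (a : ℤ) (z τ : ℂ) : thetaK k (z - a * τ) τ =
    exp (π * I * (thetaSign k * a - a ^ 2 * τ + 2 * a * z)) * thetaK k z τ := by
  have h := thetaK_add_int_mul k (-a) z τ
  rw [Int.cast_neg, neg_mul, ← sub_eq_add_neg] at h
  rw [h]
  congr 1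
  exact Complex.exp_eq_exp_iff_exists_int.2 ⟨-(thetaSign k * a), by push_cast; ring⟩

theorem opA_eq_reducedA {η : ℂ} (hη : η ≠ 0) (τ : ℂ) (k m n : ℕ) (f : ℂ → ℂ) (z : ℂ) :
    opA τ η k (m * (τ / 2) + n * η) f z =
      exp (π * I * (thetaSign k * m - m ^ 2 * (τ / 2) - m * (2 * n + 1) * η)) *
        (exp (π * I * (m + 1) * z ^ 2 / η) *
          reducedA τ η k (n + 1) (fun w => exp (-(π * I * (m + 1) * w ^ 2 / η)) * f w) z) := by
  have hplus := thetaK_add_int_mul k m (z + (n + 1) * η) (τ / 2)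
  have hminus := thetaK_sub_int_mul k m (z - (n + 1) * η) (τ / 2)
  have hphase : ∀ ε : ℂ, ε ^ 2 = 1 → exp (π * I * z ^ 2 / η) *
      (exp (π * I * (thetaSign k * m - m ^ 2 * (τ / 2) - 2 * m * (ε * z + (n + 1) * η))) *
        exp (-(π * I * (z + ε * η) ^ 2 / η))) =
      exp (π * I * (thetaSign k * m - m ^ 2 * (τ / 2) - m * (2 * n + 1) * η)) *
        (exp (π * I * (m + 1) * z ^ 2 / η) * exp (-(π * I * (m + 1) * (z + ε * η) ^ 2 / η))) := by
    intro ε hε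
    simp only [← Complex.exp_add]
    congr 1
    field_simp
    linear_combination 2 * m * η ^ 2 * hε
  have hphase_plus := hphase 1 (one_pow 2)
  have hphase_minus := hphase (-1) (neg_one_sq)
  simp only [one_mul, neg_one_mul, ← sub_eq_add_neg] at hphase_plus hphase_minus
  rw [opA, reducedA, show z + (m * (τ / 2) + n * η) + η = z + (n + 1) * η + m * (τ / 2) by ring,
    show z - (m * (τ / 2) + n * η) - η = z - (n + 1) * η - m * (τ / 2) by ring]
  rw [Int.cast_natCast] at hplus hminus
  rw [Nat.cast_succ, hplus, hminus]
  have hminus' : thetaSign k * m - m ^ 2 * (τ / 2) + 2 * m * (z - (n + 1) * η) =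
    thetaSign k * m - m ^ 2 * (τ / 2) - 2 * m * (-z + (n + 1) * η) := by ring
  rw [hminus']
  linear_combination constA τ η / theta1 (2 * z) τ *
    (thetaK k (z + (n + 1) * η) (τ / 2) * f (z + η) * hphase_plus -
      thetaK k (z - (n + 1) * η) (τ / 2) * f (z - η) * hphase_minus)

theorem prodA_eq_reducedProdA {η : ℂ} (hη : η ≠ 0) (τ : ℂ) (k m n : ℕ) (f : ℂ → ℂ) (z : ℂ) :
    prodA τ η k (m * (τ / 2)) n f z =
      exp (π * I * (thetaSign k * (m * n) - m ^ 2 * n * (τ / 2) - m * n ^ 2 * η)) *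
        (exp (π * I * (m + 1) * z ^ 2 / η) *
          reducedProdA τ η k n (fun w => exp (-(π * I * (m + 1) * w ^ 2 / η)) * f w) z) := by
  induction n generalizing z with
  | zero => simp [prodA, reducedProdA, ← mul_assoc, ← Complex.exp_add]
  | succ n ih =>
    have hcancel : (fun w => exp (-(π * I * (m + 1) * w ^ 2 / η)) *
        prodA τ η k (m * (τ / 2)) n f w) = fun w =>
          exp (π * I * (thetaSign k * (m * n) - m ^ 2 * n * (τ / 2) - m * n ^ 2 * η)) *
          reducedProdA τ η k n (fun w => exp (-(π * I * (m + 1) * w ^ 2 / η)) * f w) w := by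
      funext w
      rw [ih, mul_left_comm, ← mul_assoc (exp (-_)), ← Complex.exp_add, neg_add_cancel,
        Complex.exp_zero, one_mul]
    rw [prodA, opA_eq_reducedA hη, hcancel, reducedA_const_mul, reducedProdA,
      mul_left_comm (exp (π * I * (m + 1) * z ^ 2 / η)), ← mul_assoc, ← Complex.exp_add]
    congr 2
    push_cast
    ring

theorem prodA_eq_sum {τ η : ℂ} (hτ : 0 < τ.im) (hη : η ≠ 0)
    (hstep : ∀ j : ℕ, j ≠ 0 → theta1 (2 * η * j) τ ≠ 0) (k m n : ℕ) (f : ℂ → ℂ) {z : ℂ}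
    (hz : ∀ i : ℤ, |i| ≤ n → theta1 (2 * (z + i * η)) τ ≠ 0) :
    prodA τ η k (m * (τ / 2)) n f z =
      exp (π * I * (thetaSign k * (m * n) - m ^ 2 * n * (τ / 2) - m * n ^ 2 * η)) *
        ∑ l ∈ Finset.range (n + 1), (-1) ^ l * alphaCoeff τ η n l z *
          exp (-(π * I * (m + 1) * (n - 2 * l) * (2 * z + (n - 2 * l) * η))) *
          (thetaK k (z + ((n : ℂ) - 2 * l) * η) (τ / 2) ^ n * f (z + ((n : ℂ) - 2 * l) * η)) := by
  rw [prodA_eq_reducedProdA hη, reducedProdA_eq_sum hτ hstep k n _ hz, Finset.mul_sum]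
  congr 1
  refine Finset.sum_congr rfl fun l _ => ?_
  have hphase : exp (-(π * I * (m + 1) * (n - 2 * l) * (2 * z + (n - 2 * l) * η))) =
      exp (π * I * (m + 1) * z ^ 2 / η) *
        exp (-(π * I * (m + 1) * (z + ((n : ℂ) - 2 * l) * η) ^ 2 / η)) := by
    rw [← Complex.exp_add]
    congr 1
    field_simp
    ring
  rw [hphase]
  ring

theorem opB_eq_opA (τ η : ℂ) : opB τ η = opA (2 * η) (τ / 2) := by
  funext k g f z
  simp only [opB, opA, constB, constA, mul_div_cancel_left₀ η (two_ne_zero' ℂ)]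
  ring_nf

theorem prodB_eq_prodA (τ η : ℂ) : prodB τ η = prodA (2 * η) (τ / 2) := by
  funext k g n f
  induction n with
  | zero => rfl
  | succ n ih => rw [prodB, prodA, ih, opB_eq_opA]

theorem betaCoeff_eq_alphaCoeff (τ η : ℂ) : betaCoeff τ η = alphaCoeff (2 * η) (τ / 2) := by
  funext m l z
  simp only [betaCoeff, alphaCoeff, constB, constA, mul_div_cancel₀ τ (two_ne_zero' ℂ)]

theorem prod_theta1_add_int_mul (j : ℤ) (x h τ : ℂ) (N : ℕ) :
    ∏ i ∈ Finset.range N, theta1 (x + j * τ + i * h) τ =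
      exp (π * I * (N * (j - j ^ 2 * τ - 2 * j * x) - j * h * (N * (N - 1)))) *
        ∏ i ∈ Finset.range N, theta1 (x + i * h) τ := by
  induction N with
  | zero => simp
  | succ N ih =>
    rw [Finset.prod_range_succ, Finset.prod_range_succ, ih, add_right_comm, theta1_add_int_mul,
      mul_mul_mul_comm, ← Complex.exp_add]
    congr 2
    push_cast
    ring

theorem alphaCoeff_add_int_mul (τ η : ℂ) (n l : ℕ) (j : ℤ) (z : ℂ) :
    alphaCoeff τ η n l (z + j * (τ / 2)) =
      exp (π * I * (n * (j ^ 2 * τ + 4 * j * z - j) + 2 * j * η * (n - 1) * (n - 2 * l))) *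
        alphaCoeff τ η n l z := by
  have hden : ∀ w : ℂ, ∏ i ∈ Finset.range (n + 1), theta1 (2 * w - 2 * η * ((l : ℂ) - i)) τ =
      ∏ i ∈ Finset.range (n + 1), theta1 (2 * w - 2 * η * l + i * (2 * η)) τ := fun w =>
    Finset.prod_congr rfl fun i _ => by ring_nf
  rw [alphaCoeff, alphaCoeff, hden, hden,
    show 2 * (z + j * (τ / 2)) - 2 * η * l = 2 * z - 2 * η * l + j * τ by ring,
    show 2 * (z + j * (τ / 2)) + 2 * η * ((n : ℂ) - 2 * l) =
      2 * z + 2 * η * ((n : ℂ) - 2 * l) + j * τ by ring,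
    prod_theta1_add_int_mul, theta1_add_int_mul, mul_div_mul_comm, ← Complex.exp_sub]
  rw [mul_left_comm]
  congr 2
  push_cast
  ring

theorem prodB_zero_eq_sum {τ η : ℂ} (hτ : τ ≠ 0) (hη : 0 < η.im)
    (hinc : Incommensurable τ η) (k m : ℕ) (f : ℂ → ℂ) {z : ℂ}
    (hz : ∀ j : ℤ, |j| ≤ m → theta1 (2 * (z + j * (τ / 2))) (2 * η) ≠ 0) :
    prodB τ η k 0 m f z = ∑ l ∈ Finset.range (m + 1), (-1) ^ l * betaCoeff τ η m l z *
      exp (-(π * I * (m - 2 * l) * (2 * z + (m - 2 * l) * (τ / 2)))) *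
      (thetaK k (z + ((m : ℂ) - 2 * l) * (τ / 2)) η ^ m *
        f (z + ((m : ℂ) - 2 * l) * (τ / 2))) := by
  have hη' : 0 < (2 * η).im := by simpa using hη
  have hsum := prodA_eq_sum hη' (div_ne_zero hτ two_ne_zero)
    (fun j => hinc.swap.theta1_ne_zero hη') k 0 m f hz
  simpa only [prodB_eq_prodA, betaCoeff_eq_alphaCoeff, Nat.cast_zero, zero_mul,
    zero_pow two_ne_zero, mul_zero, sub_zero, Complex.exp_zero, one_mul, zero_add, mul_one,
    mul_div_cancel_left₀ η (two_ne_zero' ℂ)] using hsum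

theorem betaCoeff_add_int_mul (τ η : ℂ) (m l : ℕ) (j : ℤ) (z : ℂ) :
    betaCoeff τ η m l (z + j * η) =
      exp (π * I * (m * (j ^ 2 * (2 * η) + 4 * j * z - j) + j * τ * (m - 1) * (m - 2 * l))) *
        betaCoeff τ η m l z := by
  have h := alphaCoeff_add_int_mul (2 * η) (τ / 2) m l j z
  rw [mul_div_cancel_left₀ η (two_ne_zero' ℂ)] at h
  rw [betaCoeff_eq_alphaCoeff, h]
  ring_nf

theorem exp_normal_ordering_phase (τ η z : ℂ) (s : ℤ) (n m k l : ℕ) :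
    exp (π * I * (s * (m * n) - m ^ 2 * n * (τ / 2) - m * n ^ 2 * η)) *
        exp (-(π * I * (m + 1) * (n - 2 * k) * (2 * z + (n - 2 * k) * η))) *
        exp (-(π * I * (m - 2 * l) * (2 * (z + (n - 2 * k) * η) + (m - 2 * l) * (τ / 2)))) *
        exp (π * I * (m * ((n - 2 * k) ^ 2 * (2 * η) + 4 * (n - 2 * k) * z - (n - 2 * k)) +
          (n - 2 * k) * τ * (m - 1) * (m - 2 * l))) =
      (-1) ^ (n * m) * exp (-(π * I * τ / 2 * m ^ 2 * n) - π * I * η * n ^ 2 * m) *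
        exp ((n - 1) * (m - 2 * l) *
          (π * I * τ / 2 * (m - 2 * l) + 2 * π * I * (z + (n - 2 * k) * η))) *
        exp ((m - 1) * (n - 2 * k) *
          (π * I * η * (n - 2 * k) + 2 * π * I * (z + (m - 2 * l) * (τ / 2)))) *
        exp (π * I * (s * (m - 2 * l) - (m - 2 * l) ^ 2 * (τ / 2) -
          2 * (m - 2 * l) * (z + (n - 2 * k) * η))) ^ n := by
  have hsign : (-1 : ℂ) ^ (n * m) = exp (π * I * (n * m)) := by
    have h := exp_pi_mul_I_mul_int (n * m : ℕ)
    rw [zpow_natCast] at h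
    rw [← h]
    push_cast
    rfl
  rw [hsign, ← Complex.exp_nat_mul]
  simp only [← Complex.exp_add]
  refine Complex.exp_eq_exp_iff_exists_int.2 ⟨s * n * l + m * k - n * m, ?_⟩
  push_cast
  ring

theorem factorizedM_eq_normalOrderedM {τ η : ℂ} (hτ : 0 < τ.im) (hη : 0 < η.im)
    (hinc : Incommensurable τ η) {k n m : ℕ} (f : ℂ → ℂ) {z : ℂ}
    (hz : RegularPoint τ η k n m z) :
    factorizedM τ η k n m f z = normalOrderedM τ η n m f z := by
  have hτ0 : τ ≠ 0 := by rintro rfl; simp at hτ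
  have hη0 : η ≠ 0 := by rintro rfl; simp at hη
  have hcol : ∀ i : ℤ, |i| ≤ n → theta1 (2 * (z + i * η)) τ ≠ 0 := fun i hi => by
    simpa using (hz i 0 hi (by simp)).1
  rw [factorizedM, prodA_eq_sum hτ hη0 (fun j => hinc.theta1_ne_zero hτ) k m n _ hcol,
    normalOrderedM, Finset.mul_sum, Finset.mul_sum]
  refine Finset.sum_congr rfl fun i hi => ?_
  have hin : i ≤ n := Nat.lt_succ_iff.1 (Finset.mem_range.1 hi)
  have hindex : |(n - 2 * i : ℤ)| ≤ n := abs_le.2 ⟨by omega, by omega⟩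
  have hrow : ∀ j : ℤ, |j| ≤ m →
      theta1 (2 * (z + ((n : ℂ) - 2 * i) * η + j * (τ / 2))) (2 * η) ≠ 0 := fun j hj =>
    mod_cast (hz (n - 2 * i) j hindex hj).2.1
  rw [prodB_zero_eq_sum hτ0 hη hinc k m _ hrow]
  simp only [Finset.mul_sum]
  refine Finset.sum_congr rfl fun l hl => ?_
  have hlm : l ≤ m := Nat.lt_succ_iff.1 (Finset.mem_range.1 hl)
  obtain ⟨-, -, hθτ, hθη⟩ := hz (n - 2 * i) (m - 2 * l) hindex (abs_le.2 ⟨by omega, by omega⟩)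
  have hquasi := thetaK_add_int_mul k (m - 2 * l) (z + ((n : ℂ) - 2 * i) * η) (τ / 2)
  have hbeta := betaCoeff_add_int_mul τ η m l (n - 2 * i) z
  have hphase := exp_normal_ordering_phase τ η z (thetaSign k) n m i l
  push_cast at hθτ hθη hquasi hbeta
  rw [add_assoc z] at hθτ hθη hquasi
  rw [hbeta, add_assoc z]
  have hcancel := mul_div_cancel₀ (f (z + ((n - 2 * i) * η + (m - 2 * l) * (τ / 2))))
    (mul_ne_zero (pow_ne_zero m hθη) (pow_ne_zero n hθτ))
  generalize f (z + ((n - 2 * i) * η + (m - 2 * l) * (τ / 2))) / _ = x at hcancel ⊢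
  rw [hquasi, mul_pow] at hcancel
  rw [← hcancel]
  linear_combination (-1) ^ i * alphaCoeff τ η n i z * ((-1) ^ l * betaCoeff τ η m l z) *
    (thetaK k (z + ((n - 2 * i) * η + (m - 2 * l) * (τ / 2))) η ^ m *
      thetaK k (z + (n - 2 * i) * η) (τ / 2) ^ n * x) * hphase

/-! ### Contour integrals of periodic functions -/

theorem exp_two_pi_I_add_one (x : ℂ) : e(x + 1) = e(x) := by
  rw [mul_add, mul_one, exp_add, exp_two_pi_mul_I, mul_one]

theorem exp_two_pi_I_neg (x : ℂ) : e(-x) = (e(x))⁻¹ := by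
  rw [mul_neg, exp_neg]

theorem integral_add_mul_I_eq {G : ℂ → ℂ} {a b : ℝ}
    (hG : DifferentiableOn ℂ G {x | x.im ∈ Set.uIcc a b}) (hper : ∀ x, G (x + 1) = G x) :
    ∫ x in (0 : ℝ)..1, G (x + a * I) = ∫ x in (0 : ℝ)..1, G (x + b * I) := by
  have hrect := integral_boundary_rect_eq_zero_of_differentiableOn G (a * I) (1 + b * I)
    (hG.mono fun x hx => by simpa using hx.2)
  have hsides : ∀ y : ℝ, G (1 + y * I) = G (y * I) := fun y => by rw [add_comm, hper]
  simp only [mul_re, ofReal_re, I_re, mul_zero, ofReal_im, I_im, mul_one, sub_self, add_re, one_re,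
    add_zero, mul_im, zero_add, add_im, one_im, ofReal_one, ofReal_zero, hsides] at hrect
  linear_combination hrect

theorem integral_neg_add_eq {G : ℂ → ℂ} (hper : ∀ x, G (x + 1) = G x) (c : ℂ) :
    ∫ x in (0 : ℝ)..1, G (-x + c) = ∫ x in (0 : ℝ)..1, G (x + c) := by
  have hperiodic : Function.Periodic (fun x : ℝ => G (x + c)) 1 := fun x => by
    dsimp only
    rw [ofReal_add, ofReal_one, add_right_comm, hper]
  have hneg := intervalIntegral.integral_comp_neg (a := 0) (b := 1) (fun x : ℝ => G (x + c))
  have hshift := hperiodic.intervalIntegral_add_eq (-1) 0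
  simp only [ofReal_neg, neg_zero] at hneg
  simp only [neg_add_cancel, zero_add] at hshift
  rw [hneg, hshift]

theorem integral_comp_exp_eq_apply_zero {f : ℂ → ℂ} {c : ℂ}
    (hf : DifferentiableOn ℂ f (Metric.closedBall 0 ‖c‖)) :
    ∫ x in (0 : ℝ)..1, f (c * e(x)) = f 0 := by
  have hmaps : Set.MapsTo (c * ·) (Metric.closedBall 0 1) (Metric.closedBall 0 ‖c‖) :=
    fun w hw => by
      simp only [mem_closedBall_zero_iff, norm_mul] at hw ⊢
      exact mul_le_of_le_one_right (norm_nonneg c) hw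
  have hdiff : DifferentiableOn ℂ (fun w => f (c * w)) (Metric.closedBall 0 |1|) := by
    rw [abs_one]
    exact hf.fun_comp (by fun_prop) hmaps
  have hmean := hdiff.diffContOnCl_ball subset_rfl |>.circleAverage
  rw [Real.circleAverage_def] at hmean
  have hsubst := intervalIntegral.integral_comp_mul_left (a := 0) (b := 1)
    (fun θ => f (c * circleMap 0 1 θ)) Real.two_pi_pos.ne'
  have hcircle : ∀ x : ℝ, circleMap 0 1 (2 * π * x) = e(x) := fun x => by
    simp only [circleMap, ofReal_one, ofReal_mul, ofReal_ofNat, one_mul, zero_add]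
    ring_nf
  simp only [hcircle, mul_zero, mul_one] at hsubst hmean
  rw [hsubst, hmean]

/-- The Cayley transform `(1 + u) / (1 - u)`. As a function of `y`, `cayley e(y)` is an odd function
of period `1` whose only poles are the integers; it plays the role of the Cauchy kernel. -/
def cayley (u : ℂ) : ℂ := (1 + u) / (1 - u)

theorem cayley_inv {u : ℂ} (hu : u ≠ 0) : cayley u⁻¹ = -cayley u := by
  rcases eq_or_ne u 1 with rfl | hu1
  · simp [cayley]
  have hsub : 1 - u ≠ 0 := sub_ne_zero.mpr hu1.symm
  have hsub' : u - 1 ≠ 0 := sub_ne_zero.mpr hu1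
  rw [cayley, cayley]
  field_simp
  ring

theorem cayley_mul_add_cayley_div {t w : ℂ} (hw : w ≠ 0) (hmul : 1 - t * w ≠ 0)
    (hdiv : 1 - t / w ≠ 0) :
    cayley (t * w) + cayley (t / w) = 2 * (1 - t ^ 2) / ((1 - t * w) * (1 - t / w)) := by
  have hsub : w - t ≠ 0 := fun h => hdiv (by rw [← sub_eq_zero.mp h, div_self hw, sub_self])
  rw [cayley, cayley]
  field_simp
  ring

theorem one_sub_sq_ne_zero {t : ℂ} (ht : ‖t‖ < 1) : 1 - t ^ 2 ≠ 0 := sub_ne_zero.mpr fun h => by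
  have hpow := pow_lt_one₀ (norm_nonneg t) ht two_ne_zero
  rw [← norm_pow, ← h, norm_one] at hpow
  exact lt_irrefl 1 hpow

/-- The integral of `Q(x) cayley(t e(x))` over a period at height `Y`. -/
def contourInt (Q : ℂ → ℂ) (Y : ℝ) (t : ℂ) : ℂ :=
  ∫ x in (0 : ℝ)..1, Q (x + Y * I) * cayley (t * e(x + Y * I))

section

variable {Q : ℂ → ℂ} {Y : ℝ} {t x₀ : ℂ}

theorem one_sub_mul_exp_ne_zero {x : ℂ} (h : ‖t‖ * Real.exp (-(2 * π * x.im)) ≠ 1) :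
    1 - t * e(x) ≠ 0 := fun hzero => h <| by
  rw [← norm_exp_two_pi_I_mul, ← norm_mul, ← sub_eq_zero.mp hzero, norm_one]

theorem norm_mul_exp_lt_one {y : ℝ} (ht : ‖t‖ < 1) (hy : 0 ≤ y) :
    ‖t‖ * Real.exp (-(2 * π * y)) < 1 :=
  mul_lt_one_of_nonneg_of_lt_one_left (norm_nonneg t) ht
    (Real.exp_le_one_iff.mpr (neg_nonpos.mpr (by positivity)))

theorem contourInt_one (ht : ‖t‖ * Real.exp (-(2 * π * Y)) < 1) :
    contourInt (fun _ => 1) Y t = 1 := by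
  have hnorm : ‖t * e(Y * I)‖ < 1 := by
    rw [norm_mul, norm_exp_two_pi_I_mul]
    simpa using ht
  have hdiff : DifferentiableOn ℂ cayley (Metric.closedBall 0 ‖t * e(Y * I)‖) := fun u hu => by
    have hu1 : 1 - u ≠ 0 := sub_ne_zero.mpr fun h => by
      rw [← h, mem_closedBall_zero_iff, norm_one] at hu
      exact hu.not_gt hnorm
    unfold cayley
    fun_prop (disch := assumption)
  have hmean := integral_comp_exp_eq_apply_zero hdiff
  have hexp : ∀ x : ℝ, t * e(Y * I) * e(x) = t * e(x + Y * I) := fun x => by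
    rw [mul_assoc, ← exp_add]
    ring_nf
  simpa only [contourInt, one_mul, hexp, cayley, add_zero, sub_zero, div_one] using hmean

theorem contourInt_inv (hper : ∀ x, Q (x + 1) = Q x) (heven : ∀ x, Q (-x) = Q x) (ht : t ≠ 0) :
    contourInt Q Y t⁻¹ = -contourInt Q (-Y) t := by
  rw [contourInt, contourInt, ← integral_neg_add_eq (G := fun x => Q x * cayley (t⁻¹ * e(x)))
    (fun x => by rw [hper, exp_two_pi_I_add_one]), ← intervalIntegral.integral_neg]
  refine intervalIntegral.integral_congr fun x _ => ?_
  have hneg : -(x : ℂ) + Y * I = -(x + (-Y : ℝ) * I) := by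
    push_cast
    ring
  simp only [hneg, heven, exp_two_pi_I_neg, ← mul_inv]
  rw [cayley_inv (mul_ne_zero ht (exp_ne_zero _)), mul_neg]

/-- The quotient `f / h`, with the value given by l'Hôpital's rule at the zeros of `h`. -/
def simpleQuot (f h : ℂ → ℂ) (x : ℂ) : ℂ := if h x = 0 then deriv f x / deriv h x else f x / h x

theorem differentiableAt_simpleQuot {f h : ℂ → ℂ} {x : ℂ} (hf : AnalyticAt ℂ f x)
    (hh : AnalyticAt ℂ h x) (hzero : h x = 0 → f x = 0 ∧ deriv h x ≠ 0) :
    DifferentiableAt ℂ (simpleQuot f h) x := by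
  by_cases hx : h x = 0
  · obtain ⟨hfx, hderiv⟩ := hzero hx
    have hslope : ∀ {k : ℂ → ℂ}, AnalyticAt ℂ k x → DifferentiableAt ℂ (dslope k x) x := by
      intro k hk
      have hnhds := hk.eventually_analyticAt
      exact ((differentiableOn_dslope hnhds).mpr fun y hy =>
        AnalyticAt.differentiableAt hy |>.differentiableWithinAt).differentiableAt hnhds
    refine ((hslope hf).div (hslope hh) (by rwa [dslope_same])).congr_of_eventuallyEq ?_
    have hne : ∀ᶠ y in 𝓝[≠] x, h y ≠ 0 := hh.differentiableAt.hasDerivAt.eventually_ne hderiv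
    filter_upwards [eventually_nhdsWithin_iff.mp hne] with y hy
    rcases eq_or_ne y x with rfl | hyx
    · simp only [simpleQuot, if_pos hx, Pi.div_apply, dslope_same]
    · rw [simpleQuot, if_neg (hy hyx), Pi.div_apply, dslope_of_ne _ hyx, dslope_of_ne _ hyx,
        slope_def_field, slope_def_field, hfx, hx, sub_zero, sub_zero,
        div_div_div_cancel_right₀ (sub_ne_zero.mpr hyx)]
  · refine (hf.differentiableAt.div hh.differentiableAt hx).congr_of_eventuallyEq ?_
    filter_upwards [hh.continuousAt.eventually_ne hx] with y hy
    rw [simpleQuot, if_neg hy, Pi.div_apply]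

theorem hasDerivAt_one_sub_mul_exp (x : ℂ) :
    HasDerivAt (fun x => 1 - t * e(x)) (-(2 * π * I * (t * e(x)))) x := by
  refine ((((hasDerivAt_id x).const_mul (2 * π * I)).cexp.const_mul t).const_sub 1).congr_deriv ?_
  simp only [id_eq]
  ring

theorem exists_int_eq_add_of_mul_exp_eq_one {x : ℂ} (ht : t * e(x₀) = 1) (hx : t * e(x) = 1) :
    ∃ n : ℤ, x = x₀ + n := by
  have hexp : e(x - x₀) = 1 := by
    rw [mul_sub, exp_sub, div_eq_one_iff_eq (exp_ne_zero _)]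
    exact mul_left_cancel₀ (left_ne_zero_of_mul_eq_one ht) (hx.trans ht.symm)
  obtain ⟨n, hn⟩ := exists_int_eq_of_exp_eq_one hexp
  exact ⟨n, by rw [← hn]; ring⟩

theorem contourInt_eq_of_apply_eq_zero (hQ : ∀ x : ℂ, |x.im| ≤ Y → AnalyticAt ℂ Q x)
    (hper : ∀ x, Q (x + 1) = Q x) (hx₀ : |x₀.im| < Y) (ht : t * e(x₀) = 1) (hQx₀ : Q x₀ = 0) :
    contourInt Q Y t = contourInt Q (-Y) t := by
  let f : ℂ → ℂ := fun x => Q x * (1 + t * e(x))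
  let h : ℂ → ℂ := fun x => 1 - t * e(x)
  have hderiv : ∀ x, deriv h x = -(2 * π * I * (t * e(x))) := fun x =>
    (hasDerivAt_one_sub_mul_exp x).deriv
  have hperf : (fun x => f (x + 1)) = f := funext fun x => by
    simp only [f, hper, exp_two_pi_I_add_one]
  have hzero : ∀ x, h x = 0 → Q x = 0 ∧ x.im = x₀.im := by
    intro x hx
    obtain ⟨n, rfl⟩ := exists_int_eq_add_of_mul_exp_eq_one ht (sub_eq_zero.mp hx).symm
    have hperiodic : Function.Periodic Q 1 := hper
    exact ⟨by rw [← hQx₀, ← mul_one (n : ℂ), hperiodic.int_mul n x₀], by simp⟩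
  have hdiff : DifferentiableOn ℂ (simpleQuot f h) {x | x.im ∈ Set.uIcc Y (-Y)} := by
    intro x hx
    rw [Set.mem_ofPred_eq, Set.uIcc_of_ge (by linarith [abs_nonneg x₀.im])] at hx
    refine (differentiableAt_simpleQuot ((hQ x (abs_le.mpr hx)).mul (by fun_prop)) (by fun_prop)
      fun hx0 => ⟨mul_eq_zero_of_left (hzero x hx0).1 _, ?_⟩).differentiableWithinAt
    rw [hderiv, ← sub_eq_zero.mp hx0, mul_one]
    exact neg_ne_zero.mpr two_pi_I_ne_zero
  have hshift := integral_add_mul_I_eq hdiff fun x => by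
    have hderivf : deriv f (x + 1) = deriv f x := by rw [← deriv_comp_add_const, hperf]
    simp only [simpleQuot, hderiv, hderivf, congrFun hperf x, h, exp_two_pi_I_add_one]
  have hval : ∀ y : ℝ, |y| = Y → ∀ x : ℝ,
      simpleQuot f h (x + y * I) = Q (x + y * I) * cayley (t * e(x + y * I)) := by
    intro y hy x
    have hne : h (x + y * I) ≠ 0 := fun hx => by
      have him := (hzero _ hx).2
      simp only [add_im, ofReal_im, mul_im, ofReal_re, I_im, mul_one, I_re, mul_zero, add_zero,
        zero_add] at him
      rw [← him] at hx₀
      exact hx₀.ne hy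
    simp only [simpleQuot, if_neg hne, f, h, cayley, mul_div_assoc]
  have hY : 0 ≤ Y := (abs_nonneg _).trans hx₀.le
  have hY' : |(-Y)| = Y := (abs_neg Y).trans (abs_of_nonneg hY)
  simpa only [contourInt, hval Y (abs_of_nonneg hY), hval (-Y) hY'] using hshift

theorem continuous_mul_cayley {y : ℝ} (hQ : ∀ x : ℂ, x.im = y → AnalyticAt ℂ Q x)
    (ht : ‖t‖ * Real.exp (-(2 * π * y)) ≠ 1) :
    Continuous fun x : ℝ => Q (x + y * I) * cayley (t * e(x + y * I)) := by
  have hQc : Continuous fun x : ℝ => Q (x + y * I) := continuous_iff_continuousAt.mpr fun x =>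
    ContinuousAt.comp (f := fun x : ℝ => (x : ℂ) + y * I)
      (hQ _ (by simp)).continuousAt (by fun_prop)
  refine hQc.mul (Continuous.div (by fun_prop) (by fun_prop) fun x => ?_)
  exact one_sub_mul_exp_ne_zero (by simpa using ht)

/-- The residue theorem for the simple poles of `cayley (t * e(x))` in a period strip. -/
theorem contourInt_sub_contourInt_neg (hQ : ∀ x : ℂ, |x.im| ≤ Y → AnalyticAt ℂ Q x)
    (hper : ∀ x, Q (x + 1) = Q x) (hx₀ : |x₀.im| < Y) (ht : t * e(x₀) = 1) :
    contourInt Q Y t - contourInt Q (-Y) t = 2 * Q x₀ := by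
  have hY : 0 < Y := (abs_nonneg _).trans_lt hx₀
  have ht0 : t ≠ 0 := left_ne_zero_of_mul_eq_one ht
  have hnorm : ‖t‖ = Real.exp (2 * π * x₀.im) := by
    rw [eq_inv_of_mul_eq_one_left ht, norm_inv, norm_exp_two_pi_I_mul, Real.exp_neg, inv_inv]
  have hlt : ‖t‖ * Real.exp (-(2 * π * Y)) < 1 := by
    rw [hnorm, ← Real.exp_add, Real.exp_lt_one_iff]
    nlinarith [Real.two_pi_pos, (abs_lt.mp hx₀).2]
  have hgt : ‖t⁻¹‖ * Real.exp (-(2 * π * Y)) < 1 := by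
    rw [norm_inv, hnorm, ← Real.exp_neg, ← Real.exp_add, Real.exp_lt_one_iff]
    nlinarith [Real.two_pi_pos, (abs_lt.mp hx₀).1]
  have hne : ∀ y : ℝ, |y| = Y → ‖t‖ * Real.exp (-(2 * π * y)) ≠ 1 := by
    intro y hy h
    rw [hnorm, ← Real.exp_add, Real.exp_eq_one_iff, ← sub_eq_add_neg, ← mul_sub, mul_eq_zero,
      or_iff_right Real.two_pi_pos.ne', sub_eq_zero] at h
    exact hx₀.ne (h ▸ hy)
  have hsplit : ∀ y : ℝ, |y| = Y → contourInt (fun x => Q x - Q x₀) y t =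
      contourInt Q y t - Q x₀ * contourInt (fun _ => 1) y t := by
    intro y hy
    have hQy : ∀ x : ℂ, x.im = y → AnalyticAt ℂ Q x := fun x hx => hQ x (hx ▸ hy.le)
    simp only [contourInt, sub_mul, ← intervalIntegral.integral_const_mul, one_mul]
    exact intervalIntegral.integral_sub
      ((continuous_mul_cayley hQy (hne y hy)).intervalIntegrable _ _)
      ((continuous_mul_cayley (fun _ _ => analyticAt_const) (hne y hy)).intervalIntegrable _ _)
  have hzero := contourInt_eq_of_apply_eq_zero (Q := fun x => Q x - Q x₀) (t := t)
    (fun x hx => (hQ x hx).sub analyticAt_const) (fun x => by rw [hper]) hx₀ ht (sub_self _)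
  have hone := contourInt_one hlt
  have hnegone := (contourInt_inv (fun _ => rfl) (fun _ => rfl) ht0).symm.trans (contourInt_one hgt)
  rw [hsplit Y (abs_of_pos hY), hsplit (-Y) ((abs_neg Y).trans (abs_of_pos hY))] at hzero
  linear_combination hzero + Q x₀ * hone + Q x₀ * hnegone

theorem contourInt_add_contourInt_inv (hQ : ∀ x : ℂ, |x.im| ≤ Y → AnalyticAt ℂ Q x)
    (hper : ∀ x, Q (x + 1) = Q x) (heven : ∀ x, Q (-x) = Q x) (hx₀ : |x₀.im| < Y)
    (ht : t * e(x₀) = 1) :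
    contourInt Q Y t + contourInt Q Y t⁻¹ = 2 * Q x₀ := by
  rw [contourInt_inv hper heven (left_ne_zero_of_mul_eq_one ht), ← sub_eq_add_neg,
    contourInt_sub_contourInt_neg hQ hper hx₀ ht]

theorem integral_div_eq_contourInt (hY : 0 ≤ Y) (hQ : ∀ x : ℂ, |x.im| ≤ Y → AnalyticAt ℂ Q x)
    (hper : ∀ x, Q (x + 1) = Q x) (heven : ∀ x, Q (-x) = Q x) (ht : ‖t‖ < 1) :
    ∫ x in (0 : ℝ)..1, Q x / ((1 - t * e(x)) * (1 - t / e(x))) =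
      contourInt Q Y t / (1 - t ^ 2) := by
  have hne : ∀ x : ℂ, 0 ≤ x.im → 1 - t * e(x) ≠ 0 := fun x hx =>
    one_sub_mul_exp_ne_zero (norm_mul_exp_lt_one ht hx).ne
  have hperG : ∀ x, Q (x + 1) * cayley (t * e(x + 1)) = Q x * cayley (t * e(x)) := fun x => by
    rw [hper, exp_two_pi_I_add_one]
  have hshift : ∫ x in (0 : ℝ)..1, Q x * cayley (t * e(x)) = contourInt Q Y t := by
    have hdiff : DifferentiableOn ℂ (fun x => Q x * cayley (t * e(x)))
        {x | x.im ∈ Set.uIcc 0 Y} := fun x hx => by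
      rw [Set.mem_ofPred_eq, Set.uIcc_of_le hY] at hx
      refine ((hQ x (abs_le.mpr ⟨by linarith [hx.1], hx.2⟩)).differentiableAt.mul ?_)
        |>.differentiableWithinAt
      exact DifferentiableAt.div (by fun_prop) (by fun_prop) (hne x hx.1)
    simpa only [ofReal_zero, zero_mul, add_zero, contourInt] using integral_add_mul_I_eq hdiff hperG
  have hneg : ∫ x in (0 : ℝ)..1, Q x * cayley (t / e(x)) = contourInt Q Y t := by
    rw [← hshift, ← add_zero (∫ x in (0 : ℝ)..1, _)]
    simpa only [add_zero, heven, exp_two_pi_I_neg, ← div_eq_mul_inv] using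
      integral_neg_add_eq (G := fun x => Q x * cayley (t * e(x))) hperG 0
  have hcont : Continuous fun x : ℝ => Q x * cayley (t * e(x)) := by
    simpa using continuous_mul_cayley (y := 0) (t := t) (fun x hx => hQ x (by simpa [hx] using hY))
      (by simpa using ht.ne)
  have hcont' : Continuous fun x : ℝ => Q x * cayley (t / e(x)) := by
    have := hcont.comp continuous_neg
    simpa only [Function.comp_def, ofReal_neg, heven, exp_two_pi_I_neg, ← div_eq_mul_inv] using this
  have hpt : ∀ x : ℝ, Q x / ((1 - t * e(x)) * (1 - t / e(x))) = (2 * (1 - t ^ 2))⁻¹ *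
      (Q x * cayley (t * e(x)) + Q x * cayley (t / e(x))) := fun x => by
    have hne' := hne (-x) (by simp)
    rw [exp_two_pi_I_neg, ← div_eq_mul_inv] at hne'
    rw [← mul_add, cayley_mul_add_cayley_div (exp_ne_zero _) (hne x (by simp)) hne']
    have ht2 := one_sub_sq_ne_zero ht
    field_simp
  simp only [hpt]
  rw [intervalIntegral.integral_const_mul, intervalIntegral.integral_add
    (hcont.intervalIntegrable _ _) (hcont'.intervalIntegrable _ _), hneg, hshift, mul_inv]
  ring

end

/-! ### Continuation of an integral with a pinched contour -/

/-- The factor `(1 - u v)(1 - u / v) = u ((u + u⁻¹) - (v + v⁻¹))`. -/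
def pairFactor (u v : ℂ) : ℂ := (1 - u * v) * (1 - u / v)

theorem pairFactor_eq {u v : ℂ} (hu : u ≠ 0) (hv : v ≠ 0) :
    pairFactor u v = u * ((u + u⁻¹) - (v + v⁻¹)) := by
  rw [pairFactor]
  field_simp
  ring

theorem pairFactor_inv_right (u v : ℂ) : pairFactor u v⁻¹ = pairFactor u v := by
  rw [pairFactor, pairFactor, div_inv_eq_mul, ← div_eq_mul_inv, mul_comm]

theorem pairFactor_ne_zero_iff {u v : ℂ} (hv : v ≠ 0) :
    pairFactor u v ≠ 0 ↔ u * v ≠ 1 ∧ u ≠ v := by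
  rw [pairFactor, mul_ne_zero_iff, sub_ne_zero, sub_ne_zero, ne_comm, ne_comm (a := 1)]
  exact and_congr_right' (div_eq_one_iff_eq hv).not

theorem inv_prod_pairFactor_eq_sum {ι : Type*} [DecidableEq ι] {K : Finset ι} (hK : K.Nonempty)
    {t : ι → ℂ} {w : ℂ} (hw : w ≠ 0) (ht : ∀ i ∈ K, t i ≠ 0)
    (hsep : ∀ i ∈ K, ∀ j ∈ K, i ≠ j → pairFactor (t i) (t j) ≠ 0)
    (hne : ∀ i ∈ K, pairFactor (t i) w ≠ 0) :
    (∏ i ∈ K, pairFactor (t i) w)⁻¹ =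
      ∑ j ∈ K, (∏ i ∈ K.erase j, pairFactor (t i) (t j))⁻¹ * (pairFactor (t j) w)⁻¹ := by
  let d : ι → ℂ := fun i => t i + (t i)⁻¹
  have hinj : Set.InjOn d K := by
    intro i hi j hj hij
    by_contra hne'
    exact hsep i hi j hj hne'
      (by rw [pairFactor_eq (ht i hi) (ht j hj), mul_eq_zero, sub_eq_zero]; exact Or.inr hij)
  have hbasis := congrArg (Polynomial.eval (w + w⁻¹)) (Lagrange.sum_basis hinj hK)
  rw [Polynomial.eval_finsetSum, Polynomial.eval_one] at hbasis
  rw [← mul_one (∏ i ∈ K, _)⁻¹, ← hbasis, Finset.mul_sum]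
  refine Finset.sum_congr rfl fun j hj => ?_
  rw [← Finset.mul_prod_erase K _ hj, mul_inv, mul_comm (pairFactor (t j) w)⁻¹, mul_right_comm]
  congr 1
  rw [Lagrange.basis, Polynomial.eval_prod, ← Finset.prod_inv_distrib, ← Finset.prod_inv_distrib,
    ← Finset.prod_mul_distrib]
  refine Finset.prod_congr rfl fun i hi => ?_
  obtain ⟨hij, hi'⟩ := Finset.mem_erase.mp hi
  have hiw := hne i hi'
  have hji := hsep i hi' j hj hij
  rw [pairFactor_eq (ht i hi') hw] at hiw ⊢
  rw [pairFactor_eq (ht i hi') (ht j hj)] at hji ⊢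
  simp only [Lagrange.basisDivisor, Polynomial.eval_mul, Polynomial.eval_C, Polynomial.eval_sub,
    Polynomial.eval_X]
  change (t i * (d i - (w + w⁻¹)))⁻¹ * _ = (t i * (d i - d j))⁻¹
  have hwi : d i - (w + w⁻¹) ≠ 0 := right_ne_zero_of_mul hiw
  have hdij : d i - d j ≠ 0 := right_ne_zero_of_mul hji
  have hti := ht i hi'
  rw [← neg_sub (d i) (d j), inv_neg, ← neg_sub (d i) (w + w⁻¹)]
  generalize d i - (w + w⁻¹) = a at *
  generalize d i - d j = b at *
  field_simp

theorem analyticOnNhd_integral {f : ℂ × ℂ → ℂ} {U : Set ℂ} (hU : IsOpen U) {Y : ℝ}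
    (hf : ∀ s ∈ U, ∀ x : ℝ, AnalyticAt ℂ f (s, x + Y * I)) :
    AnalyticOnNhd ℂ (fun s => ∫ x in (0 : ℝ)..1, f (s, x + Y * I)) U := by
  refine DifferentiableOn.analyticOnNhd (fun s₀ hs₀ => ?_) hU
  let g : ℂ × ℝ → ℂ × ℂ := fun y => (y.1, y.2 + Y * I)
  have hg : Continuous g := by fun_prop
  have hfderiv : ∀ y : ℂ × ℝ, y.1 ∈ U →
      ContinuousAt (fun y : ℂ × ℝ => fderiv ℂ f (g y) (1, 0)) y := fun y hy =>
    have hg' : ContinuousAt (fderiv ℂ f) (g y) := (hf y.1 hy y.2).fderiv.continuousAt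
    (hg'.comp hg.continuousAt).clm_apply continuousAt_const
  obtain ⟨R, hR, hball⟩ := Metric.nhds_basis_closedBall.mem_iff.mp (hU.mem_nhds hs₀)
  obtain ⟨M, hM⟩ := ((isCompact_closedBall s₀ R).prod
    (isCompact_uIcc (a := (0 : ℝ)) (b := 1))).exists_bound_of_continuousOn
    fun y hy => (hfderiv y (hball hy.1)).continuousWithinAt
  have hfcont : ∀ s ∈ U, Continuous fun x : ℝ => f (s, x + Y * I) := fun s hs =>
    continuous_iff_continuousAt.mpr fun x => (hf s hs x).continuousAt.comp
      (f := fun x : ℝ => (s, (x : ℂ) + Y * I)) (by fun_prop)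
  have hfderivcont : Continuous fun x : ℝ => fderiv ℂ f (g (s₀, x)) (1, 0) :=
    continuous_iff_continuousAt.mpr fun x =>
      (hfderiv (s₀, x) hs₀).comp (f := fun x : ℝ => (s₀, x)) (by fun_prop)
  refine (intervalIntegral.hasDerivAt_integral_of_dominated_loc_of_deriv_le
    (F' := fun s (x : ℝ) => fderiv ℂ f (g (s, x)) (1, 0)) (bound := fun _ => M)
    (Metric.closedBall_mem_nhds s₀ hR) ?_ ((hfcont s₀ hs₀).intervalIntegrable _ _)
    hfderivcont.aestronglyMeasurable
    (ae_of_all _ fun x hx s hs => hM (s, x) ⟨hs, Set.uIoc_subset_uIcc hx⟩) (by simp)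
    (ae_of_all _ fun x _ s hs => ?_)).2.differentiableAt.differentiableWithinAt
  · filter_upwards [hU.mem_nhds hs₀] with s hs using (hfcont s hs).aestronglyMeasurable
  · exact (hf s (hball hs) x).differentiableAt.hasFDerivAt.comp_hasDerivAt s
      ((hasDerivAt_id s).prodMk (hasDerivAt_const s _))

section

variable {ι : Type*} {Q : ℂ × ℂ → ℂ} {Y : ℝ} {K L : Finset ι} {t : ι → ℂ → ℂ} {U : Set ℂ} {g : ℂ}

theorem analyticOnNhd_contourInt (hU : IsOpen U)
    (hQ : ∀ s ∈ U, ∀ x : ℂ, x.im = Y → AnalyticAt ℂ Q (s, x)) {u : ℂ → ℂ} (hu : Differentiable ℂ u)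
    (hlt : ∀ s ∈ U, ‖u s‖ * Real.exp (-(2 * π * Y)) < 1) :
    AnalyticOnNhd ℂ (fun s => contourInt (fun x => Q (s, x)) Y (u s)) U := by
  refine analyticOnNhd_integral (f := fun y => Q y * cayley (u y.1 * e(y.2))) hU fun s hs x => ?_
  have hucomp : AnalyticAt ℂ (fun y : ℂ × ℂ => u y.1) (s, x + Y * I) :=
    (hu.analyticAt s).fun_comp (f := fun y : ℂ × ℂ => y.1) analyticAt_fst
  have hue : AnalyticAt ℂ (fun y : ℂ × ℂ => u y.1 * e(y.2)) (s, x + Y * I) :=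
    hucomp.mul (analyticAt_const.mul analyticAt_snd).cexp'
  exact (hQ s hs _ (by simp)).mul ((analyticAt_const.add hue).div (analyticAt_const.sub hue)
    (one_sub_mul_exp_ne_zero (by simpa using (hlt s hs).ne)))

/-- The contribution of the pole `x = -log (t k) / 2πi` to the partial fraction expansion of the
integral of `Q / ∏ i ∈ K, pairFactor (t i) e(x)`, for `L = K \ {k}`. -/
def poleTerm (Q : ℂ × ℂ → ℂ) (Y : ℝ) (L : Finset ι) (t : ι → ℂ → ℂ) (k : ι) (s : ℂ) : ℂ :=
  contourInt (fun x => Q (s, x)) Y (t k s) /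
    ((1 - t k s ^ 2) * ∏ i ∈ L, pairFactor (t i s) (t k s))

theorem differentiable_pairFactor {u v : ℂ → ℂ} (hu : Differentiable ℂ u) (hv : Differentiable ℂ v)
    (hv0 : ∀ s, v s ≠ 0) : Differentiable ℂ fun s => pairFactor (u s) (v s) :=
  ((differentiable_const _).sub (hu.mul hv)).mul ((differentiable_const _).sub (hu.div hv hv0))

theorem differentiable_poleTerm_denom (ht : ∀ i ∈ L, Differentiable ℂ (t i)) {k : ι}
    (htk : Differentiable ℂ (t k)) (htk0 : ∀ s, t k s ≠ 0) :
    Differentiable ℂ fun s => (1 - t k s ^ 2) * ∏ i ∈ L, pairFactor (t i s) (t k s) :=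
  ((differentiable_const _).sub (htk.pow 2)).mul
    (Differentiable.fun_finsetProd fun i hi => differentiable_pairFactor (ht i hi) htk htk0)

theorem meromorphicOn_poleTerm (hU : IsOpen U)
    (hQ : ∀ s ∈ U, ∀ x : ℂ, x.im = Y → AnalyticAt ℂ Q (s, x))
    (ht : ∀ i ∈ L, Differentiable ℂ (t i)) {k : ι} (htk : Differentiable ℂ (t k))
    (htk0 : ∀ s, t k s ≠ 0) (hlt : ∀ s ∈ U, ‖t k s‖ * Real.exp (-(2 * π * Y)) < 1) :
    MeromorphicOn (poleTerm Q Y L t k) U := fun s hs =>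
  (analyticOnNhd_contourInt hU hQ htk hlt s hs).meromorphicAt.div
    ((differentiable_poleTerm_denom ht htk htk0).analyticAt s).meromorphicAt

theorem continuousAt_poleTerm (hU : IsOpen U) (hg : g ∈ U)
    (hQ : ∀ s ∈ U, ∀ x : ℂ, x.im = Y → AnalyticAt ℂ Q (s, x))
    (ht : ∀ i ∈ L, Differentiable ℂ (t i)) {k : ι} (htk : Differentiable ℂ (t k))
    (htk0 : ∀ s, t k s ≠ 0) (hlt : ∀ s ∈ U, ‖t k s‖ * Real.exp (-(2 * π * Y)) < 1)
    (hsq : t k g ^ 2 ≠ 1) (hsep : ∀ i ∈ L, pairFactor (t i g) (t k g) ≠ 0) :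
    ContinuousAt (poleTerm Q Y L t k) g :=
  (analyticOnNhd_contourInt hU hQ htk hlt g hg).continuousAt.div
    (differentiable_poleTerm_denom ht htk htk0).continuous.continuousAt
    (mul_ne_zero (sub_ne_zero.mpr hsq.symm) (Finset.prod_ne_zero_iff.mpr hsep))

theorem poleTerm_add_poleTerm_partner {k l : ι}
    (hQ : ∀ x : ℂ, |x.im| ≤ Y → AnalyticAt ℂ (fun x => Q (g, x)) x)
    (hper : ∀ x, Q (g, x + 1) = Q (g, x)) (heven : ∀ x, Q (g, -x) = Q (g, x))
    (hone : t l g * t k g = 1) {x₀ : ℂ} (hx₀ : |x₀.im| < Y) (hx : t k g * e(x₀) = 1) :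
    poleTerm Q Y L t k g / (1 - (t k g)⁻¹ ^ 2) + poleTerm Q Y L t l g / (1 - (t l g)⁻¹ ^ 2) =
      2 * Q (g, x₀) /
        ((1 - (t k g)⁻¹ ^ 2) * (1 - t k g ^ 2) * ∏ i ∈ L, pairFactor (t i g) (t k g)) := by
  rw [← contourInt_add_contourInt_inv hQ hper heven hx₀ hx, poleTerm, poleTerm,
    eq_inv_of_mul_eq_one_left hone, inv_inv]
  simp only [pairFactor_inv_right, div_eq_mul_inv, mul_inv]
  ring

variable [DecidableEq ι]

theorem sum_poleTerm_eq_integral (hY : 0 ≤ Y) (hK : K.Nonempty) {s : ℂ}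
    (hQ : ∀ x : ℂ, |x.im| ≤ Y → AnalyticAt ℂ (fun x => Q (s, x)) x)
    (hper : ∀ x, Q (s, x + 1) = Q (s, x)) (heven : ∀ x, Q (s, -x) = Q (s, x))
    (ht0 : ∀ i ∈ K, t i s ≠ 0) (hlt : ∀ i ∈ K, ‖t i s‖ < 1)
    (hinj : ∀ i ∈ K, ∀ j ∈ K, i ≠ j → t i s ≠ t j s) :
    ∑ k ∈ K, poleTerm Q Y (K.erase k) t k s =
      ∫ x in (0 : ℝ)..1, Q (s, x) / ∏ i ∈ K, pairFactor (t i s) e(x) := by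
  have hnorm : ∀ x : ℝ, ‖e(x)‖ = 1 := fun x => by simp [norm_exp_two_pi_I_mul]
  have hmul : ∀ u v : ℂ, ‖u‖ < 1 → ‖v‖ ≤ 1 → u * v ≠ 1 := fun u v hu hv h =>
    (mul_lt_one_of_nonneg_of_lt_one_left (norm_nonneg u) hu hv).ne (by rw [← norm_mul, h, norm_one])
  have hfac : ∀ i ∈ K, ∀ x : ℝ, pairFactor (t i s) e(x) ≠ 0 := fun i hi x =>
    (pairFactor_ne_zero_iff (exp_ne_zero _)).mpr
      ⟨hmul _ _ (hlt i hi) (hnorm x).le, fun h => (hlt i hi).ne (h ▸ hnorm x)⟩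
  have hpf : ∀ x : ℝ, Q (s, x) / ∏ i ∈ K, pairFactor (t i s) e(x) =
      ∑ k ∈ K, (∏ i ∈ K.erase k, pairFactor (t i s) (t k s))⁻¹ *
        (Q (s, x) / pairFactor (t k s) e(x)) := by
    intro x
    rw [div_eq_mul_inv, inv_prod_pairFactor_eq_sum hK (exp_ne_zero _) ht0 ?_ (hfac · · x),
      Finset.mul_sum]
    · exact Finset.sum_congr rfl fun k _ => by ring
    · exact fun i hi j hj hij => (pairFactor_ne_zero_iff (ht0 j hj)).mpr
        ⟨hmul _ _ (hlt i hi) (hlt j hj).le, hinj i hi j hj hij⟩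
  simp only [hpf]
  rw [intervalIntegral.integral_finsetSum]
  · refine Finset.sum_congr rfl fun k hk => ?_
    have hint : ∫ x in (0 : ℝ)..1, Q (s, x) / pairFactor (t k s) e(x) =
        contourInt (fun x => Q (s, x)) Y (t k s) / (1 - t k s ^ 2) :=
      integral_div_eq_contourInt hY hQ hper heven (hlt k hk)
    rw [intervalIntegral.integral_const_mul, hint, poleTerm, div_mul_eq_div_div, mul_comm,
      div_eq_mul_inv (_ / _)]
  · intro k hk
    have hQc : Continuous fun x : ℝ => Q (s, x) := continuous_iff_continuousAt.mpr fun x =>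
      (hQ x (by simpa using hY)).continuousAt.comp (f := fun x : ℝ => (x : ℂ)) (by fun_prop)
    refine ((hQc.div ?_ (hfac k hk)).const_mul _).intervalIntegrable _ _
    exact (Continuous.sub (by fun_prop) (by fun_prop)).mul
      (continuous_const.sub (continuous_const.div (by fun_prop) fun x => exp_ne_zero _))

theorem poleTerm_erase_eq_div {k l : ι} (hl : l ∈ L) (s : ℂ) :
    poleTerm Q Y L t k s = poleTerm Q Y (L.erase l) t k s / pairFactor (t l s) (t k s) := by
  rw [poleTerm, poleTerm, ← Finset.mul_prod_erase L _ hl, div_div]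
  ring

/-- At `g` the poles of `k` and of its partner `σ k` pinch the contour; the zero of the prefactor
`D` at `g` compensates this. -/
theorem tendsto_mul_poleTerm_of_pinched (hU : IsOpen U) (hg : g ∈ U)
    (hQ : ∀ s ∈ U, ∀ x : ℂ, x.im = Y → AnalyticAt ℂ Q (s, x))
    (ht : ∀ i ∈ K, Differentiable ℂ (t i)) (ht0 : ∀ i ∈ K, ∀ s, t i s ≠ 0) {k l : ι} (hk : k ∈ K)
    (hl : l ∈ K.erase k) (hlt : ∀ s ∈ U, ‖t k s‖ * Real.exp (-(2 * π * Y)) < 1) {D Dhat : ℂ → ℂ}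
    (hDhat : ContinuousAt Dhat g) (hD : ∀ s, D s = Dhat s * (1 - t l s * t k s))
    (hpun : ∀ᶠ s in 𝓝[≠] g, t l s * t k s ≠ 1) (hone : t l g * t k g = 1) (hsq : t k g ^ 2 ≠ 1)
    (hsep : ∀ i ∈ (K.erase k).erase l, pairFactor (t i g) (t k g) ≠ 0) :
    Tendsto (fun s => D s * poleTerm Q Y (K.erase k) t k s) (𝓝[≠] g)
      (𝓝 (Dhat g * (poleTerm Q Y ((K.erase k).erase l) t k g / (1 - (t k g)⁻¹ ^ 2)))) := by
  have htL : ∀ i ∈ (K.erase k).erase l, Differentiable ℂ (t i) := fun i hi =>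
    ht i (Finset.mem_of_mem_erase (Finset.mem_of_mem_erase hi))
  have hratio : t l g / t k g = (t k g)⁻¹ ^ 2 := by
    rw [eq_inv_of_mul_eq_one_left hone]
    ring
  have hratio1 : 1 - t l g / t k g ≠ 0 := by
    rw [hratio, inv_pow, sub_ne_zero, ne_comm, inv_ne_one]
    exact hsq
  have hcont : ContinuousAt (fun s => Dhat s *
      (poleTerm Q Y ((K.erase k).erase l) t k s / (1 - t l s / t k s))) g := by
    have htl := (ht l (Finset.mem_of_mem_erase hl)).continuous.continuousAt (x := g)
    have htk := (ht k hk).continuous.continuousAt (x := g)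
    exact hDhat.mul ((continuousAt_poleTerm hU hg hQ htL (ht k hk) (ht0 k hk) hlt hsq hsep).div
      (continuousAt_const.sub (htl.div htk (ht0 k hk g))) hratio1)
  have hlim := hcont.tendsto.mono_left (nhdsWithin_le_nhds (s := {g}ᶜ))
  rw [hratio] at hlim
  refine hlim.congr' ?_
  filter_upwards [hpun] with s hs
  rw [poleTerm_erase_eq_div hl, hD s, pairFactor, mul_assoc, ← mul_div_assoc (1 - _),
    mul_div_mul_left _ _ (sub_ne_zero.mpr hs.symm)]

theorem tendsto_mul_sum_poleTerm (hU : IsOpen U) (hg : g ∈ U)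
    (hQ : ∀ s ∈ U, ∀ x : ℂ, x.im = Y → AnalyticAt ℂ Q (s, x))
    (ht : ∀ i ∈ K, Differentiable ℂ (t i)) (ht0 : ∀ i ∈ K, ∀ s, t i s ≠ 0)
    (hlt : ∀ i ∈ K, ∀ s ∈ U, ‖t i s‖ * Real.exp (-(2 * π * Y)) < 1)
    {D Dhat : ℂ → ℂ} (hDcont : ContinuousAt D g) (hD0 : D g = 0) (hDhat : ContinuousAt Dhat g)
    {B : Finset ι} (hB : B ⊆ K) {σ : ι → ι} (hσ : ∀ k ∈ B, σ k ∈ K.erase k)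
    (hD : ∀ k ∈ B, ∀ s, D s = Dhat s * (1 - t (σ k) s * t k s))
    (hpun : ∀ k ∈ B, ∀ᶠ s in 𝓝[≠] g, t (σ k) s * t k s ≠ 1)
    (hone : ∀ k ∈ B, t (σ k) g * t k g = 1)
    (hinj : ∀ i ∈ K, ∀ j ∈ K, i ≠ j → t i g ≠ t j g)
    (hsep : ∀ i ∈ K, ∀ j ∈ K, t i g * t j g = 1 → j ∈ B ∧ i = σ j) :
    Tendsto (fun s => D s * ∑ k ∈ K, poleTerm Q Y (K.erase k) t k s) (𝓝[≠] g)
      (𝓝 (Dhat g * ∑ k ∈ B,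
        poleTerm Q Y ((K.erase k).erase (σ k)) t k g / (1 - (t k g)⁻¹ ^ 2))) := by
  have hsq : ∀ k ∈ K, t k g ^ 2 ≠ 1 := fun k hk h =>
    have hself := hsep k hk k hk (by rw [← sq, h])
    Finset.ne_of_mem_erase (hσ k hself.1) hself.2.symm
  have hunpinched : ∀ k ∈ K \ B,
      Tendsto (fun s => D s * poleTerm Q Y (K.erase k) t k s) (𝓝[≠] g) (𝓝 0) := by
    intro k hk
    obtain ⟨hkK, hkB⟩ := Finset.mem_sdiff.mp hk
    have hcont := hDcont.mul (continuousAt_poleTerm (L := K.erase k) hU hg hQ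
      (fun i hi => ht i (Finset.mem_of_mem_erase hi)) (ht k hkK) (ht0 k hkK) (hlt k hkK) (hsq k hkK)
      fun i hi => (pairFactor_ne_zero_iff (ht0 k hkK g)).mpr
        ⟨fun h => hkB (hsep i (Finset.mem_of_mem_erase hi) k hkK h).1,
          hinj i (Finset.mem_of_mem_erase hi) k hkK (Finset.ne_of_mem_erase hi)⟩)
    have hlim := hcont.tendsto.mono_left (nhdsWithin_le_nhds (s := {g}ᶜ))
    rwa [Pi.mul_apply, hD0, zero_mul] at hlim
  have hpinched : ∀ k ∈ B, Tendsto (fun s => D s * poleTerm Q Y (K.erase k) t k s) (𝓝[≠] g)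
      (𝓝 (Dhat g * (poleTerm Q Y ((K.erase k).erase (σ k)) t k g / (1 - (t k g)⁻¹ ^ 2)))) := by
    intro k hk
    refine tendsto_mul_poleTerm_of_pinched hU hg hQ ht ht0 (hB hk) (hσ k hk) (hlt k (hB hk)) hDhat
      (hD k hk) (hpun k hk) (hone k hk) (hsq k (hB hk)) fun i hi => ?_
    obtain ⟨hiσ, hi'⟩ := Finset.mem_erase.mp hi
    obtain ⟨hik, hiK⟩ := Finset.mem_erase.mp hi'
    exact (pairFactor_ne_zero_iff (ht0 k (hB hk) g)).mpr
      ⟨fun h => hiσ (hsep i hiK k (hB hk) h).2, hinj i hiK k (hB hk) hik⟩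
  have hsum := (tendsto_finsetSum _ hunpinched).add (tendsto_finsetSum _ hpinched)
  simp only [Finset.sum_sdiff hB, Finset.sum_const_zero, zero_add] at hsum
  simpa only [Finset.mul_sum] using hsum

end

/-! ### The kernel of the intertwining operator -/

/-- The lattice point `Λⱼ = aτ + b(2η)` with label `j = (a, b)`. -/
def latPoint (τ η : ℂ) (j : ℕ × ℕ) : ℂ := j.1 * τ + j.2 * (2 * η)

/-- The product of `1 - w e(Λⱼ)` over the labels `j ∉ J`; for `J = ∅` it is `(w;p,q)_∞`. -/
def latProd (τ η : ℂ) (J : Finset (ℕ × ℕ)) (w : ℂ) : ℂ :=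
  prodOneSub (fun j => if j ∈ J then 0 else e(latPoint τ η j)) w

/-- The elliptic gamma function `Γ` without its poles at `-Λⱼ + ℤ`, `j ∈ J`: the corresponding
factors of the denominator are left out. -/
def gammaTail (τ η : ℂ) (J : Finset (ℕ × ℕ)) (y : ℂ) : ℂ :=
  latProd τ η ∅ e(τ + 2 * η - y) / latProd τ η J e(y)

/-- The function `1 / (Γ(y) Γ(-y))`, as a product of theta functions. -/
def thetaFactor (τ η y : ℂ) : ℂ :=
  -(constR τ * theta1 y τ * (constR (2 * η) * theta1 y (2 * η)))

theorem exp_two_pi_I_add (x y : ℂ) : e(x + y) = e(x) * e(y) := by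
  rw [mul_add, exp_add]

theorem exp_two_pi_I_sub (x y : ℂ) : e(x - y) = e(x) / e(y) := by
  rw [mul_sub, exp_sub]

section

variable {τ η : ℂ}

theorem latPoint_im_nonneg (hτ : 0 < τ.im) (hη : 0 < η.im) (j : ℕ × ℕ) :
    0 ≤ (latPoint τ η j).im := by
  have him : (latPoint τ η j).im = j.1 * τ.im + j.2 * (2 * η.im) := by simp [latPoint]
  rw [him]
  positivity

theorem exp_latPoint (j : ℕ × ℕ) : e(latPoint τ η j) = e(τ) ^ j.1 * e(2 * η) ^ j.2 := by
  rw [latPoint, ← exp_nat_mul, ← exp_nat_mul, ← exp_add]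
  ring_nf

theorem summable_norm_exp_latPoint (hτ : 0 < τ.im) (hη : 0 < η.im) :
    Summable fun j => ‖e(latPoint τ η j)‖ := by
  simp only [exp_latPoint]
  exact summable_norm_pow_mul_pow (norm_exp_two_pi_I_mul_lt_one hτ)
    (norm_exp_two_pi_I_mul_lt_one (by simpa using hη))

theorem latProd_empty (w : ℂ) : latProd τ η ∅ w = pqProd e(τ) e(2 * η) w := by
  simp only [latProd, pqProd, Finset.notMem_empty, if_false, exp_latPoint]

theorem differentiable_latProd (hτ : 0 < τ.im) (hη : 0 < η.im) (J : Finset (ℕ × ℕ)) :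
    Differentiable ℂ (latProd τ η J) :=
  differentiable_prodOneSub (summable_norm_ite_zero (summable_norm_exp_latPoint hτ hη) _)

theorem latProd_exp_eq_zero_iff (hτ : 0 < τ.im) (hη : 0 < η.im) {J : Finset (ℕ × ℕ)} {y : ℂ} :
    latProd τ η J e(y) = 0 ↔ ∃ j ∉ J, ∃ a : ℤ, y + latPoint τ η j = a := by
  rw [latProd, prodOneSub_eq_zero_iff
    (summable_norm_ite_zero (summable_norm_exp_latPoint hτ hη) _)]
  refine exists_congr fun j => ?_
  by_cases hj : j ∈ J
  · simp [hj]
  · rw [if_neg hj, ← exp_two_pi_I_add]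
    refine ⟨fun h => ⟨hj, exists_int_eq_of_exp_eq_one h⟩, ?_⟩
    rintro ⟨-, a, ha⟩
    rw [ha, mul_comm, exp_int_mul_two_pi_mul_I]

theorem latProd_exp_ne_zero (hτ : 0 < τ.im) (hη : 0 < η.im) {J : Finset (ℕ × ℕ)} {y : ℂ}
    (hy : ∀ j ∉ J, 0 < (y + latPoint τ η j).im) : latProd τ η J e(y) ≠ 0 := by
  rw [Ne, latProd_exp_eq_zero_iff hτ hη]
  rintro ⟨j, hj, a, ha⟩
  exact (hy j hj).ne' (by rw [ha, intCast_im])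

theorem latProd_empty_exp_ne_zero (hτ : 0 < τ.im) (hη : 0 < η.im) {y : ℂ} (hy : 0 < y.im) :
    latProd τ η ∅ e(y) ≠ 0 :=
  latProd_exp_ne_zero hτ hη fun j _ => add_pos_of_pos_of_nonneg hy (latPoint_im_nonneg hτ hη j)

theorem latProd_exp_eq_prod_mul (hτ : 0 < τ.im) (hη : 0 < η.im) {J J' : Finset (ℕ × ℕ)}
    (hJ : J ⊆ J') (y : ℂ) :
    latProd τ η J e(y) = (∏ j ∈ J' \ J, (1 - e(y + latPoint τ η j))) * latProd τ η J' e(y) := by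
  simp only [exp_two_pi_I_add]
  exact prodOneSub_ite_eq_prod_mul (summable_norm_exp_latPoint hτ hη) hJ e(y)

theorem ellGamma_eq_gammaTail (hτ : 0 < τ.im) (hη : 0 < η.im) (y : ℂ) :
    ellGamma τ η y = gammaTail τ η ∅ y := by
  have hp := norm_exp_two_pi_I_mul_lt_one hτ
  have hq : ‖e(2 * η)‖ < 1 := norm_exp_two_pi_I_mul_lt_one (by simpa using hη)
  have hsum := summable_norm_pow_mul_pow hp hq
  rw [ellGamma, gammaTail, latProd_empty, latProd_empty, add_sub_assoc, exp_two_pi_I_add,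
    exp_two_pi_I_sub, exp_neg, show 4 * (π : ℂ) * I * η = 2 * π * I * (2 * η) by ring]
  generalize e(τ) = p at *
  generalize e(2 * η) = q at *
  by_cases h0 : pqProd p q e(y) = 0
  · obtain ⟨j, hj⟩ := (prodOneSub_eq_zero_iff hsum _).mp h0
    rw [h0, div_zero]
    exact tprod_of_exists_eq_zero ⟨j, by rw [mul_assoc e(y), hj, sub_self, div_zero]⟩
  · exact (((hasProd_prodOneSub hsum (p * (q / e(y)))).div₀ (hasProd_prodOneSub hsum e(y))
      h0).congr_fun fun j => by ring).tprod_eq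

theorem gammaTail_eq_mul_of_subset (hτ : 0 < τ.im) (hη : 0 < η.im) {J J' : Finset (ℕ × ℕ)}
    (hJ : J ⊆ J') (y : ℂ) :
    gammaTail τ η J y =
      gammaTail τ η J' y * (∏ j ∈ J' \ J, (1 - e(y + latPoint τ η j)))⁻¹ := by
  rw [gammaTail, gammaTail, latProd_exp_eq_prod_mul hτ hη hJ, ← div_eq_mul_inv, div_div,
    mul_comm (latProd _ _ _ _)]

theorem differentiable_latProd_exp (hτ : 0 < τ.im) (hη : 0 < η.im) (J : Finset (ℕ × ℕ)) :
    Differentiable ℂ fun y => latProd τ η J e(y) :=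
  (differentiable_latProd hτ hη J).comp (by fun_prop)

theorem differentiable_gammaTail_num (hτ : 0 < τ.im) (hη : 0 < η.im) :
    Differentiable ℂ fun y => latProd τ η ∅ e(τ + 2 * η - y) :=
  (differentiable_latProd hτ hη ∅).comp (by fun_prop)

theorem meromorphicAt_gammaTail (hτ : 0 < τ.im) (hη : 0 < η.im) (J : Finset (ℕ × ℕ)) (y : ℂ) :
    MeromorphicAt (gammaTail τ η J) y :=
  ((differentiable_gammaTail_num hτ hη).analyticAt y).meromorphicAt.div
    ((differentiable_latProd_exp hτ hη J).analyticAt y).meromorphicAt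

theorem analyticAt_gammaTail (hτ : 0 < τ.im) (hη : 0 < η.im) {J : Finset (ℕ × ℕ)} {y : ℂ}
    (hy : latProd τ η J e(y) ≠ 0) : AnalyticAt ℂ (gammaTail τ η J) y :=
  ((differentiable_gammaTail_num hτ hη).analyticAt y).div
    ((differentiable_latProd_exp hτ hη J).analyticAt y) hy

theorem analyticAt_inv_gammaTail (hτ : 0 < τ.im) (hη : 0 < η.im) (J : Finset (ℕ × ℕ)) {y : ℂ}
    (hy : y.im < (τ + 2 * η).im) : AnalyticAt ℂ (gammaTail τ η J)⁻¹ y := by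
  have hinv : (gammaTail τ η J)⁻¹ =
      fun y => latProd τ η J e(y) / latProd τ η ∅ e(τ + 2 * η - y) :=
    funext fun y => inv_div _ _
  rw [hinv]
  refine ((differentiable_latProd_exp hτ hη J).analyticAt y).fun_div
    ((differentiable_gammaTail_num hτ hη).analyticAt y) (latProd_empty_exp_ne_zero hτ hη ?_)
  rwa [sub_im, sub_pos]

theorem gammaTail_add_one (J : Finset (ℕ × ℕ)) (y : ℂ) :
    gammaTail τ η J (y + 1) = gammaTail τ η J y := by
  rw [gammaTail, gammaTail, exp_two_pi_I_add_one, ← exp_two_pi_I_add_one (τ + 2 * η - (y + 1)),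
    sub_add_eq_sub_sub, sub_add_cancel]

theorem modTheta_inv {p : ℂ} (hp : ‖p‖ < 1) {w : ℂ} (hw : w ≠ 0) :
    modTheta p w⁻¹ = -w⁻¹ * modTheta p w := by
  rw [modTheta, modTheta, qProd_eq_one_sub_mul hp w⁻¹, qProd_eq_one_sub_mul hp w, div_inv_eq_mul,
    div_eq_mul_inv]
  field_simp
  ring

theorem thetaFactor_eq (hτ : 0 < τ.im) (hη : 0 < η.im) (y : ℂ) :
    thetaFactor τ η y = -(e(y))⁻¹ * (modTheta e(τ) e(y) * modTheta e(2 * η) e(y)) := by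
  have hexp : (e(y))⁻¹ = exp (-(π * I * y)) * exp (-(π * I * y)) := by
    rw [← exp_neg, ← exp_add]
    ring_nf
  rw [thetaFactor, constR_mul_theta1 hτ, constR_mul_theta1 (by simpa using hη), hexp]
  ring

theorem thetaFactor_neg (y : ℂ) : thetaFactor τ η (-y) = thetaFactor τ η y := by
  rw [thetaFactor, thetaFactor, theta1_neg, theta1_neg]
  ring

theorem thetaFactor_add_one (hτ : 0 < τ.im) (hη : 0 < η.im) (y : ℂ) :
    thetaFactor τ η (y + 1) = thetaFactor τ η y := by
  rw [thetaFactor_eq hτ hη, thetaFactor_eq hτ hη, exp_two_pi_I_add_one]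

theorem differentiable_modTheta_exp (hτ : 0 < τ.im) :
    Differentiable ℂ fun y => modTheta e(τ) e(y) := by
  have hp := differentiable_qProd (norm_exp_two_pi_I_mul_lt_one hτ)
  simp only [modTheta, ← exp_two_pi_I_sub]
  exact (hp.comp (by fun_prop)).mul (hp.comp (by fun_prop))

theorem differentiable_thetaFactor (hτ : 0 < τ.im) (hη : 0 < η.im) :
    Differentiable ℂ (thetaFactor τ η) := by
  rw [funext (thetaFactor_eq hτ hη)]
  simp only [← exp_two_pi_I_neg]
  exact (Differentiable.neg (by fun_prop)).mul ((differentiable_modTheta_exp hτ).mul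
    (differentiable_modTheta_exp (by simpa using hη)))

theorem inv_ellGamma_mul_ellGamma_neg (hτ : 0 < τ.im) (hη : 0 < η.im) {y : ℂ}
    (hy : latProd τ η ∅ e(τ + 2 * η + y) ≠ 0) (hy' : latProd τ η ∅ e(τ + 2 * η - y) ≠ 0) :
    (ellGamma τ η y * ellGamma τ η (-y))⁻¹ = thetaFactor τ η y := by
  have hp := norm_exp_two_pi_I_mul_lt_one hτ
  have hq : ‖e(2 * η)‖ < 1 := norm_exp_two_pi_I_mul_lt_one (by simpa using hη)
  have hv0 : e(y) ≠ 0 := exp_ne_zero _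
  rw [ellGamma_eq_gammaTail hτ hη, ellGamma_eq_gammaTail hτ hη, gammaTail, gammaTail,
    sub_neg_eq_add, thetaFactor_eq hτ hη]
  rw [exp_two_pi_I_neg]
  simp only [latProd_empty, exp_two_pi_I_add, exp_two_pi_I_sub] at hy hy' ⊢
  set p := e(τ)
  set q := e(2 * η)
  set v := e(y)
  have hnum : pqProd p q v = qProd p v * (qProd q (q * v) * pqProd p q (p * q * v)) := by
    rw [pqProd_eq_qProd_mul_right hp hq v, pqProd_eq_qProd_mul_left hp hq (q * v), mul_assoc p q v]
  have hnum_inv : pqProd p q v⁻¹ = qProd q v⁻¹ * (qProd p (p / v) * pqProd p q (p * q / v)) := by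
    rw [pqProd_eq_qProd_mul_left hp hq v⁻¹, pqProd_eq_qProd_mul_right hp hq (p * v⁻¹)]
    ring_nf
  have htheta : -v⁻¹ * modTheta q v = qProd q v⁻¹ * qProd q (q * v) := by
    rw [← modTheta_inv hq hv0, modTheta, div_inv_eq_mul]
  rw [mul_left_comm, htheta, modTheta, hnum, hnum_inv]
  field_simp

end

/-- The point `±z + Λⱼ` with label `κ = (±, j)`, where `true` stands for `+`: the integrand of
`M(s)` has its poles at `x = ±(poleShift κ - s) + ℤ`. -/
def poleShift (τ η z : ℂ) (κ : Bool × ℕ × ℕ) : ℂ := (if κ.1 then z else -z) + latPoint τ η κ.2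

/-- The multiplicative form of the poles: the integrand of `M(s)` has its poles where `e(x)` or
`e(-x)` equals one of these numbers. -/
def poleVar (τ η z : ℂ) (κ : Bool × ℕ × ℕ) (s : ℂ) : ℂ := e(poleShift τ η z κ - s)

/-- The labels `j` for which a pole with label `(±, j)` pinches the contour as `s` approaches
`nη + mτ/2`. -/
def pinchBox (n m : ℕ) : Finset (ℕ × ℕ) := Finset.range (m + 1) ×ˢ Finset.range (n + 1)

/-- The reflection of `pinchBox n m` in its centre. -/
def boxReflect (n m : ℕ) (j : ℕ × ℕ) : ℕ × ℕ := (m - j.1, n - j.2)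

/-- The label of the pole together with which the pole with label `κ` pinches the contour. -/
def polePartner (n m : ℕ) (κ : Bool × ℕ × ℕ) : Bool × ℕ × ℕ := (!κ.1, boxReflect n m κ.2)

/-- The integrand of `M(s)` without its poles with labels in `Bool × J`, as a function of
`y = (s, x)`. -/
def kernelQ (τ η z : ℂ) (J : Finset (ℕ × ℕ)) (Φ : ℂ → ℂ) (y : ℂ × ℂ) : ℂ :=
  thetaFactor τ η (2 * y.2) *
    (gammaTail τ η J (z + y.2 - y.1) * gammaTail τ η J (z - y.2 - y.1) *
      gammaTail τ η J (-z + y.2 - y.1) * gammaTail τ η J (-z - y.2 - y.1)) * Φ y.2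

/-- The factor in front of the integral in `M(s)`, without its zeros at `2s ∈ Λⱼ + ℤ` for
`j ∈ J`. -/
def prefactor (τ η : ℂ) (J : Finset (ℕ × ℕ)) (s : ℂ) : ℂ :=
  qPoch (2 * η) * qPoch τ / 2 * (gammaTail τ η J (-2 * s))⁻¹

theorem mem_pinchBox {n m : ℕ} {j : ℕ × ℕ} : j ∈ pinchBox n m ↔ j.1 ≤ m ∧ j.2 ≤ n := by
  simp only [pinchBox, Finset.mem_product, Finset.mem_range, Nat.lt_succ_iff]

theorem boxReflect_mem (n m : ℕ) (j : ℕ × ℕ) : boxReflect n m j ∈ pinchBox n m :=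
  mem_pinchBox.mpr ⟨Nat.sub_le _ _, Nat.sub_le _ _⟩

theorem boxReflect_boxReflect {n m : ℕ} {j : ℕ × ℕ} (hj : j ∈ pinchBox n m) :
    boxReflect n m (boxReflect n m j) = j := by
  obtain ⟨h₁, h₂⟩ := mem_pinchBox.mp hj
  exact Prod.ext (Nat.sub_sub_self h₁) (Nat.sub_sub_self h₂)

theorem polePartner_polePartner {n m : ℕ} {κ : Bool × ℕ × ℕ} (hκ : κ.2 ∈ pinchBox n m) :
    polePartner n m (polePartner n m κ) = κ :=
  Prod.ext (Bool.not_not _) (boxReflect_boxReflect hκ)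

theorem polePartner_ne (n m : ℕ) (κ : Bool × ℕ × ℕ) : polePartner n m κ ≠ κ := fun h =>
  Bool.not_ne_self _ (congrArg Prod.fst h)

section

variable {τ η z : ℂ} {J : Finset (ℕ × ℕ)} {Φ : ℂ → ℂ} {n m : ℕ}

theorem two_mul_eq_latPoint (τ η : ℂ) (n m : ℕ) :
    2 * (n * η + m * (τ / 2)) = latPoint τ η (m, n) := by
  rw [latPoint]
  ring

theorem latPoint_boxReflect {j : ℕ × ℕ} (hj : j ∈ pinchBox n m) :
    latPoint τ η (boxReflect n m j) = latPoint τ η (m, n) - latPoint τ η j := by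
  obtain ⟨h₁, h₂⟩ := mem_pinchBox.mp hj
  simp only [latPoint, boxReflect, Nat.cast_sub h₁, Nat.cast_sub h₂]
  ring

theorem poleShift_polePartner_add {κ : Bool × ℕ × ℕ} (hκ : κ.2 ∈ pinchBox n m) :
    poleShift τ η z (polePartner n m κ) + poleShift τ η z κ = latPoint τ η (m, n) := by
  obtain ⟨b, j⟩ := κ
  cases b <;>
  · simp only [polePartner, poleShift, latPoint_boxReflect hκ, Bool.not_true, Bool.not_false,
      if_true, Bool.false_eq_true, if_false]
    ring

theorem poleShift_injective (hinc : Incommensurable τ η)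
    (hz : ∀ a b c : ℤ, 2 * z ≠ a + b * τ + c * (2 * η)) {κ κ' : Bool × ℕ × ℕ} {a : ℤ}
    (h : poleShift τ η z κ = poleShift τ η z κ' + a) : κ = κ' := by
  obtain ⟨b, i, j⟩ := κ
  obtain ⟨b', i', j'⟩ := κ'
  have hlat (hij : (i : ℂ) * τ + j * (2 * η) = i' * τ + j' * (2 * η) + a) : i = i' ∧ j = j' := by
    obtain ⟨-, hi, hj⟩ := hinc (-a) (i - i') (j - j') (by push_cast; linear_combination hij)
    omega
  cases b <;> cases b' <;>
    simp only [poleShift, latPoint, if_true, Bool.false_eq_true, if_false] at h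
  · obtain ⟨rfl, rfl⟩ := hlat (by linear_combination h)
    rfl
  · exact absurd (by push_cast; linear_combination -h) (hz (-a) (i - i') (j - j'))
  · exact absurd (by push_cast; linear_combination h) (hz a (i' - i) (j' - j))
  · obtain ⟨rfl, rfl⟩ := hlat (by linear_combination h)
    rfl

theorem eq_polePartner_of_poleShift_add (hinc : Incommensurable τ η)
    (hz : ∀ a b c : ℤ, 2 * z ≠ a + b * τ + c * (2 * η)) {κ κ' : Bool × ℕ × ℕ} {a : ℤ}
    (h : poleShift τ η z κ + poleShift τ η z κ' = latPoint τ η (m, n) + a) :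
    κ'.2 ∈ pinchBox n m ∧ κ = polePartner n m κ' := by
  obtain ⟨b, i, j⟩ := κ
  obtain ⟨b', i', j'⟩ := κ'
  have hlat (hij : (i : ℂ) * τ + j * (2 * η) + (i' * τ + j' * (2 * η)) =
      m * τ + n * (2 * η) + a) : (i' ≤ m ∧ j' ≤ n) ∧ i = m - i' ∧ j = n - j' := by
    obtain ⟨-, hi, hj⟩ := hinc (-a) (i + i' - m) (j + j' - n)
      (by push_cast; linear_combination hij)
    omega
  simp only [mem_pinchBox, polePartner, boxReflect, Prod.mk.injEq]
  cases b <;> cases b' <;>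
    simp only [poleShift, latPoint, if_true, Bool.false_eq_true, if_false] at h
  · exact absurd (by push_cast; linear_combination -h) (hz (-a) (i + i' - m) (j + j' - n))
  · exact (hlat (by linear_combination h)).imp_right (And.intro rfl)
  · exact (hlat (by linear_combination h)).imp_right (And.intro rfl)
  · exact absurd (by push_cast; linear_combination h) (hz a (m - i - i') (n - j - j'))

theorem poleVar_mul_exp (κ : Bool × ℕ × ℕ) (s x : ℂ) :
    poleVar τ η z κ s * e(x) = e((if κ.1 then z else -z) + x - s + latPoint τ η κ.2) := by
  rw [poleVar, poleShift, ← exp_two_pi_I_add]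
  ring_nf

theorem poleVar_div_exp (κ : Bool × ℕ × ℕ) (s x : ℂ) :
    poleVar τ η z κ s / e(x) = e((if κ.1 then z else -z) - x - s + latPoint τ η κ.2) := by
  rw [poleVar, poleShift, ← exp_two_pi_I_sub]
  ring_nf

theorem poleVar_mul_poleVar (κ κ' : Bool × ℕ × ℕ) (s : ℂ) :
    poleVar τ η z κ s * poleVar τ η z κ' s =
      e(poleShift τ η z κ + poleShift τ η z κ' - 2 * s) := by
  rw [poleVar, poleVar, ← exp_two_pi_I_add]
  ring_nf

theorem differentiable_poleVar (κ : Bool × ℕ × ℕ) : Differentiable ℂ (poleVar τ η z κ) := by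
  unfold poleVar
  fun_prop

theorem poleVar_injective (hinc : Incommensurable τ η)
    (hz : ∀ a b c : ℤ, 2 * z ≠ a + b * τ + c * (2 * η)) {κ κ' : Bool × ℕ × ℕ} {s : ℂ}
    (h : poleVar τ η z κ s = poleVar τ η z κ' s) : κ = κ' := by
  rw [poleVar, poleVar, ← div_eq_one_iff_eq (exp_ne_zero _), ← exp_two_pi_I_sub] at h
  obtain ⟨a, ha⟩ := exists_int_eq_of_exp_eq_one h
  exact poleShift_injective hinc hz (a := a) (by linear_combination ha)

theorem eq_polePartner_of_mul_eq_one (hinc : Incommensurable τ η)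
    (hz : ∀ a b c : ℤ, 2 * z ≠ a + b * τ + c * (2 * η)) {κ κ' : Bool × ℕ × ℕ}
    (h : poleVar τ η z κ (n * η + m * (τ / 2)) * poleVar τ η z κ' (n * η + m * (τ / 2)) = 1) :
    κ'.2 ∈ pinchBox n m ∧ κ = polePartner n m κ' := by
  rw [poleVar_mul_poleVar, two_mul_eq_latPoint] at h
  obtain ⟨a, ha⟩ := exists_int_eq_of_exp_eq_one h
  exact eq_polePartner_of_poleShift_add hinc hz (a := a) (by linear_combination ha)

theorem poleVar_polePartner_mul {κ : Bool × ℕ × ℕ} (hκ : κ.2 ∈ pinchBox n m) (s : ℂ) :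
    poleVar τ η z (polePartner n m κ) s * poleVar τ η z κ s =
      e(-2 * s + latPoint τ η (m, n)) := by
  rw [poleVar_mul_poleVar, poleShift_polePartner_add hκ]
  ring_nf

theorem poleVar_polePartner_mul_eq_one {κ : Bool × ℕ × ℕ} (hκ : κ.2 ∈ pinchBox n m) :
    poleVar τ η z (polePartner n m κ) (n * η + m * (τ / 2)) *
      poleVar τ η z κ (n * η + m * (τ / 2)) = 1 := by
  rw [poleVar_polePartner_mul hκ, ← two_mul_eq_latPoint, neg_mul, neg_add_cancel, mul_zero,
    exp_zero]

theorem eventually_poleVar_polePartner_mul_ne_one {κ : Bool × ℕ × ℕ} (hκ : κ.2 ∈ pinchBox n m)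
    (g : ℂ) :
    ∀ᶠ s in 𝓝[≠] g, poleVar τ η z (polePartner n m κ) s * poleVar τ η z κ s ≠ 1 := by
  have hderiv : HasDerivAt (fun s => e(-2 * s + latPoint τ η (m, n)))
      (e(-2 * g + latPoint τ η (m, n)) * (2 * π * I * (-2 * 1))) g :=
    ((((hasDerivAt_id g).const_mul (-2)).add_const _).const_mul _).cexp
  simp only [poleVar_polePartner_mul hκ]
  exact hderiv.eventually_ne
    (mul_ne_zero (exp_ne_zero _) (mul_ne_zero two_pi_I_ne_zero (by norm_num)))

theorem norm_poleVar_mul_exp_lt_one (hτ : 0 < τ.im) (hη : 0 < η.im) {Y : ℝ} {s : ℂ}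
    (hs : |z.im| + s.im < Y) (κ : Bool × ℕ × ℕ) :
    ‖poleVar τ η z κ s‖ * Real.exp (-(2 * π * Y)) < 1 := by
  rw [poleVar, norm_exp_two_pi_I_mul, ← Real.exp_add, Real.exp_lt_one_iff]
  have hsign : -|z.im| ≤ (if κ.1 then z else -z).im := by
    split_ifs
    · exact neg_abs_le _
    · exact neg_le_neg (le_abs_self _)
  have him : 0 < (poleShift τ η z κ - s).im + Y := by
    rw [poleShift, sub_im, add_im]
    linarith [latPoint_im_nonneg hτ hη κ.2]
  nlinarith [mul_pos Real.pi_pos him]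

theorem abs_im_pole_le (hτ : 0 < τ.im) (hη : 0 < η.im) {j : ℕ × ℕ} (hj : j ∈ pinchBox n m) :
    |(n * η + m * (τ / 2) - z - latPoint τ η j).im| ≤ (n * η + m * (τ / 2)).im + |z.im| := by
  have hj₀ := latPoint_im_nonneg hτ hη j
  have hrefl := latPoint_im_nonneg hτ hη (boxReflect n m j)
  rw [latPoint_boxReflect hj, ← two_mul_eq_latPoint, sub_im, two_mul, add_im] at hrefl
  rw [sub_im, sub_im, abs_le]
  constructor <;> linarith [neg_abs_le z.im, le_abs_self z.im]

theorem exists_finset_lt_latPoint_im (hτ : 0 < τ.im) (hη : 0 < η.im) (B : Finset (ℕ × ℕ))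
    (M : ℝ) : ∃ J, B ⊆ J ∧ ∀ j ∉ J, M < (latPoint τ η j).im := by
  have him (j : ℕ × ℕ) : (latPoint τ η j).im = j.1 * τ.im + j.2 * (2 * η.im) := by
    simp [latPoint]
  obtain ⟨a, ha⟩ := exists_lt_nsmul hτ M
  obtain ⟨b, hb⟩ := exists_lt_nsmul (mul_pos two_pos hη) M
  rw [nsmul_eq_mul] at ha hb
  refine ⟨B ∪ Finset.range a ×ˢ Finset.range b, Finset.subset_union_left, fun j hj => ?_⟩
  simp only [Finset.mem_union, Finset.mem_product, Finset.mem_range, not_or, not_and_or,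
    not_lt] at hj
  rw [him]
  have h₁ : (0 : ℝ) ≤ j.1 * τ.im := by positivity
  have h₂ : (0 : ℝ) ≤ j.2 * (2 * η.im) := by positivity
  rcases hj.2 with h | h
  · have : (a : ℝ) * τ.im ≤ j.1 * τ.im := by gcongr
    linarith
  · have : (b : ℝ) * (2 * η.im) ≤ j.2 * (2 * η.im) := by gcongr
    linarith

theorem kernelQ_add_one (hτ : 0 < τ.im) (hη : 0 < η.im) (hΦ : ∀ x, Φ (x + 1) = Φ x) (s x : ℂ) :
    kernelQ τ η z J Φ (s, x + 1) = kernelQ τ η z J Φ (s, x) := by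
  have hsub : ∀ y, gammaTail τ η J (y - 1) = gammaTail τ η J y := fun y => by
    rw [← gammaTail_add_one J (y - 1), sub_add_cancel]
  simp only [kernelQ]
  rw [hΦ, mul_add_one, ← one_add_one_eq_two, ← add_assoc, thetaFactor_add_one hτ hη,
    thetaFactor_add_one hτ hη, ← add_assoc, ← add_assoc, add_sub_right_comm _ 1,
    add_sub_right_comm _ 1, ← sub_sub, ← sub_sub, sub_right_comm _ 1, sub_right_comm _ 1,
    gammaTail_add_one, gammaTail_add_one, hsub, hsub]

theorem kernelQ_neg (hΦ : ∀ x, Φ (-x) = Φ x) (s x : ℂ) :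
    kernelQ τ η z J Φ (s, -x) = kernelQ τ η z J Φ (s, x) := by
  simp only [kernelQ]
  rw [hΦ, mul_neg, thetaFactor_neg, sub_neg_eq_add, sub_neg_eq_add, ← sub_eq_add_neg,
    ← sub_eq_add_neg]
  ring

theorem analyticAt_kernelQ (hτ : 0 < τ.im) (hη : 0 < η.im) (hΦ : Differentiable ℂ Φ) {s x : ℂ}
    (hJ : ∀ j ∉ J, |z.im| + |x.im| + s.im < (latPoint τ η j).im) :
    AnalyticAt ℂ (kernelQ τ η z J Φ) (s, x) := by
  have hs : AnalyticAt ℂ (fun y : ℂ × ℂ => y.1) (s, x) := analyticAt_fst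
  have hx : AnalyticAt ℂ (fun y : ℂ × ℂ => y.2) (s, x) := analyticAt_snd
  have htheta : AnalyticAt ℂ (fun y : ℂ × ℂ => thetaFactor τ η (2 * y.2)) (s, x) :=
    ((differentiable_thetaFactor hτ hη).analyticAt (2 * x)).fun_comp
      (f := fun y : ℂ × ℂ => 2 * y.2) (analyticAt_const.mul hx)
  have hΦx : AnalyticAt ℂ (fun y : ℂ × ℂ => Φ y.2) (s, x) := (hΦ.analyticAt x).fun_comp hx
  have hgamma : ∀ f : ℂ × ℂ → ℂ, AnalyticAt ℂ f (s, x) →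
      -(|z.im| + |x.im| + s.im) ≤ (f (s, x)).im →
      AnalyticAt ℂ (fun y => gammaTail τ η J (f y)) (s, x) := fun f hf him =>
    (analyticAt_gammaTail hτ hη (latProd_exp_ne_zero hτ hη fun j hj => by
      rw [add_im]; linarith [hJ j hj])).fun_comp hf
  have hz₁ := neg_abs_le z.im
  have hz₂ := le_abs_self z.im
  have hx₁ := neg_abs_le x.im
  have hx₂ := le_abs_self x.im
  refine (htheta.mul (((AnalyticAt.mul ?_ ?_).mul ?_).mul ?_)).mul hΦx
  · exact hgamma _ ((analyticAt_const.add hx).sub hs) (by simp only [add_im, sub_im]; linarith)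
  · exact hgamma _ ((analyticAt_const.sub hx).sub hs) (by simp only [sub_im]; linarith)
  · exact hgamma _ ((analyticAt_const.add hx).sub hs)
      (by simp only [add_im, sub_im, neg_im]; linarith)
  · exact hgamma _ ((analyticAt_const.sub hx).sub hs) (by simp only [sub_im, neg_im]; linarith)

theorem prefactor_empty_eq (hτ : 0 < τ.im) (hη : 0 < η.im) {κ : Bool × ℕ × ℕ}
    (hκ : κ.2 ∈ pinchBox n m) (s : ℂ) :
    prefactor τ η ∅ s = prefactor τ η {(m, n)} s *
      (1 - poleVar τ η z (polePartner n m κ) s * poleVar τ η z κ s) := by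
  rw [poleVar_polePartner_mul hκ, prefactor, prefactor,
    gammaTail_eq_mul_of_subset hτ hη (Finset.empty_subset {(m, n)}), Finset.sdiff_empty,
    Finset.prod_singleton, mul_inv, inv_inv]
  ring

theorem analyticAt_prefactor (hτ : 0 < τ.im) (hη : 0 < η.im) (J : Finset (ℕ × ℕ)) {s : ℂ}
    (hs : (-2 * s).im < (τ + 2 * η).im) : AnalyticAt ℂ (prefactor τ η J) s :=
  analyticAt_const.mul ((analyticAt_inv_gammaTail hτ hη J hs).comp
    (f := fun s => -2 * s) (analyticAt_const.mul analyticAt_id))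

theorem meromorphicAt_prefactor (hτ : 0 < τ.im) (hη : 0 < η.im) (J : Finset (ℕ × ℕ)) (s : ℂ) :
    MeromorphicAt (prefactor τ η J) s :=
  (MeromorphicAt.const _ s).mul (((meromorphicAt_gammaTail hτ hη J (-2 * s)).comp_analyticAt
    (f := gammaTail τ η J) (g := fun s => -2 * s) (analyticAt_const.mul analyticAt_id)).inv)

theorem ellGamma_eq_gammaTail_mul (hτ : 0 < τ.im) (hη : 0 < η.im) (J : Finset (ℕ × ℕ)) (y : ℂ) :
    ellGamma τ η y = gammaTail τ η J y * (∏ j ∈ J, (1 - e(y + latPoint τ η j)))⁻¹ := by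
  rw [ellGamma_eq_gammaTail hτ hη, gammaTail_eq_mul_of_subset hτ hη (Finset.empty_subset J),
    Finset.sdiff_empty]

theorem intertwinerIntegral_eq (hτ : 0 < τ.im) (hη : 0 < η.im) (J : Finset (ℕ × ℕ)) (s : ℂ) :
    intertwinerIntegral τ η s Φ z = prefactor τ η ∅ s *
      ∫ x in (0 : ℝ)..1, kernelQ τ η z J Φ (s, x) /
        ∏ κ ∈ (Finset.univ : Finset Bool) ×ˢ J, pairFactor (poleVar τ η z κ s) e(x) := by
  rw [intertwinerIntegral, prefactor, ← ellGamma_eq_gammaTail hτ hη, mul_assoc _ (_)⁻¹,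
    ← intervalIntegral.integral_const_mul (ellGamma τ η (-2 * s))⁻¹]
  congr 1
  refine intervalIntegral.integral_congr fun x _ => ?_
  have hreal : (2 * (x : ℂ)).im = 0 := by simp
  have htheta := inv_ellGamma_mul_ellGamma_neg hτ hη (y := 2 * x)
    (latProd_empty_exp_ne_zero hτ hη (by simp only [add_im, hreal]; simp; linarith))
    (latProd_empty_exp_ne_zero hτ hη (by simp only [add_im, sub_im, hreal]; simp; linarith))
  simp only [kernelQ, pairFactor, ← htheta, poleVar_mul_exp, poleVar_div_exp,
    Finset.prod_product, Fintype.prod_bool, Finset.prod_mul_distrib, if_true, Bool.false_eq_true,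
    if_false, ellGamma_eq_gammaTail_mul hτ hη J (_ - s), neg_mul]
  simp only [mul_inv, div_eq_mul_inv]
  ring

end

/-! ### The value of the continuation -/

/-- The limit of `(1 - e(y)) Γ(y - Λⱼ)` as `y` tends to `0`. -/
def gammaResidue (τ η : ℂ) (j : ℕ × ℕ) : ℂ := gammaTail τ η {j} (-latPoint τ η j)

/-- The coefficient of `Φ(nη + mτ/2 - z - Λⱼ)` in the value of `M(g)Φ` at `g = nη + mτ/2`: the
contribution of the poles with labels `(+, j)` and `polePartner n m (+, j)`. -/
def pinchCoeff (τ η : ℂ) (n m : ℕ) (j : ℕ × ℕ) (z : ℂ) : ℂ :=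
  qPoch (2 * η) * qPoch τ *
    (gammaResidue τ η j * gammaResidue τ η (boxReflect n m j) / gammaResidue τ η (m, n)) *
    thetaFactor τ η (2 * (n * η + m * (τ / 2) - z - latPoint τ η j)) *
    (ellGamma τ η (2 * z - latPoint τ η (boxReflect n m j)) *
      ellGamma τ η (-(2 * z) - latPoint τ η j))

/-- The integral of `M(s)Φ` at `z`, written as a sum of contributions of its poles with labels in
`Bool × J`. Each term is meromorphic in `s` for `|Im z| + Im s < Y`, so this is the continuation of
`M(s)Φ` to that half-plane once `J` contains all labels with `Im Λⱼ ≤ 2Y`. -/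
def continuedIntegral (τ η z : ℂ) (J : Finset (ℕ × ℕ)) (Y : ℝ) (Φ : ℂ → ℂ) (s : ℂ) : ℂ :=
  prefactor τ η ∅ s * ∑ κ ∈ (Finset.univ : Finset Bool) ×ˢ J,
    poleTerm (kernelQ τ η z J Φ) Y (((Finset.univ : Finset Bool) ×ˢ J).erase κ)
      (poleVar τ η z) κ s

theorem mul_prod_pairFactor_of_mul_eq_one {ι : Type*} [DecidableEq ι] {K : Finset ι} {t : ι → ℂ}
    {k l : ι} (hk : k ∈ K) (hl : l ∈ K) (hlk : l ≠ k) (hone : t l * t k = 1) :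
    (1 - (t k)⁻¹ ^ 2) * (1 - t k ^ 2) * ∏ i ∈ (K.erase k).erase l, pairFactor (t i) (t k) =
      (∏ i ∈ K.erase l, (1 - t i * t k)) * ∏ i ∈ K.erase k, (1 - t i / t k) := by
  have hratio : (t k)⁻¹ ^ 2 = t l / t k := by
    rw [eq_inv_of_mul_eq_one_left hone]
    ring
  simp only [pairFactor]
  rw [Finset.prod_mul_distrib, hratio,
    ← Finset.mul_prod_erase (K.erase k) _ (Finset.mem_erase.mpr ⟨hlk, hl⟩),
    ← Finset.mul_prod_erase (K.erase l) _ (Finset.mem_erase.mpr ⟨hlk.symm, hk⟩),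
    Finset.erase_right_comm]
  ring

theorem prod_erase_univ_product {ι : Type*} [DecidableEq ι] (J : Finset ι) (b : Bool) (j : ι)
    (f : Bool × ι → ℂ) :
    ∏ i ∈ ((Finset.univ : Finset Bool) ×ˢ J).erase (b, j), f i =
      (∏ i ∈ J.erase j, f (b, i)) * ∏ i ∈ J, f (!b, i) := by
  have hunion : ((Finset.univ : Finset Bool) ×ˢ J).erase (b, j) =
      ({b} ×ˢ J.erase j) ∪ ({!b} ×ˢ J) := by
    ext ⟨d, i⟩
    cases d <;> cases b <;> simp
  have hdisj : Disjoint (({b} : Finset Bool) ×ˢ J.erase j) ({!b} ×ˢ J) :=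
    Finset.disjoint_product.mpr (Or.inl (by cases b <;> simp))
  rw [hunion, Finset.prod_union hdisj, Finset.prod_product, Finset.prod_product,
    Finset.prod_singleton, Finset.prod_singleton]

theorem sum_univ_product_pinchBox (n m : ℕ) (f : Bool × ℕ × ℕ → ℂ) :
    ∑ κ ∈ (Finset.univ : Finset Bool) ×ˢ pinchBox n m, f κ =
      ∑ j ∈ pinchBox n m, (f (true, j) + f (polePartner n m (true, j))) := by
  rw [Finset.sum_product, Fintype.sum_bool, Finset.sum_add_distrib]
  congr 1
  refine Finset.sum_nbij' (boxReflect n m) (boxReflect n m) (fun j _ => boxReflect_mem n m j)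
    (fun j _ => boxReflect_mem n m j) (fun j hj => boxReflect_boxReflect hj)
    (fun j hj => boxReflect_boxReflect hj) fun j hj => ?_
  rw [polePartner, boxReflect_boxReflect hj, Bool.not_true]

section

variable {τ η z : ℂ} {J : Finset (ℕ × ℕ)} {Φ : ℂ → ℂ} {n m : ℕ} {Y : ℝ}

theorem gammaTail_mul_inv_prod_eq_gammaResidue (hτ : 0 < τ.im) (hη : 0 < η.im) {j : ℕ × ℕ}
    (hj : j ∈ J) :
    gammaTail τ η J (-latPoint τ η j) *
      (∏ i ∈ J.erase j, (1 - e(-latPoint τ η j + latPoint τ η i)))⁻¹ = gammaResidue τ η j := by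
  rw [gammaResidue, gammaTail_eq_mul_of_subset hτ hη (Finset.singleton_subset_iff.mpr hj),
    Finset.sdiff_singleton_eq_erase]

theorem prefactor_singleton (τ η : ℂ) (n m : ℕ) :
    prefactor τ η {(m, n)} (n * η + m * (τ / 2)) =
      qPoch (2 * η) * qPoch τ / 2 * (gammaResidue τ η (m, n))⁻¹ := by
  rw [prefactor, neg_mul, two_mul_eq_latPoint, gammaResidue]

theorem kernelQ_div_eq_gammaResidue (hτ : 0 < τ.im) (hη : 0 < η.im) {j : ℕ × ℕ}
    (hj : j ∈ pinchBox n m) (hJ : pinchBox n m ⊆ J) {g x₀ : ℂ}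
    (hg : g = n * η + m * (τ / 2)) (hx₀ : x₀ = g - z - latPoint τ η j) :
    kernelQ τ η z J Φ (g, x₀) /
        ((1 - (e(-x₀))⁻¹ ^ 2) * (1 - e(-x₀) ^ 2) *
          ∏ i ∈ (((Finset.univ : Finset Bool) ×ˢ J).erase (true, j)).erase
            (polePartner n m (true, j)), pairFactor (poleVar τ η z i g) e(-x₀)) =
      thetaFactor τ η (2 * x₀) * (gammaResidue τ η j * gammaResidue τ η (boxReflect n m j) *
        (ellGamma τ η (2 * z - latPoint τ η (boxReflect n m j)) *
          ellGamma τ η (-(2 * z) - latPoint τ η j))) * Φ x₀ := by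
  have hrefl := latPoint_boxReflect (τ := τ) (η := η) hj
  rw [← two_mul_eq_latPoint τ η n m, ← hg] at hrefl
  have hpole : poleVar τ η z (true, j) g = e(-x₀) := by
    rw [poleVar, poleShift, if_pos rfl, hx₀]
    ring_nf
  have hone : poleVar τ η z (polePartner n m (true, j)) g * poleVar τ η z (true, j) g = 1 :=
    hg ▸ poleVar_polePartner_mul_eq_one hj
  have hden := mul_prod_pairFactor_of_mul_eq_one (K := Finset.univ ×ˢ J)
    (t := fun i => poleVar τ η z i g)
    (Finset.mem_product.mpr ⟨Finset.mem_univ _, hJ hj⟩)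
    (Finset.mem_product.mpr ⟨Finset.mem_univ _, hJ (boxReflect_mem n m j)⟩)
    (polePartner_ne n m (true, j)) hone
  simp only [hpole, poleVar_mul_exp, poleVar_div_exp, sub_neg_eq_add, ← sub_eq_add_neg] at hden
  rw [hden, polePartner, prod_erase_univ_product, prod_erase_univ_product, kernelQ]
  simp only [Bool.not_true, Bool.not_false, if_true, Bool.false_eq_true, if_false]
  rw [← gammaTail_mul_inv_prod_eq_gammaResidue hτ hη (hJ hj),
    ← gammaTail_mul_inv_prod_eq_gammaResidue hτ hη (hJ (boxReflect_mem n m j)),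
    ellGamma_eq_gammaTail_mul hτ hη J, ellGamma_eq_gammaTail_mul hτ hη J,
    show -latPoint τ η j = z + x₀ - g by rw [hx₀]; ring,
    show -latPoint τ η (boxReflect n m j) = -z - x₀ - g by rw [hrefl, hx₀]; ring,
    show 2 * z - latPoint τ η (boxReflect n m j) = z - x₀ - g by rw [hrefl, hx₀]; ring,
    show -(2 * z) - latPoint τ η j = -z + x₀ - g by rw [hx₀]; ring]
  simp only [mul_inv, div_eq_mul_inv]
  ring

theorem analyticAt_kernelQ_of_le (hτ : 0 < τ.im) (hη : 0 < η.im) (hΦ : Differentiable ℂ Φ)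
    (hJ : ∀ j ∉ J, 2 * Y < (latPoint τ η j).im) {s x : ℂ} (hs : |z.im| + s.im < Y)
    (hx : |x.im| ≤ Y) : AnalyticAt ℂ (kernelQ τ η z J Φ) (s, x) :=
  analyticAt_kernelQ hτ hη hΦ fun j hj => by linarith [hJ j hj]

theorem isOpen_continuationDomain (z : ℂ) (Y : ℝ) : IsOpen {s : ℂ | |z.im| + s.im < Y} :=
  isOpen_lt (continuous_const.add continuous_im) continuous_const

theorem meromorphicOn_continuedIntegral (hτ : 0 < τ.im) (hη : 0 < η.im) (hΦ : Differentiable ℂ Φ)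
    (hY : 0 ≤ Y) (hJ : ∀ j ∉ J, 2 * Y < (latPoint τ η j).im) :
    MeromorphicOn (continuedIntegral τ η z J Y Φ) {s | |z.im| + s.im < Y} := fun s hs =>
  (meromorphicAt_prefactor hτ hη ∅ s).mul (MeromorphicAt.fun_sum fun κ _ =>
    meromorphicOn_poleTerm (isOpen_continuationDomain z Y)
      (fun s hs x hx => analyticAt_kernelQ_of_le hτ hη hΦ hJ hs (by rw [hx, abs_of_nonneg hY]))
      (fun i _ => differentiable_poleVar i) (differentiable_poleVar κ) (fun _ => exp_ne_zero _)
      (fun s hs => norm_poleVar_mul_exp_lt_one hτ hη hs κ) s hs)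

theorem continuedIntegral_eq_intertwinerIntegral (hτ : 0 < τ.im) (hη : 0 < η.im)
    (hinc : Incommensurable τ η) (hΦ : Differentiable ℂ Φ) (hper : ∀ x, Φ (x + 1) = Φ x)
    (heven : ∀ x, Φ (-x) = Φ x) (hz : ∀ a b c : ℤ, 2 * z ≠ a + b * τ + c * (2 * η)) (hY : 0 ≤ Y)
    (hJ₀ : J.Nonempty) (hJ : ∀ j ∉ J, 2 * Y < (latPoint τ η j).im) {s : ℂ}
    (hs : |z.im| + s.im < 0) :
    continuedIntegral τ η z J Y Φ s = intertwinerIntegral τ η s Φ z := by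
  rw [intertwinerIntegral_eq hτ hη J, continuedIntegral,
    sum_poleTerm_eq_integral (Q := kernelQ τ η z J Φ) (t := poleVar τ η z) (s := s) hY
    (Finset.univ_nonempty.product hJ₀)
    (fun x hx => (analyticAt_kernelQ_of_le hτ hη hΦ hJ (hs.trans_le hY) hx).fun_comp
      (f := fun x => (s, x)) (analyticAt_const.prod analyticAt_id))
    (kernelQ_add_one hτ hη hper s) (kernelQ_neg heven s) (fun i _ => exp_ne_zero _)
    (fun i _ => by simpa using norm_poleVar_mul_exp_lt_one hτ hη hs i)
    (fun i _ j _ hij h => hij (poleVar_injective hinc hz h))]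

theorem sum_pinched_poleTerm_eq (hτ : 0 < τ.im) (hη : 0 < η.im) (hΦ : Differentiable ℂ Φ)
    (hper : ∀ x, Φ (x + 1) = Φ x) (heven : ∀ x, Φ (-x) = Φ x) {g : ℂ}
    (hg : g = n * η + m * (τ / 2)) (hgY : |z.im| + g.im < Y) (hbox : pinchBox n m ⊆ J)
    (hJ : ∀ j ∉ J, 2 * Y < (latPoint τ η j).im) :
    prefactor τ η {(m, n)} g * ∑ κ ∈ (Finset.univ : Finset Bool) ×ˢ pinchBox n m,
        poleTerm (kernelQ τ η z J Φ) Y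
          ((((Finset.univ : Finset Bool) ×ˢ J).erase κ).erase (polePartner n m κ))
          (poleVar τ η z) κ g / (1 - (poleVar τ η z κ g)⁻¹ ^ 2) =
      ∑ j ∈ pinchBox n m, pinchCoeff τ η n m j z * Φ (g - z - latPoint τ η j) := by
  rw [sum_univ_product_pinchBox, Finset.mul_sum]
  refine Finset.sum_congr rfl fun j hj => ?_
  have hone : poleVar τ η z (polePartner n m (true, j)) g * poleVar τ η z (true, j) g = 1 :=
    hg ▸ poleVar_polePartner_mul_eq_one hj
  have hpole : poleVar τ η z (true, j) g = e(-(g - z - latPoint τ η j)) := by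
    rw [poleVar, poleShift, if_pos rfl]
    ring_nf
  rw [polePartner_polePartner hj, Finset.erase_right_comm (a := polePartner n m (true, j)),
    poleTerm_add_poleTerm_partner
      (fun x hx => (analyticAt_kernelQ_of_le hτ hη hΦ hJ hgY hx).fun_comp
        (f := fun x => (g, x)) (analyticAt_const.prod analyticAt_id))
      (kernelQ_add_one hτ hη hper g) (kernelQ_neg heven g) hone (x₀ := g - z - latPoint τ η j)
      (by rw [hg] at hgY ⊢; linarith [abs_im_pole_le (z := z) hτ hη hj])
      (by rw [hpole, ← exp_two_pi_I_add, neg_add_cancel, mul_zero, exp_zero]),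
    hpole, mul_div_assoc, kernelQ_div_eq_gammaResidue hτ hη hj hbox hg rfl, pinchCoeff, ← hg]
  rw [show prefactor τ η {(m, n)} g = _ from hg ▸ prefactor_singleton τ η n m]
  ring

theorem tendsto_continuedIntegral (hτ : 0 < τ.im) (hη : 0 < η.im) (hinc : Incommensurable τ η)
    (hΦ : Differentiable ℂ Φ) (hper : ∀ x, Φ (x + 1) = Φ x) (heven : ∀ x, Φ (-x) = Φ x)
    (hz : ∀ a b c : ℤ, 2 * z ≠ a + b * τ + c * (2 * η)) (hY : 0 ≤ Y)
    (hgY : |z.im| + (n * η + m * (τ / 2)).im < Y) (hbox : pinchBox n m ⊆ J)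
    (hJ : ∀ j ∉ J, 2 * Y < (latPoint τ η j).im) :
    Tendsto (continuedIntegral τ η z J Y Φ) (𝓝[≠] (n * η + m * (τ / 2)))
      (𝓝 (∑ j ∈ pinchBox n m, pinchCoeff τ η n m j z *
        Φ (n * η + m * (τ / 2) - z - latPoint τ η j))) := by
  have hpref (L : Finset (ℕ × ℕ)) : ContinuousAt (prefactor τ η L) (n * η + m * (τ / 2)) := by
    refine (analyticAt_prefactor hτ hη L ?_).continuousAt
    rw [neg_mul, two_mul_eq_latPoint, neg_im, add_im, two_mul, add_im]
    linarith [latPoint_im_nonneg hτ hη (m, n)]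
  have hmem {κ : Bool × ℕ × ℕ} :
      κ ∈ (Finset.univ : Finset Bool) ×ˢ pinchBox n m ↔ κ.2 ∈ pinchBox n m := by simp
  have hzero : prefactor τ η ∅ (n * η + m * (τ / 2)) = 0 := by
    rw [prefactor_empty_eq (z := z) (κ := (true, boxReflect n m (0, 0))) hτ hη
      (boxReflect_mem n m _), poleVar_polePartner_mul_eq_one (boxReflect_mem n m _), sub_self,
      mul_zero]
  rw [← sum_pinched_poleTerm_eq hτ hη hΦ hper heven rfl hgY hbox hJ]
  exact tendsto_mul_sum_poleTerm (isOpen_continuationDomain z Y) hgY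
    (fun s hs x hx => analyticAt_kernelQ_of_le hτ hη hΦ hJ hs (by rw [hx, abs_of_nonneg hY]))
    (fun i _ => differentiable_poleVar i) (fun i _ _ => exp_ne_zero _)
    (fun i _ s hs => norm_poleVar_mul_exp_lt_one hτ hη hs i) (hpref ∅) hzero (hpref {(m, n)})
    (Finset.product_subset_product_right hbox)
    (fun κ _ => Finset.mem_erase.mpr ⟨polePartner_ne n m κ,
      Finset.mem_product.mpr ⟨Finset.mem_univ _, hbox (boxReflect_mem n m κ.2)⟩⟩)
    (fun κ hκ s => prefactor_empty_eq hτ hη (hmem.mp hκ) s)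
    (fun κ hκ => eventually_poleVar_polePartner_mul_ne_one (hmem.mp hκ) _)
    (fun κ hκ => poleVar_polePartner_mul_eq_one (hmem.mp hκ))
    (fun i _ j _ hij h => hij (poleVar_injective hinc hz h))
    (fun i _ j _ h => (eq_polePartner_of_mul_eq_one hinc hz h).imp_left hmem.mpr)

theorem intertwinerValue_sum_pinchCoeff (hτ : 0 < τ.im) (hη : 0 < η.im)
    (hinc : Incommensurable τ η) (hΦ : Differentiable ℂ Φ) (hper : ∀ x, Φ (x + 1) = Φ x)
    (heven : ∀ x, Φ (-x) = Φ x) (hz : ∀ a b c : ℤ, 2 * z ≠ a + b * τ + c * (2 * η)) (n m : ℕ) :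
    IntertwinerValue τ η (n * η + m * (τ / 2)) Φ z
      (∑ j ∈ pinchBox n m, pinchCoeff τ η n m j z *
        Φ (n * η + m * (τ / 2) - z - latPoint τ η j)) := by
  have hg0 : 0 ≤ 2 * (n * η + m * (τ / 2)).im := by
    have him := latPoint_im_nonneg hτ hη (m, n)
    rwa [← two_mul_eq_latPoint, two_mul, add_im, ← two_mul] at him
  let Y := |z.im| + (n * η + m * (τ / 2)).im + 1
  have hY : 0 ≤ Y := by linarith [abs_nonneg z.im]
  have hdom : {s : ℂ | s.im < (n * η + m * (τ / 2)).im + 1} = {s | |z.im| + s.im < Y} := by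
    ext s
    simp only [Y, Set.mem_ofPred_eq, add_assoc, add_lt_add_iff_left]
  obtain ⟨J, hbox, hJ⟩ := exists_finset_lt_latPoint_im hτ hη (pinchBox n m) (2 * Y)
  have hlim := tendsto_continuedIntegral hτ hη hinc hΦ hper heven hz hY (by linarith) hbox hJ
  have hmero := meromorphicOn_continuedIntegral (z := z) hτ hη hΦ hY hJ
  rw [← hdom] at hmero
  have hgmem : n * η + m * (τ / 2) ∈ {s : ℂ | s.im < (n * η + m * (τ / 2)).im + 1} :=
    lt_add_one (n * η + m * (τ / 2)).im
  refine ⟨_, Function.update (continuedIntegral τ η z J Y Φ) (n * η + m * (τ / 2)) _, hgmem,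
    fun s hs => (hmero s hs).update _ _, fun s hs hsz hsz' _ => ?_,
    ((hmero _ hgmem).update _ _).analyticAt (continuousAt_update_same.mpr hlim),
    Function.update_self _ _ _⟩
  have hs0 : |z.im| + s.im < 0 := by
    simp only [add_im, sub_im, neg_im] at hsz hsz'
    rw [← lt_neg_iff_add_neg, abs_lt]
    constructor <;> linarith
  have hsg : s ≠ n * η + m * (τ / 2) := by
    rintro rfl
    linarith [abs_nonneg z.im]
  rw [Function.update_of_ne hsg]
  exact continuedIntegral_eq_intertwinerIntegral hτ hη hinc hΦ hper heven hz hY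
    ⟨_, hbox (boxReflect_mem n m (0, 0))⟩ hJ hs0

end

/-! ### Residues of the elliptic gamma function -/

/-- The theta function `modTheta e(τ) e(y)` as a function of `y`: the multiplier by which `Γ`
changes under a shift of its argument. -/
def expTheta (τ y : ℂ) : ℂ := exp (π * I * y) * (constR τ * theta1 y τ)

/-- The quotient `Γ(y) / Γ(y - Λⱼ)`, as a product of theta functions. -/
def gammaShift (τ η : ℂ) (j : ℕ × ℕ) (y : ℂ) : ℂ :=
  (∏ i ∈ Finset.range j.2, expTheta τ (y - 2 * η * (i + 1))) *
    ∏ i ∈ Finset.range j.1, expTheta (2 * η) (y - j.2 * (2 * η) - τ * (i + 1))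

theorem eq_of_eventually_exp_ne_one_imp {f g : ℂ → ℂ} (hf : ContinuousAt f 0)
    (hg : ContinuousAt g 0) (h : ∀ᶠ y in 𝓝 0, e(y) ≠ 1 → f y = g y) : f 0 = g 0 := by
  have hderiv : HasDerivAt (fun y => e(y)) (e(0) * (2 * π * I)) 0 :=
    (hasDerivAt_const_mul (2 * π * I)).cexp
  have hne : ∀ᶠ y in 𝓝[≠] (0 : ℂ), e(y) ≠ 1 :=
    hderiv.eventually_ne (mul_ne_zero (exp_ne_zero _) two_pi_I_ne_zero)
  refine ((hf.eventuallyEq_nhds_iff_eventuallyEq_nhdsNE hg).mp ?_).eq_of_nhds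
  filter_upwards [hne, h.filter_mono nhdsWithin_le_nhds] with y hy himp using himp hy

section

variable {τ η : ℂ}

theorem expTheta_eq_modTheta (hτ : 0 < τ.im) (y : ℂ) : expTheta τ y = modTheta e(τ) e(y) := by
  rw [expTheta, constR_mul_theta1 hτ, ← mul_assoc, ← exp_add, add_neg_cancel, exp_zero, one_mul]

theorem continuous_expTheta (hτ : 0 < τ.im) : Continuous (expTheta τ) := by
  rw [funext (expTheta_eq_modTheta hτ)]
  exact (differentiable_modTheta_exp hτ).continuous

theorem expTheta_ne_zero (hτ : 0 < τ.im) {y : ℂ} (hy : ∀ a b : ℤ, y ≠ a + b * τ) :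
    expTheta τ y ≠ 0 := by
  refine mul_ne_zero (exp_ne_zero _) (mul_ne_zero (constR_ne_zero hτ) fun h => ?_)
  obtain ⟨a, b, hab⟩ := exists_eq_add_mul_of_theta1_eq_zero hτ h
  exact hy a b hab

theorem ellGamma_swap (hτ : 0 < τ.im) (hη : 0 < η.im) (y : ℂ) :
    ellGamma (2 * η) (τ / 2) y = ellGamma τ η y := by
  rw [ellGamma_eq_gammaTail (by simpa using hη) (by simpa using hτ), ellGamma_eq_gammaTail hτ hη,
    gammaTail, gammaTail]
  simp only [latProd_empty, mul_div_cancel₀ τ (two_ne_zero' ℂ), pqProd_comm e(2 * η),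
    add_comm (2 * η) τ]

theorem ellGamma_sub_mul_expTheta (hτ : 0 < τ.im) (hη : 0 < η.im) {y : ℂ}
    (hy : expTheta τ (y - 2 * η) ≠ 0) :
    ellGamma τ η (y - 2 * η) * expTheta τ (y - 2 * η) = ellGamma τ η y := by
  have hp := norm_exp_two_pi_I_mul_lt_one hτ
  have hq : ‖e(2 * η)‖ < 1 := norm_exp_two_pi_I_mul_lt_one (by simpa using hη)
  have hq0 : e(2 * η) ≠ 0 := exp_ne_zero _
  rw [ellGamma_eq_gammaTail hτ hη, ellGamma_eq_gammaTail hτ hη, gammaTail, gammaTail]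
  rw [expTheta_eq_modTheta hτ, modTheta] at hy ⊢
  simp only [latProd_empty, exp_two_pi_I_add, exp_two_pi_I_sub] at hy ⊢
  generalize e(τ) = p at *
  generalize e(2 * η) = q at *
  generalize e(y) = w at *
  have hden : pqProd p q (w / q) = qProd p (w / q) * pqProd p q w := by
    rw [pqProd_eq_qProd_mul_right hp hq, mul_div_cancel₀ w hq0]
  have hnum : pqProd p q (p * q / w) = qProd p (p / (w / q)) * pqProd p q (p * q / (w / q)) := by
    rw [pqProd_eq_qProd_mul_right hp hq, div_div_eq_mul_div, div_div_eq_mul_div, mul_div_assoc',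
      mul_comm q (p * q)]
  rw [hden, hnum]
  have hA := left_ne_zero_of_mul hy
  generalize qProd p (w / q) = A at *
  generalize qProd p (p / (w / q)) = B at *
  field_simp

theorem ellGamma_sub_mul_prod_expTheta (hτ : 0 < τ.im) (hη : 0 < η.im) (y : ℂ) (n : ℕ)
    (hy : ∏ i ∈ Finset.range n, expTheta τ (y - 2 * η * (i + 1)) ≠ 0) :
    ellGamma τ η (y - n * (2 * η)) * ∏ i ∈ Finset.range n, expTheta τ (y - 2 * η * (i + 1)) =
      ellGamma τ η y := by
  induction n with
  | zero => simp
  | succ n ih =>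
    have hstep : y - 2 * η * (n + 1) = y - n * (2 * η) - 2 * η := by ring
    rw [Finset.prod_range_succ, hstep] at hy
    rw [Finset.prod_range_succ, hstep, ← ih (left_ne_zero_of_mul hy),
      ← ellGamma_sub_mul_expTheta hτ hη (right_ne_zero_of_mul hy)]
    push_cast
    ring_nf

theorem ellGamma_sub_latPoint_mul_gammaShift (hτ : 0 < τ.im) (hη : 0 < η.im) {y : ℂ} {j : ℕ × ℕ}
    (hy : gammaShift τ η j y ≠ 0) :
    ellGamma τ η (y - latPoint τ η j) * gammaShift τ η j y = ellGamma τ η y := by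
  have hstep := ellGamma_sub_mul_prod_expTheta (τ := 2 * η) (η := τ / 2) (by simpa using hη)
    (by simpa using hτ) (y - j.2 * (2 * η)) j.1
  rw [mul_div_cancel₀ τ (two_ne_zero' ℂ), ellGamma_swap hτ hη, ellGamma_swap hτ hη] at hstep
  rw [gammaShift] at hy ⊢
  rw [← ellGamma_sub_mul_prod_expTheta hτ hη y j.2 (left_ne_zero_of_mul hy),
    ← hstep (right_ne_zero_of_mul hy), latPoint, ← sub_sub, sub_right_comm y]
  ring

theorem continuous_gammaShift (hτ : 0 < τ.im) (hη : 0 < η.im) (j : ℕ × ℕ) :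
    Continuous (gammaShift τ η j) :=
  (continuous_finsetProd _ fun _ _ => (continuous_expTheta hτ).comp (by fun_prop)).mul
    (continuous_finsetProd _ fun _ _ =>
      (continuous_expTheta (τ := 2 * η) (by simpa using hη)).comp (by fun_prop))

theorem gammaShift_ne_zero (hτ : 0 < τ.im) (hη : 0 < η.im) {y : ℂ}
    (hy : ∀ a b c : ℤ, y = a + b * τ + c * (2 * η) → b = 0 ∧ c = 0) (j : ℕ × ℕ) :
    gammaShift τ η j y ≠ 0 := by
  refine mul_ne_zero (Finset.prod_ne_zero_iff.mpr fun i _ => expTheta_ne_zero hτ fun a b h => ?_)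
    (Finset.prod_ne_zero_iff.mpr fun i _ => expTheta_ne_zero (by simpa using hη) fun a b h => ?_)
  · have := hy a b (i + 1) (by push_cast; linear_combination h)
    omega
  · have := hy a (i + 1) (b + j.2) (by push_cast; linear_combination h)
    omega

theorem Incommensurable.gammaShift_zero_ne_zero (hinc : Incommensurable τ η) (hτ : 0 < τ.im)
    (hη : 0 < η.im) (j : ℕ × ℕ) : gammaShift τ η j 0 ≠ 0 :=
  gammaShift_ne_zero hτ hη (fun a b c h => (hinc a b c h.symm).2) j

theorem Incommensurable.latProd_singleton_ne_zero (hinc : Incommensurable τ η) (hτ : 0 < τ.im)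
    (hη : 0 < η.im) (j : ℕ × ℕ) : latProd τ η {j} e(-latPoint τ η j) ≠ 0 := by
  rw [Ne, latProd_exp_eq_zero_iff hτ hη]
  rintro ⟨i, hij, a, ha⟩
  rw [latPoint, latPoint] at ha
  obtain ⟨-, hfst, hsnd⟩ := hinc (-a) (i.1 - j.1) (i.2 - j.2) (by
    push_cast
    linear_combination ha)
  exact hij (Finset.mem_singleton.mpr (Prod.ext (by omega) (by omega)))

theorem gammaResidue_mul_gammaShift (hτ : 0 < τ.im) (hη : 0 < η.im) (hinc : Incommensurable τ η)
    (j : ℕ × ℕ) : gammaResidue τ η j * gammaShift τ η j 0 = gammaResidue τ η (0, 0) := by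
  have htail (i : ℕ × ℕ) : ContinuousAt (gammaTail τ η {i}) (0 - latPoint τ η i) := by
    rw [zero_sub]
    exact (analyticAt_gammaTail hτ hη (hinc.latProd_singleton_ne_zero hτ hη i)).continuousAt
  have hcont (i : ℕ × ℕ) : ContinuousAt (fun y => gammaTail τ η {i} (y - latPoint τ η i)) 0 :=
    (htail i).comp (f := fun y => y - latPoint τ η i) (continuous_sub_right _).continuousAt
  have hshift : ContinuousAt (gammaShift τ η j) 0 := (continuous_gammaShift hτ hη j).continuousAt
  have hlim := eq_of_eventually_exp_ne_one_imp ((hcont j).mul hshift) (hcont (0, 0)) ?_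
  · simpa only [gammaResidue, zero_sub, Pi.mul_apply] using hlim
  filter_upwards [hshift.eventually_ne (hinc.gammaShift_zero_ne_zero hτ hη j)] with y hy hexp
  have hzero : latPoint τ η (0, 0) = 0 := by simp [latPoint]
  have hgamma := ellGamma_sub_latPoint_mul_gammaShift hτ hη hy
  rw [ellGamma_eq_gammaTail_mul hτ hη {j}, ellGamma_eq_gammaTail_mul hτ hη {(0, 0)},
    Finset.prod_singleton, Finset.prod_singleton, sub_add_cancel, hzero, add_zero,
    mul_right_comm] at hgamma
  simpa only [Pi.mul_apply, hzero, sub_zero] using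
    mul_right_cancel₀ (inv_ne_zero (sub_ne_zero.mpr hexp.symm)) hgamma

theorem latProd_singleton_zero_one (hτ : 0 < τ.im) (hη : 0 < η.im) :
    latProd τ η {(0, 0)} 1 = qPoch τ * (qPoch (2 * η) * latProd τ η ∅ e(τ + 2 * η)) := by
  have hp := norm_exp_two_pi_I_mul_lt_one hτ
  have hq : ‖e(2 * η)‖ < 1 := norm_exp_two_pi_I_mul_lt_one (by simpa using hη)
  have hcont : Continuous fun y => qProd e(τ) (e(τ) * e(y)) * (qProd e(2 * η) (e(2 * η) * e(y)) *
      latProd τ η ∅ (e(τ) * (e(2 * η) * e(y)))) :=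
    ((differentiable_qProd hp).continuous.comp (by fun_prop)).mul
      (((differentiable_qProd hq).continuous.comp (by fun_prop)).mul
        ((differentiable_latProd hτ hη ∅).continuous.comp (by fun_prop)))
  have hlim := eq_of_eventually_exp_ne_one_imp
    (differentiable_latProd_exp hτ hη {(0, 0)}).continuous.continuousAt hcont.continuousAt ?_
  · simpa only [mul_zero, exp_zero, mul_one, qPoch_eq_qProd, exp_two_pi_I_add] using hlim
  refine Eventually.of_forall fun y hexp => mul_left_cancel₀ (sub_ne_zero.mpr hexp.symm) ?_
  have hsplit := latProd_exp_eq_prod_mul hτ hη (Finset.empty_subset {(0, 0)}) y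
  rw [Finset.sdiff_empty, Finset.prod_singleton, show latPoint τ η (0, 0) = 0 by simp [latPoint],
    add_zero] at hsplit
  rw [← hsplit, latProd_empty, latProd_empty, pqProd_eq_qProd_mul_right hp hq,
    pqProd_eq_qProd_mul_left hp hq, qProd_eq_one_sub_mul hp e(y)]
  ring

theorem gammaResidue_zero_mul (hτ : 0 < τ.im) (hη : 0 < η.im) :
    gammaResidue τ η (0, 0) * (qPoch (2 * η) * qPoch τ) = 1 := by
  have hprod : latProd τ η ∅ e(τ + 2 * η) ≠ 0 := by
    refine latProd_empty_exp_ne_zero hτ hη ?_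
    have hη' : 0 < (2 * η).im := by simpa using hη
    rw [add_im]
    positivity
  have hqτ := qPoch_ne_zero hτ
  have hqη : qPoch (2 * η) ≠ 0 := qPoch_ne_zero (by simpa using hη)
  rw [gammaResidue, gammaTail, show latPoint τ η (0, 0) = 0 by simp [latPoint], neg_zero, sub_zero,
    mul_zero, exp_zero, latProd_singleton_zero_one hτ hη]
  field_simp

end

/-! ### Comparison with the normal ordered operator -/

/-- The product `θ₁(y - h) θ₁(y - 2h) ⋯ θ₁(y - nh)`. -/
def thetaProd (τ h : ℂ) (n : ℕ) (y : ℂ) : ℂ := ∏ i ∈ Finset.range n, theta1 (y - h * (i + 1)) τ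

/-- The quotient of theta functions in `α_k^{(b+k)}(z)`, with step `h = 2η` and `y = 2z`. -/
def thetaRatio (τ h : ℂ) (b k : ℕ) (y : ℂ) : ℂ :=
  thetaProd τ h (b + k) 0 / (thetaProd τ h k 0 * thetaProd τ h b 0) *
    (theta1 (y + (b - k) * h) τ / (thetaProd τ h k y * theta1 y τ * thetaProd τ h b (-y)))

/-- The exponent by which `gammaShift τ η (a, b) y` differs from a product of theta functions. -/
def shiftPhase (τ η : ℂ) (a b : ℕ) (y : ℂ) : ℂ :=
  π * I * ((a + b + 2 * a * b) * y - η * (b * (b + 1) * (1 + 2 * a)) -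
    τ / 2 * (a * (a + 1) * (1 + 2 * b)) - a * b)

/-- The exponent by which `thetaFactor` changes under a shift by `s(2η) + rτ`. -/
def thetaPhase (τ η y s r : ℂ) : ℂ :=
  π * I * (r - r ^ 2 * τ - 2 * r * (y + s * (2 * η)) + (s - s ^ 2 * (2 * η) - 2 * s * (y + r * τ)))

/-- The exponent by which `pinchCoeff τ η (b + k) (a + l) (a, b) z` differs from a product of two
quotients `thetaRatio`, normalized by powers of `R(τ)` and `R(2η)`. -/
def pinchPhase (τ η : ℂ) (a b k l : ℕ) (z : ℂ) : ℂ :=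
  shiftPhase τ η (a + l) (b + k) 0 - shiftPhase τ η a b 0 - shiftPhase τ η l k 0 -
    shiftPhase τ η l k (2 * z) - shiftPhase τ η a b (-(2 * z)) +
    thetaPhase τ η (2 * z) (b - k) (a - l)

section

variable {τ η : ℂ}

theorem prod_expTheta (τ h y : ℂ) (b n : ℕ) :
    ∏ i ∈ Finset.range n, expTheta τ (y - b * τ - h * (i + 1)) =
      exp (π * I * ((1 + 2 * b) * (n * y - h * (n * (n + 1) / 2)) - n * b * (1 + (b + 1) * τ))) *
        (constR τ ^ n * thetaProd τ h n y) := by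
  induction n with
  | zero => simp [thetaProd]
  | succ n ih =>
    have hshift := theta1_add_int_mul (-b) (y - h * (n + 1)) τ
    rw [show y - h * (n + 1) + (-b : ℤ) * τ = y - b * τ - h * (n + 1) by push_cast; ring] at hshift
    have hexp : exp (π * I * ((1 + 2 * b) * (n * y - h * (n * (n + 1) / 2)) -
          n * b * (1 + (b + 1) * τ))) * (exp (π * I * (y - b * τ - h * (n + 1))) *
        exp (π * I * ((-b : ℤ) - (-b : ℤ) ^ 2 * τ - 2 * (-b : ℤ) * (y - h * (n + 1))))) =
        exp (π * I * ((1 + 2 * b) * ((n + 1 : ℕ) * y - h * ((n + 1 : ℕ) * ((n + 1 : ℕ) + 1) / 2)) -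
          (n + 1 : ℕ) * b * (1 + (b + 1) * τ))) := by
      rw [← exp_add, ← exp_add]
      push_cast
      ring_nf
    rw [Finset.prod_range_succ, ih, expTheta, hshift, ← hexp, thetaProd, thetaProd,
      Finset.prod_range_succ]
    ring

theorem gammaShift_eq_exp_mul_thetaProd (a b : ℕ) (y : ℂ) :
    gammaShift τ η (a, b) y =
      exp (shiftPhase τ η a b y) * (constR τ ^ b * constR (2 * η) ^ a *
        (thetaProd τ (2 * η) b y * thetaProd (2 * η) τ a y)) := by
  have hfst := prod_expTheta τ (2 * η) y 0 b
  rw [Nat.cast_zero, zero_mul, sub_zero] at hfst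
  rw [gammaShift, hfst, prod_expTheta, mul_mul_mul_comm, ← exp_add, shiftPhase]
  ring_nf

theorem thetaFactor_add_int_mul_div (hτ : 0 < τ.im) (hη : 0 < η.im) (y : ℂ) (s r : ℤ) :
    thetaFactor τ η (y + s * (2 * η) + r * τ) / thetaFactor τ η y =
      exp (thetaPhase τ η y s r) * (theta1 (y + s * (2 * η)) τ / theta1 y τ *
        (theta1 (y + r * τ) (2 * η) / theta1 y (2 * η))) := by
  have hR := constR_ne_zero hτ
  have hR' : constR (2 * η) ≠ 0 := constR_ne_zero (by simpa using hη)
  have hexp : exp (thetaPhase τ η y s r) =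
      exp (π * I * (r - r ^ 2 * τ - 2 * r * (y + s * (2 * η)))) *
        exp (π * I * (s - s ^ 2 * (2 * η) - 2 * s * (y + r * τ))) := by
    rw [thetaPhase, mul_add, exp_add]
  rw [thetaFactor, theta1_add_int_mul, add_right_comm, theta1_add_int_mul, thetaFactor,
    neg_div_neg_eq, mul_div_mul_comm, mul_div_mul_left _ _ hR, mul_div_mul_left _ _ hR', hexp]
  ring

theorem prod_Icc_theta1_eq_thetaProd (τ h : ℂ) (n : ℕ) :
    ∏ j ∈ Finset.Icc 1 n, theta1 (h * j) τ = (-1) ^ n * thetaProd τ h n 0 := by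
  induction n with
  | zero => simp [thetaProd]
  | succ n ih =>
    rw [Finset.prod_Icc_succ_top (by omega), ih, thetaProd, thetaProd, Finset.prod_range_succ,
      pow_succ, zero_sub, theta1_neg, Nat.cast_add, Nat.cast_one]
    ring

theorem prod_range_theta1_eq_thetaProd (τ h y : ℂ) (b k : ℕ) :
    ∏ j ∈ Finset.range (b + k + 1), theta1 (y - h * (k - j)) τ =
      (-1) ^ b * (thetaProd τ h k y * theta1 y τ * thetaProd τ h b (-y)) := by
  have hlow : ∏ j ∈ Finset.range k, theta1 (y - h * (k - j)) τ = thetaProd τ h k y := by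
    rw [thetaProd, ← Finset.prod_range_reflect]
    refine Finset.prod_congr rfl fun j hj => ?_
    rw [Nat.sub_sub, Nat.cast_sub (by have := Finset.mem_range.mp hj; omega)]
    push_cast
    ring_nf
  have hhigh (i : ℕ) : theta1 (y - h * (k - (k + (i + 1) : ℕ))) τ =
      -1 * theta1 (-y - h * (i + 1)) τ := by
    rw [neg_one_mul, ← theta1_neg]
    push_cast
    ring_nf
  rw [show b + k + 1 = k + (b + 1) by omega, Finset.prod_range_add, Finset.prod_range_succ', hlow]
  simp only [hhigh, Finset.prod_mul_distrib, Finset.prod_const, Finset.card_range, add_zero,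
    sub_self, mul_zero, sub_zero]
  rw [thetaProd, thetaProd]
  ring

theorem alphaCoeff_eq_thetaRatio (τ η : ℂ) (b k : ℕ) (z : ℂ) :
    alphaCoeff τ η (b + k) k z =
      (-1) ^ b * (constA τ η ^ (b + k) * thetaRatio τ (2 * η) b k (2 * z)) := by
  have hsign : ((-1 : ℂ) ^ b)⁻¹ = (-1) ^ b := by rw [← inv_pow, inv_neg_one]
  have hpow : (-1 : ℂ) ^ (b + k) ≠ 0 := pow_ne_zero _ (neg_ne_zero.mpr one_ne_zero)
  rw [alphaCoeff, ellBinom, prod_range_theta1_eq_thetaProd, Nat.add_sub_cancel,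
    prod_Icc_theta1_eq_thetaProd, prod_Icc_theta1_eq_thetaProd, prod_Icc_theta1_eq_thetaProd,
    mul_mul_mul_comm ((-1) ^ k), ← pow_add, add_comm k b, mul_div_mul_left _ _ hpow,
    ← div_div _ ((-1 : ℂ) ^ b), div_eq_mul_inv _ ((-1 : ℂ) ^ b), hsign, thetaRatio,
    show 2 * z + 2 * η * ((b + k : ℕ) - 2 * k) = 2 * z + (b - k) * (2 * η) by push_cast; ring]
  ring

theorem betaCoeff_eq_thetaRatio (τ η : ℂ) (a l : ℕ) (z : ℂ) :
    betaCoeff τ η (a + l) l z =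
      (-1) ^ a * (constB τ η ^ (a + l) * thetaRatio (2 * η) τ a l (2 * z)) := by
  rw [betaCoeff_eq_alphaCoeff, alphaCoeff_eq_thetaRatio, constA, constB,
    mul_div_cancel₀ τ (two_ne_zero' ℂ)]

theorem latProd_empty_exp_add_ne_zero (hτ : 0 < τ.im) (hη : 0 < η.im) {y : ℂ}
    (hy : ∀ a b c : ℤ, y ≠ a + b * τ + c * (2 * η)) : latProd τ η ∅ e(τ + 2 * η + y) ≠ 0 := by
  rw [Ne, latProd_exp_eq_zero_iff hτ hη]
  rintro ⟨j, -, a, ha⟩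
  rw [latPoint] at ha
  exact hy a (-(1 + j.1)) (-(1 + j.2)) (by push_cast; linear_combination ha)

theorem pinchCoeff_eq_gammaShift (hτ : 0 < τ.im) (hη : 0 < η.im) (hinc : Incommensurable τ η)
    {z : ℂ} (hz : ∀ a b c : ℤ, 2 * z ≠ a + b * τ + c * (2 * η)) (a b k l : ℕ) :
    pinchCoeff τ η (b + k) (a + l) (a, b) z =
      gammaShift τ η (a + l, b + k) 0 / (gammaShift τ η (a, b) 0 * gammaShift τ η (l, k) 0) *
        (thetaFactor τ η (2 * z + (b - k : ℤ) * (2 * η) + (a - l : ℤ) * τ) /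
          thetaFactor τ η (2 * z)) /
        (gammaShift τ η (l, k) (2 * z) * gammaShift τ η (a, b) (-(2 * z))) := by
  have hz' : ∀ a b c : ℤ, -(2 * z) ≠ a + b * τ + c * (2 * η) := fun a b c h =>
    hz (-a) (-b) (-c) (by push_cast; linear_combination -h)
  have hshift := gammaShift_ne_zero hτ hη (fun a b c h => absurd h (hz a b c)) (l, k)
  have hshift' := gammaShift_ne_zero hτ hη (fun a b c h => absurd h (hz' a b c)) (a, b)
  have hgamma := ellGamma_sub_latPoint_mul_gammaShift hτ hη hshift
  have hgamma' := ellGamma_sub_latPoint_mul_gammaShift hτ hη hshift'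
  have hfactor := inv_ellGamma_mul_ellGamma_neg hτ hη (latProd_empty_exp_add_ne_zero hτ hη hz)
    (by simpa only [sub_eq_add_neg] using latProd_empty_exp_add_ne_zero hτ hη hz')
  have hres (j : ℕ × ℕ) : gammaResidue τ η j = gammaResidue τ η (0, 0) / gammaShift τ η j 0 :=
    eq_div_of_mul_eq (hinc.gammaShift_zero_ne_zero hτ hη j)
      (gammaResidue_mul_gammaShift hτ hη hinc j)
  have hone := gammaResidue_zero_mul hτ hη
  have hres₀ := left_ne_zero_of_mul_eq_one hone
  have harg : thetaFactor τ η (2 * ((b + k : ℕ) * η + (a + l : ℕ) * (τ / 2) - z -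
      latPoint τ η (a, b))) =
        thetaFactor τ η (2 * z + (b - k : ℤ) * (2 * η) + (a - l : ℤ) * τ) := by
    rw [← thetaFactor_neg, latPoint]
    push_cast
    ring_nf
  have hshift₀ := hinc.gammaShift_zero_ne_zero hτ hη
  rw [pinchCoeff, harg, ← hfactor, ← hgamma, ← hgamma', boxReflect, Nat.add_sub_cancel_left,
    Nat.add_sub_cancel_left, hres (a, b), hres (l, k), hres (a + l, b + k)]
  have hshift_ab := hshift₀ (a, b)
  have hshift_lk := hshift₀ (l, k)
  have hshift_nm := hshift₀ (a + l, b + k)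
  generalize thetaFactor τ η _ = F
  generalize ellGamma τ η (2 * z - _) = G
  generalize ellGamma τ η _ = G'
  field_simp [hres₀]
  linear_combination (F * G * G') * hone

theorem pinchCoeff_eq_exp_mul_thetaRatio (hτ : 0 < τ.im) (hη : 0 < η.im)
    (hinc : Incommensurable τ η) {z : ℂ} (hz : ∀ a b c : ℤ, 2 * z ≠ a + b * τ + c * (2 * η))
    (a b k l : ℕ) :
    pinchCoeff τ η (b + k) (a + l) (a, b) z =
      exp (pinchPhase τ η a b k l z) * (thetaRatio τ (2 * η) b k (2 * z) / constR τ ^ (b + k)) *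
        (thetaRatio (2 * η) τ a l (2 * z) / constR (2 * η) ^ (a + l)) := by
  have hconst : constR τ ^ b * constR (2 * η) ^ a * (constR τ ^ k * constR (2 * η) ^ l) ≠ 0 :=
    mul_ne_zero
      (mul_ne_zero (pow_ne_zero b (constR_ne_zero hτ))
        (pow_ne_zero a (constR_ne_zero (by simpa using hη))))
      (mul_ne_zero (pow_ne_zero k (constR_ne_zero hτ))
        (pow_ne_zero l (constR_ne_zero (by simpa using hη))))
  have hquot : gammaShift τ η (a + l, b + k) 0 /
        (gammaShift τ η (a, b) 0 * gammaShift τ η (l, k) 0) =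
      exp (shiftPhase τ η (a + l) (b + k) 0) /
          (exp (shiftPhase τ η a b 0) * exp (shiftPhase τ η l k 0)) *
        (thetaProd τ (2 * η) (b + k) 0 * thetaProd (2 * η) τ (a + l) 0 /
          (thetaProd τ (2 * η) b 0 * thetaProd (2 * η) τ a 0 *
            (thetaProd τ (2 * η) k 0 * thetaProd (2 * η) τ l 0))) := by
    rw [gammaShift_eq_exp_mul_thetaProd, gammaShift_eq_exp_mul_thetaProd,
      gammaShift_eq_exp_mul_thetaProd, mul_mul_mul_comm (exp (shiftPhase τ η a b 0)),
      mul_mul_mul_comm (constR τ ^ b * constR (2 * η) ^ a), pow_add, pow_add,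
      mul_mul_mul_comm (constR τ ^ b), mul_div_mul_comm, mul_div_mul_left _ _ hconst]
  rw [pinchCoeff_eq_gammaShift hτ hη hinc hz, hquot, thetaFactor_add_int_mul_div hτ hη]
  simp only [gammaShift_eq_exp_mul_thetaProd, thetaRatio, pinchPhase, exp_sub, exp_add, pow_add,
    div_eq_mul_inv, mul_inv, Int.cast_sub, Int.cast_natCast]
  ring

theorem exp_pinchPhase (τ η : ℂ) (a b k l : ℕ) (z : ℂ) {n m : ℕ} (hn : n = b + k)
    (hm : m = a + l) :
    exp (pinchPhase τ η a b k l z) = (-1) ^ (n * m) * (-1) ^ n * (-1) ^ m *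
      exp (n * (π * I * η)) * exp (m * (π * I * (τ / 2))) *
      exp (-(π * I * τ / 2 * m ^ 2 * n) - π * I * η * n ^ 2 * m) *
      exp ((n - 1) * (m - 2 * l) *
        (π * I * τ / 2 * (m - 2 * l) + 2 * π * I * (z + (n - 2 * k) * η))) *
      exp ((m - 1) * (n - 2 * k) *
        (π * I * η * (n - 2 * k) + 2 * π * I * (z + (m - 2 * l) * (τ / 2)))) := by
  have hsign (N : ℕ) : (-1 : ℂ) ^ N = exp (N * (π * I)) := by rw [exp_nat_mul, exp_pi_mul_I]
  subst hn hm
  simp only [hsign, ← exp_add]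
  rw [exp_eq_exp_iff_exists_int]
  refine ⟨-(b * l + k * a + l + k), ?_⟩
  simp only [pinchPhase, shiftPhase, thetaPhase]
  push_cast
  ring

theorem pinchCoeff_eq_alphaCoeff_mul_betaCoeff (hτ : 0 < τ.im) (hη : 0 < η.im)
    (hinc : Incommensurable τ η) {z : ℂ} (hz : ∀ a b c : ℤ, 2 * z ≠ a + b * τ + c * (2 * η))
    {n m k l : ℕ} (hk : k ≤ n) (hl : l ≤ m) :
    pinchCoeff τ η n m (m - l, n - k) z =
      (-1) ^ (n * m) * exp (-(π * I * τ / 2 * m ^ 2 * n) - π * I * η * n ^ 2 * m) *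
        ((-1) ^ k * alphaCoeff τ η n k z * ((-1) ^ l * betaCoeff τ η m l z *
          exp ((n - 1) * (m - 2 * l) *
            (π * I * τ / 2 * (m - 2 * l) + 2 * π * I * (z + (n - 2 * k) * η))) *
          exp ((m - 1) * (n - 2 * k) *
            (π * I * η * (n - 2 * k) + 2 * π * I * (z + (m - 2 * l) * (τ / 2)))))) := by
  obtain ⟨b, rfl⟩ := Nat.exists_eq_add_of_le' hk
  obtain ⟨a, rfl⟩ := Nat.exists_eq_add_of_le' hl
  rw [Nat.add_sub_cancel, Nat.add_sub_cancel, pinchCoeff_eq_exp_mul_thetaRatio hτ hη hinc hz,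
    exp_pinchPhase τ η a b k l z rfl rfl, alphaCoeff_eq_thetaRatio, betaCoeff_eq_thetaRatio,
    constA, constB, div_pow, div_pow, ← exp_nat_mul, ← exp_nat_mul, pow_add (-1 : ℂ) b k,
    pow_add (-1 : ℂ) a l]
  ring

theorem sum_pinchCoeff_eq_normalOrderedM (hτ : 0 < τ.im) (hη : 0 < η.im)
    (hinc : Incommensurable τ η) {z : ℂ} (hz : ∀ a b c : ℤ, 2 * z ≠ a + b * τ + c * (2 * η))
    {Φ : ℂ → ℂ} (heven : ∀ x, Φ (-x) = Φ x) (n m : ℕ) :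
    ∑ j ∈ pinchBox n m, pinchCoeff τ η n m j z *
        Φ (n * η + m * (τ / 2) - z - latPoint τ η j) = normalOrderedM τ η n m Φ z := by
  simp only [normalOrderedM, Finset.mul_sum]
  rw [Finset.sum_comm, ← Finset.sum_product']
  refine Finset.sum_nbij' (boxReflect n m) (boxReflect n m) (fun j _ => boxReflect_mem n m j)
    (fun j _ => boxReflect_mem n m j) (fun j hj => boxReflect_boxReflect hj)
    (fun j hj => boxReflect_boxReflect hj) fun j hj => ?_
  obtain ⟨hl, hk⟩ := mem_pinchBox.mp (boxReflect_mem n m j)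
  have hj' : j = (m - (boxReflect n m j).1, n - (boxReflect n m j).2) :=
    (boxReflect_boxReflect hj).symm
  generalize boxReflect n m j = p at *
  have harg : n * η + m * (τ / 2) - z - latPoint τ η j =
      -(z + ((n - 2 * p.2) * η + (m - 2 * p.1) * (τ / 2))) := by
    rw [hj', latPoint, Nat.cast_sub hl, Nat.cast_sub hk]
    ring
  rw [harg, heven, hj', pinchCoeff_eq_alphaCoeff_mul_betaCoeff hτ hη hinc hz hk hl]
  ring

end

end EllipticDouble

end

theorem mainTheorem5 (τ η : ℂ) (hτ : 0 < τ.im) (hη : 0 < η.im)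
    (hinc : LinearIndependent ℚ ![(1 : ℂ), 2 * η, τ]) (n m : ℕ) :
    (∀ Φ : ℂ → ℂ, Differentiable ℂ Φ → (∀ x, Φ (x + 1) = Φ x) → (∀ x, Φ (-x) = Φ x) →
      ∀ z : ℂ, (∀ a b c : ℤ, 2 * z ≠ a + b * τ + c * (2 * η)) →
        EllipticDouble.IntertwinerValue τ η (n * η + m * (τ / 2)) Φ z
          (EllipticDouble.normalOrderedM τ η n m Φ z)) ∧
    (∀ k : ℕ, k = 3 ∨ k = 4 → ∀ z : ℂ, EllipticDouble.RegularPoint τ η k n m z →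
      ∀ f : ℂ → ℂ,
        EllipticDouble.factorizedM τ η k n m f z =
          EllipticDouble.normalOrderedM τ η n m f z) := by
  have hinc' := EllipticDouble.Incommensurable.of_linearIndependent hinc
  refine ⟨fun Φ hΦ hper heven z hz => ?_, fun k _ z hz f =>
    EllipticDouble.factorizedM_eq_normalOrderedM hτ hη hinc' f hz⟩
  rw [← EllipticDouble.sum_pinchCoeff_eq_normalOrderedM hτ hη hinc' hz heven]
  exact EllipticDouble.intertwinerValue_sum_pinchCoeff hτ hη hinc' hΦ hper heven hz n m
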